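/- Let $\Bbbk$ be an algebraically closed field of characteristic zero. *Connections.* Let $\mathcal{C}_\infty$ be the category of pairs $(V,\nabla_\zeta)$, where $V$ is a finite-dimensional vector space over $\Bbbk((\zeta))$ and $\nabla_\zeta:V\to V$ is $\Bbbk$-linear with $\nabla_\zeta(fv)=f\nabla_\zeta(v)+\frac{df}{d\zeta}v$; morphisms are the $\Bbbk((\zeta))$-linear maps commuting with the connections. Put $z=\zeta^{-1}$ and $\nabla=\nabla_z=-\zeta^2\nabla_\zeta$. For $q\ge 1$ and $f\in\Bbbk((\zeta^{1/q}))$ let $E_f=\bigl(\Bbbk((\zeta^{1/q})),\frac{d}{d\zeta}+\zeta^{-1}f\bigr)$; every irreducible object of $\mathcal{C}_\infty$ is isomorphic to some $E_f$, and its slope is $\max(0,-\mathrm{ord}(f))$, where $\mathrm{ord}(\zeta)=1$. Let $\mathcal{C}_\infty^{>0}$ be the full subcategory of the objects all of whose irreducible components (Jordan–Hölder factors) have positive slope. *Difference operators.* Let $\varphi$ be the automorphism $\theta\mapsto\frac{\theta}{1+\theta}$ of $\Bbbk((\theta))$, extended to $\Bbbk((\theta^{1/q}))$ by $\theta^{1/q}\mapsto\theta^{1/q}(1+\theta)^{-1/q}$.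 Let $\mathcal{N}$ be the category of pairs $(V,\Phi)$, where $V$ is a finite-dimensional vector space over $\Bbbk((\theta))$ and $\Phi:V\to V$ is $\Bbbk$-linear and bijective with $\Phi(fv)=\varphi(f)\Phi(v)$; morphisms are the $\Bbbk((\theta))$-linear maps commuting with the operators $\Phi$. For $0\ne g\in\Bbbk((\theta^{1/q}))$ let $D_g=\bigl(\Bbbk((\theta^{1/q})),g\varphi\bigr)$; every irreducible object of $\mathcal{N}$ is isomorphic to some $D_g$, and its order is $\mathrm{ord}(g)$, where $\mathrm{ord}(\theta)=1$. Let $\mathcal{N}^{<0}$ be the full subcategory of the objects all of whose irreducible components have negative order. **Theorem.** For every $E=(V,\nabla)\in\mathcal{C}_\infty^{>0}$ the operator $z\nabla$ on $V$ is invertible, and $\theta:=-(z\nabla)^{-1}$ extends to a structure of finite-dimensional $\Bbbk((\theta))$-vector space $V_\theta$ on $V$ whose $\theta$-adic topology is the $\zeta$-adic topology of $V$ (this determines the structure). With $\Phi:=z$, the object $\mathcal{M}^{(\infty,\infty)}(E):=(V_\theta,\Phi)$ belongs to $\mathcal{N}^{<0}$, and $\mathcal{M}^{(\infty,\infty)}$,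 acting as the identity on the underlying maps of morphisms, is an equivalence of categories $$\mathcal{M}^{(\infty,\infty)}:\ \mathcal{C}_\infty^{>0}\ \xrightarrow{\ \sim\ }\ \mathcal{N}^{<0}.$$ The functor with this description is unique up to isomorphism. -/

import Mathlib

open CategoryTheory

universe u

noncomputable section

namespace LocalMellin

/-! ### Laurent series: substitutions, ramification, derivative -/

section Series

variable {k : Type u} [Field k]

/-- The ring homomorphism `k[[x]] → k((x))`, `p ↦ p(s(x))`, for a power series `s` without constant
term. -/
def substCoe (s : PowerSeries k) (h0 : PowerSeries.constantCoeff s = 0) :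
    PowerSeries k →+* LaurentSeries k :=
  (HahnSeries.ofPowerSeries ℤ k).comp
    (PowerSeries.substAlgHom (R := k) (PowerSeries.HasSubst.of_constantCoeff_zero' h0)).toRingHom

theorem substCoe_apply (s : PowerSeries k) (h0 : PowerSeries.constantCoeff s = 0)
    (p : PowerSeries k) : substCoe s h0 p = HahnSeries.ofPowerSeries ℤ k (p.subst s) := by
  simp [substCoe, PowerSeries.coe_substAlgHom]

theorem isUnit_substCoe_X (s : PowerSeries k) (h0 : PowerSeries.constantCoeff s = 0)
    (hs : s ≠ 0) : IsUnit (substCoe s h0 PowerSeries.X) := by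
  rw [substCoe_apply, PowerSeries.subst_X (PowerSeries.HasSubst.of_constantCoeff_zero' h0),
    isUnit_iff_ne_zero]
  exact fun h => hs (HahnSeries.ofPowerSeries_injective (by rw [h, map_zero]))

/-- The substitution `x ↦ s(x)` on `k((x))`, where `s` is a nonzero power series without
constant term. -/
def substHom (s : PowerSeries k) (h0 : PowerSeries.constantCoeff s = 0) (hs : s ≠ 0) :
    LaurentSeries k →+* LaurentSeries k :=
  IsLocalization.Away.lift (S := LaurentSeries k) (PowerSeries.X : PowerSeries k)
    (isUnit_substCoe_X s h0 hs)

theorem substHom_coe (s : PowerSeries k) (h0 : PowerSeries.constantCoeff s = 0) (hs : s ≠ 0)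
    (p : PowerSeries k) :
    substHom s h0 hs (HahnSeries.ofPowerSeries ℤ k p) =
      HahnSeries.ofPowerSeries ℤ k (p.subst s) := by
  have := IsLocalization.Away.lift_eq (S := LaurentSeries k) (PowerSeries.X : PowerSeries k)
    (isUnit_substCoe_X s h0 hs) p
  rw [LaurentSeries.coe_algebraMap] at this
  exact this.trans (substCoe_apply s h0 p)

/-- Ring endomorphisms of `k((x))` that agree on `k[[x]]` are equal. -/
theorem ringHom_ext {f g : LaurentSeries k →+* LaurentSeries k}
    (h : ∀ p : PowerSeries k, f (HahnSeries.ofPowerSeries ℤ k p) =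
      g (HahnSeries.ofPowerSeries ℤ k p)) : f = g := by
  refine IsLocalization.ringHom_ext (Submonoid.powers (PowerSeries.X : PowerSeries k)) ?_
  ext p
  rw [RingHom.comp_apply, RingHom.comp_apply, LaurentSeries.coe_algebraMap, h]

/-- Multiplication by `a`, as a `k`-linear operator on `k((x))`. -/
def mulOp (a : LaurentSeries k) : LaurentSeries k →ₗ[k] LaurentSeries k where
  toFun v := a * v
  map_add' := mul_add a
  map_smul' c v := by
    rw [RingHom.id_apply, ← HahnSeries.C_mul_eq_smul, ← HahnSeries.C_mul_eq_smul, mul_left_comm]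

theorem mulOp_apply (a v : LaurentSeries k) : mulOp a v = a * v := rfl

/-- The embedding `k((x)) → k((t))`, `x ↦ t ^ q`, that is `t = x ^ (1/q)`. -/
def ramify (k : Type u) [Field k] (q : ℕ+) : LaurentSeries k →+* LaurentSeries k :=
  HahnSeries.embDomainRingHom (AddMonoidHom.mulLeft ((q : ℕ) : ℤ))
    (fun a b h => by
      have hq : ((q : ℕ) : ℤ) ≠ 0 := by exact_mod_cast q.ne_zero
      exact mul_left_cancel₀ hq h)
    (fun a b => by
      have hq : (0 : ℤ) < ((q : ℕ) : ℤ) := by exact_mod_cast q.pos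
      exact mul_le_mul_iff_right₀ hq)

theorem ramify_coeff_mul (q : ℕ+) (f : LaurentSeries k) (n : ℤ) :
    (ramify k q f).coeff (((q : ℕ) : ℤ) * n) = f.coeff n :=
  HahnSeries.embDomain_mk_coeff (f := fun n : ℤ => ((q : ℕ) : ℤ) * n) _ _

theorem ramify_coeff_of_not_dvd (q : ℕ+) (f : LaurentSeries k) (n : ℤ)
    (h : ¬ ((q : ℕ) : ℤ) ∣ n) : (ramify k q f).coeff n = 0 := by
  refine HahnSeries.embDomain_of_notMem_range ?_
  rintro ⟨m, rfl⟩
  exact h (Dvd.intro _ rfl)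

theorem ramify_C (q : ℕ+) (c : k) : ramify k q (HahnSeries.C c) = HahnSeries.C c := by
  ext n
  by_cases h : ((q : ℕ) : ℤ) ∣ n
  · obtain ⟨m, rfl⟩ := h
    rw [ramify_coeff_mul]
    have hq : ((q : ℕ) : ℤ) ≠ 0 := by exact_mod_cast q.ne_zero
    by_cases hm : m = 0
    · simp [hm]
    · simp [HahnSeries.C_apply, HahnSeries.coeff_single_of_ne, hm]
  · rw [ramify_coeff_of_not_dvd q _ _ h, HahnSeries.C_apply, HahnSeries.coeff_single_of_ne]
    rintro rfl
    exact h (dvd_zero _)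

theorem ramify_coe (q : ℕ+) (p : PowerSeries k) :
    ramify k q (HahnSeries.ofPowerSeries ℤ k p) =
      HahnSeries.ofPowerSeries ℤ k (p.subst (PowerSeries.X ^ (q : ℕ) : PowerSeries k)) := by
  have hq : (0 : ℤ) < ((q : ℕ) : ℤ) := by exact_mod_cast q.pos
  ext n
  rw [PowerSeries.coeff_coe]
  by_cases h : ((q : ℕ) : ℤ) ∣ n
  · obtain ⟨m, rfl⟩ := h
    rw [ramify_coeff_mul, PowerSeries.coeff_coe]
    by_cases hm : m < 0
    · rw [if_pos hm, if_pos (mul_neg_of_pos_of_neg hq hm)]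
    · rw [if_neg hm, if_neg (by push Not at hm ⊢; positivity), PowerSeries.coeff_subst_X_pow q.ne_zero]
      rw [Int.natAbs_mul, Int.natAbs_natCast, if_pos (dvd_mul_right _ _),
        Nat.mul_div_cancel_left _ q.pos]
      simp
  · rw [ramify_coeff_of_not_dvd q _ _ h]
    split_ifs with hn
    · rfl
    · rw [PowerSeries.coeff_subst_X_pow q.ne_zero, if_neg]
      rwa [← Int.natCast_dvd]

theorem single_one_mul_derivative_coeff (f : LaurentSeries k) (n : ℤ) :
    (HahnSeries.single (1 : ℤ) (1 : k) * LaurentSeries.derivative k f).coeff n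
      = (n : k) * f.coeff n := by
  have := HahnSeries.coeff_single_mul_add (r := (1 : k)) (x := LaurentSeries.derivative k f)
    (a := n - 1) (b := (1 : ℤ))
  rw [sub_add_cancel] at this
  rw [this, LaurentSeries.derivative_apply, LaurentSeries.hasseDeriv_coeff]
  simp

theorem single_one_ne_zero : (HahnSeries.single (1 : ℤ) (1 : k)) ≠ 0 := by simp

theorem derivative_mul (f g : LaurentSeries k) :
    LaurentSeries.derivative k (f * g) =
      f * LaurentSeries.derivative k g + LaurentSeries.derivative k f * g := by
  have key : ∀ f : LaurentSeries k,
      (HahnSeries.single (1 : ℤ) (1 : k) * LaurentSeries.derivative k f).support ⊆ f.support := by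
    intro f n hn h0
    apply hn
    rw [single_one_mul_derivative_coeff, h0, mul_zero]
  apply mul_left_cancel₀ (single_one_ne_zero (k := k))
  rw [mul_add, mul_left_comm, ← mul_assoc _ (LaurentSeries.derivative k f)]
  ext n
  rw [single_one_mul_derivative_coeff, HahnSeries.coeff_add, HahnSeries.coeff_mul,
    HahnSeries.coeff_mul_right' g.isPWO_support (key g),
    HahnSeries.coeff_mul_left' f.isPWO_support (key f), Finset.mul_sum, ← Finset.sum_add_distrib]
  refine Finset.sum_congr rfl fun ij hij => ?_
  rw [single_one_mul_derivative_coeff, single_one_mul_derivative_coeff,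
    ← (Finset.mem_antidiagonal.1 hij).2.2]
  push_cast
  ring

theorem derivative_ramify (q : ℕ+) (f : LaurentSeries k) :
    LaurentSeries.derivative k (ramify k q f) =
      HahnSeries.single (((q : ℕ) : ℤ) - 1) ((q : ℕ) : k) *
        ramify k q (LaurentSeries.derivative k f) := by
  have h1 : ramify k q (HahnSeries.single (1 : ℤ) (1 : k)) =
      HahnSeries.single (((q : ℕ) : ℤ)) (1 : k) := by
    refine (HahnSeries.embDomain_single (f := ⟨⟨fun n : ℤ => ((q : ℕ) : ℤ) * n, ?_⟩, ?_⟩)).trans ?_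
    change HahnSeries.single (((q : ℕ) : ℤ) * 1) (1 : k) = _
    rw [mul_one]
  have h2 : ramify k q (HahnSeries.single (1 : ℤ) (1 : k) * LaurentSeries.derivative k f) =
      HahnSeries.single (((q : ℕ) : ℤ)) (1 : k) * ramify k q (LaurentSeries.derivative k f) := by
    rw [map_mul, h1]
  apply mul_left_cancel₀ (single_one_ne_zero (k := k))
  have h3 : HahnSeries.single (1 : ℤ) (1 : k) * (HahnSeries.single (((q : ℕ) : ℤ) - 1) ((q : ℕ) : k) *
        ramify k q (LaurentSeries.derivative k f)) = HahnSeries.C ((q : ℕ) : k) *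
        ramify k q (HahnSeries.single (1 : ℤ) (1 : k) * LaurentSeries.derivative k f) := by
    rw [h2, ← mul_assoc, ← mul_assoc, HahnSeries.C_apply, HahnSeries.single_mul_single,
      HahnSeries.single_mul_single]
    simp
  rw [h3]
  ext n
  rw [single_one_mul_derivative_coeff, HahnSeries.C_mul_eq_smul, HahnSeries.coeff_smul,
    smul_eq_mul]
  by_cases h : ((q : ℕ) : ℤ) ∣ n
  · obtain ⟨m, rfl⟩ := h
    rw [ramify_coeff_mul, ramify_coeff_mul, single_one_mul_derivative_coeff]
    push_cast
    ring
  · rw [ramify_coeff_of_not_dvd q _ _ h, ramify_coeff_of_not_dvd q _ _ h, mul_zero, mul_zero]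

theorem substHom_comp (s s' : PowerSeries k) (h0 : PowerSeries.constantCoeff s = 0) (hs : s ≠ 0)
    (h0' : PowerSeries.constantCoeff s' = 0) (hs' : s' ≠ 0) (h : s'.subst s = PowerSeries.X)
    (f : LaurentSeries k) : substHom s h0 hs (substHom s' h0' hs' f) = f := by
  have : (substHom s h0 hs).comp (substHom s' h0' hs') = RingHom.id _ := by
    apply ringHom_ext
    intro p
    rw [RingHom.comp_apply, substHom_coe, substHom_coe, PowerSeries.subst_comp_subst_apply
      (PowerSeries.HasSubst.of_constantCoeff_zero' h0')
      (PowerSeries.HasSubst.of_constantCoeff_zero' h0), h, PowerSeries.X_subst, RingHom.id_apply]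
  exact RingHom.congr_fun this f

theorem substHom_bijective (s : PowerSeries k) (h0 : PowerSeries.constantCoeff s = 0) (hs : s ≠ 0)
    (h1 : PowerSeries.coeff 1 s = 1) : Function.Bijective (substHom s h0 hs) := by
  refine ⟨RingHom.injective _, fun f => ?_⟩
  have hu : IsUnit (PowerSeries.coeff 1 s) := by rw [h1]; exact isUnit_one
  have h3 : (s.substInvOfIsUnit hu).subst s = PowerSeries.X :=
    PowerSeries.subst_substInvOfIsUnit_left s h0 hu
  have h4 : PowerSeries.constantCoeff (s.substInvOfIsUnit hu) = 0 :=
    PowerSeries.constantCoeff_substInvOfIsUnit s hu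
  have h5 : s.substInvOfIsUnit hu ≠ 0 := by
    intro h
    have := PowerSeries.coeff_one_substInvOfIsUnit s hu
    rw [h, map_zero] at this
    exact (hu.unit⁻¹).ne_zero this.symm
  exact ⟨_, substHom_comp s _ h0 hs h4 h5 h3 f⟩

/-- The power series `x / (1 + x)`. -/
def shiftSeries (k : Type u) [Field k] : PowerSeries k :=
  PowerSeries.X * (1 + PowerSeries.X)⁻¹

theorem shiftSeries_constantCoeff : PowerSeries.constantCoeff (shiftSeries k) = 0 := by
  simp [shiftSeries]

theorem shiftSeries_ne_zero : shiftSeries k ≠ 0 := by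
  refine mul_ne_zero PowerSeries.X_ne_zero ?_
  rw [Ne, PowerSeries.inv_eq_zero]
  simp

/-- The automorphism `φ` of `k((θ))`, `θ ↦ θ / (1 + θ)`. -/
def phi (k : Type u) [Field k] : LaurentSeries k →+* LaurentSeries k :=
  substHom (shiftSeries k) shiftSeries_constantCoeff shiftSeries_ne_zero

theorem substHom_C (s : PowerSeries k) (h0 : PowerSeries.constantCoeff s = 0) (hs : s ≠ 0)
    (c : k) : substHom s h0 hs (HahnSeries.C c) = HahnSeries.C c := by
  rw [← HahnSeries.ofPowerSeries_C, substHom_coe]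
  congr 1
  exact PowerSeries.subst_C c

/-- The series in `x` formed by the coefficients of `v` at `t ^ (q * n + j)`. -/
def part (q : ℕ+) (v : LaurentSeries k) (j : ℕ) : LaurentSeries k where
  coeff n := v.coeff (((q : ℕ) : ℤ) * n + j)
  isPWO_support' := by
    have hq : (0 : ℤ) < ((q : ℕ) : ℤ) := by exact_mod_cast q.pos
    refine (BddBelow.isWF ?_).isPWO
    refine ⟨-|v.order| - j, fun n hn => ?_⟩
    have h1 : v.order ≤ ((q : ℕ) : ℤ) * n + j := HahnSeries.order_le_of_coeff_ne_zero hn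
    by_contra h
    push Not at h
    have h2 : n < 0 := by have := abs_nonneg v.order; omega
    have h3 := neg_abs_le v.order
    nlinarith

theorem eq_sum_part (q : ℕ+) (v : LaurentSeries k) :
    v = ∑ j ∈ Finset.range (q : ℕ), ramify k q (part q v j) * HahnSeries.single (j : ℤ) (1 : k) := by
  have hq : (0 : ℤ) < ((q : ℕ) : ℤ) := by exact_mod_cast q.pos
  ext n
  have hterm : ∀ j : ℕ, (ramify k q (part q v j) *
      HahnSeries.single (j : ℤ) (1 : k)).coeff n =
      (ramify k q (part q v j)).coeff (n - j) := by
    intro j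
    have := HahnSeries.coeff_mul_single_add (r := (1 : k)) (x := ramify k q (part q v j))
      (a := n - j) (b := (j : ℤ))
    rwa [sub_add_cancel, mul_one] at this
  rw [HahnSeries.coeff_sum]
  simp only [hterm]
  have hr0 := Int.emod_nonneg n hq.ne'
  have hrq := Int.emod_lt_of_pos n hq
  have hdm := Int.mul_ediv_add_emod n ((q : ℕ) : ℤ)
  obtain ⟨r, hr⟩ := Int.eq_ofNat_of_zero_le hr0
  have hnr : n - (r : ℤ) = ((q : ℕ) : ℤ) * (n / ((q : ℕ) : ℤ)) := by omega
  rw [Finset.sum_eq_single r]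
  · rw [hnr, ramify_coeff_mul]
    change _ = v.coeff _
    congr 1
    omega
  · intro j hj hjr
    refine ramify_coeff_of_not_dvd q _ _ fun hd => hjr ?_
    have hj' : (j : ℤ) < ((q : ℕ) : ℤ) := by exact_mod_cast Finset.mem_range.1 hj
    have h1 : n % ((q : ℕ) : ℤ) = j % ((q : ℕ) : ℤ) :=
      ((Int.modEq_iff_dvd (a := (j : ℤ)) (b := n)).2 hd).symm
    rw [Int.emod_eq_of_lt (Int.natCast_nonneg j) hj', hr] at h1
    exact_mod_cast h1.symm
  · intro h
    exfalso
    apply h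
    rw [Finset.mem_range]
    omega

/-- `K_q = k((x^(1/q)))`, regarded as a vector space over `K = k((x))`; its elements are Laurent
series in `t = x^(1/q)`. -/
def RamExt (k : Type u) [Field k] (_q : ℕ+) : Type u := LaurentSeries k

instance (q : ℕ+) : AddCommGroup (RamExt k q) := inferInstanceAs (AddCommGroup (LaurentSeries k))

instance (q : ℕ+) : Module k (RamExt k q) := inferInstanceAs (Module k (LaurentSeries k))

instance (q : ℕ+) : Module (LaurentSeries k) (RamExt k q) :=
  Module.compHom (LaurentSeries k) (ramify k q)

theorem RamExt.smul_def (q : ℕ+) (c v : LaurentSeries k) :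
    (c • (show RamExt k q from v) : RamExt k q) = (ramify k q c * v : LaurentSeries k) := rfl

instance (q : ℕ+) : IsScalarTower k (LaurentSeries k) (RamExt k q) where
  smul_assoc c f v := by
    have h : ∀ v : LaurentSeries k, ramify k q (c • f) * v = c • (ramify k q f * v) := by
      intro v
      rw [← HahnSeries.C_mul_eq_smul, map_mul, ramify_C, mul_assoc, HahnSeries.C_mul_eq_smul]
    exact h v

instance (q : ℕ+) : FiniteDimensional (LaurentSeries k) (RamExt k q) := by
  classical
  let g : ℕ → RamExt k q := fun j => (HahnSeries.single (j : ℤ) (1 : k) : LaurentSeries k)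
  refine ⟨⟨(Finset.range q).image g, ?_⟩⟩
  rw [eq_top_iff]
  intro v _
  have hv : v = ∑ j ∈ Finset.range (q : ℕ), part q v j • g j := eq_sum_part q v
  rw [hv]
  refine Submodule.sum_mem _ fun j hj => Submodule.smul_mem _ _ (Submodule.subset_span ?_)
  exact Finset.mem_coe.2 (Finset.mem_image_of_mem g hj)

end Series

section Shift

variable {k : Type u} [Field k] [CharZero k]

/-- The power series `t * ∑ i, (-1/q choose i) * t ^ (q * i)`, that is `t * (1 + t ^ q) ^ (-1/q)`. -/
def shiftSeriesRam (k : Type u) [Field k] [CharZero k] (q : ℕ+) : PowerSeries k :=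
  PowerSeries.X * (PowerSeries.binomialSeries k (-(1 / (q : ℕ)) : ℚ)).subst
    (PowerSeries.X ^ (q : ℕ) : PowerSeries k)

theorem shiftSeriesRam_constantCoeff (q : ℕ+) :
    PowerSeries.constantCoeff (shiftSeriesRam k q) = 0 := by
  simp [shiftSeriesRam]

theorem shiftSeriesRam_coeff_one (q : ℕ+) :
    PowerSeries.coeff 1 (shiftSeriesRam k q) = 1 := by
  have := PowerSeries.coeff_succ_X_mul 0 ((PowerSeries.binomialSeries k (-(1 / (q : ℕ)) : ℚ)).subst
    (PowerSeries.X ^ (q : ℕ) : PowerSeries k))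
  rw [zero_add] at this
  rw [shiftSeriesRam, this, PowerSeries.coeff_subst_X_pow q.ne_zero]
  simp

theorem shiftSeriesRam_ne_zero (q : ℕ+) : shiftSeriesRam k q ≠ 0 := by
  intro h
  have := shiftSeriesRam_coeff_one (k := k) q
  rw [h, map_zero] at this
  exact zero_ne_one this

/-- The extension of `φ` to `k((θ^(1/q)))`: with `t = θ^(1/q)` it is
`t ↦ t * (1 + t ^ q) ^ (-1/q)`. -/
def phiRam (k : Type u) [Field k] [CharZero k] (q : ℕ+) : LaurentSeries k →+* LaurentSeries k :=
  substHom (shiftSeriesRam k q) (shiftSeriesRam_constantCoeff q) (shiftSeriesRam_ne_zero q)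

theorem phiRam_bijective (q : ℕ+) : Function.Bijective (phiRam k q) :=
  substHom_bijective _ _ _ (shiftSeriesRam_coeff_one q)

theorem binomialSeries_pow (r : ℚ) (n : ℕ) :
    PowerSeries.binomialSeries k r ^ n = PowerSeries.binomialSeries k ((n : ℚ) * r) := by
  induction n with
  | zero => simp
  | succ n ih =>
    rw [pow_succ, ih, ← PowerSeries.binomialSeries_add]
    congr 1
    push_cast
    ring

theorem binomialSeries_neg_one :
    PowerSeries.binomialSeries k (-1 : ℚ) = (1 + PowerSeries.X : PowerSeries k)⁻¹ := by
  rw [PowerSeries.eq_inv_iff_mul_eq_one (by simp)]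
  have h := PowerSeries.binomialSeries_nat (R := ℚ) (A := k) 1
  rw [pow_one] at h
  rw [← h, ← PowerSeries.binomialSeries_add]
  simp

theorem shiftSeriesRam_pow (q : ℕ+) :
    shiftSeriesRam k q ^ (q : ℕ) =
      (shiftSeries k).subst (PowerSeries.X ^ (q : ℕ) : PowerSeries k) := by
  have hX : PowerSeries.HasSubst (PowerSeries.X ^ (q : ℕ) : PowerSeries k) :=
    PowerSeries.HasSubst.X_pow q.ne_zero
  have hq : ((q : ℕ) : ℚ) ≠ 0 := by exact_mod_cast q.ne_zero
  rw [shiftSeriesRam, shiftSeries, mul_pow, ← PowerSeries.subst_pow hX, binomialSeries_pow,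
    PowerSeries.subst_mul hX, PowerSeries.subst_X hX, ← binomialSeries_neg_one]
  congr 3
  field_simp

theorem phiRam_ramify (q : ℕ+) (f : LaurentSeries k) :
    phiRam k q (ramify k q f) = ramify k q (phi k f) := by
  have hX : PowerSeries.HasSubst (PowerSeries.X ^ (q : ℕ) : PowerSeries k) :=
    PowerSeries.HasSubst.X_pow q.ne_zero
  have h1 := PowerSeries.HasSubst.of_constantCoeff_zero' (shiftSeriesRam_constantCoeff (k := k) q)
  have h2 := PowerSeries.HasSubst.of_constantCoeff_zero' (shiftSeries_constantCoeff (k := k))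
  have : (phiRam k q).comp (ramify k q) = (ramify k q).comp (phi k) := by
    apply ringHom_ext
    intro p
    rw [RingHom.comp_apply, RingHom.comp_apply, ramify_coe, phi, substHom_coe, ramify_coe, phiRam,
      substHom_coe, PowerSeries.subst_comp_subst_apply hX h1,
      PowerSeries.subst_comp_subst_apply h2 hX, PowerSeries.subst_pow h1, PowerSeries.subst_X h1,
      shiftSeriesRam_pow]
  exact RingHom.congr_fun this f

end Shift

/-! ### Connections -/

/-- A finite-dimensional vector space over `K = k((x))` with a connection `∇`, where `x` is the
local coordinate. -/
structure FormalConnection (k : Type u) [Field k] where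
  carrier : Type u
  [addCommGroup : AddCommGroup carrier]
  [moduleBase : Module k carrier]
  [module : Module (LaurentSeries k) carrier]
  [isScalarTower : IsScalarTower k (LaurentSeries k) carrier]
  [finiteDimensional : FiniteDimensional (LaurentSeries k) carrier]
  nabla : carrier →ₗ[k] carrier
  leibniz : ∀ (f : LaurentSeries k) (v : carrier),
    nabla (f • v) = f • nabla v + LaurentSeries.derivative k f • v

attribute [instance] FormalConnection.addCommGroup FormalConnection.moduleBase
  FormalConnection.module FormalConnection.isScalarTower FormalConnection.finiteDimensional

namespace FormalConnection

variable {k : Type u} [Field k]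

/-- Horizontal `K`-linear maps. -/
@[ext]
structure Hom (E E' : FormalConnection k) where
  toLinearMap : E.carrier →ₗ[LaurentSeries k] E'.carrier
  horizontal : ∀ v, toLinearMap (E.nabla v) = E'.nabla (toLinearMap v)

instance : Category (FormalConnection k) where
  Hom E E' := Hom E E'
  id E := ⟨LinearMap.id, fun _ => rfl⟩
  comp f g := ⟨g.toLinearMap.comp f.toLinearMap, fun v => by
    simp [f.horizontal, g.horizontal]⟩

/-- `E ≠ 0` and `E` has no `∇`-invariant subspaces other than `0` and `E`. -/
def IsIrreducible (E : FormalConnection k) : Prop :=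
  Nontrivial E.carrier ∧ ∀ W : Submodule (LaurentSeries k) E.carrier,
    (∀ w ∈ W, E.nabla w ∈ W) → W = ⊥ ∨ W = ⊤

/-- `S` is an irreducible component (Jordan–Hölder factor) of `E`: an irreducible quotient of a
subobject of `E`. -/
def IsIrreducibleComponent (S E : FormalConnection k) : Prop :=
  S.IsIrreducible ∧ ∃ (X : FormalConnection k) (i : X ⟶ E) (p : X ⟶ S),
    Function.Injective i.toLinearMap ∧ Function.Surjective p.toLinearMap

/-- The derivation `d/dx` of `k((x^(1/q)))`; in terms of `t = x^(1/q)` it is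
`(1/q) * t^(1-q) * d/dt`. -/
def derivRam (q : ℕ+) : LaurentSeries k →ₗ[k] LaurentSeries k :=
  mulOp (HahnSeries.single (1 - ((q : ℕ) : ℤ)) (((q : ℕ) : k)⁻¹)) ∘ₗ
    LaurentSeries.derivative k

theorem derivRam_apply (q : ℕ+) (v : LaurentSeries k) : derivRam q v =
    HahnSeries.single (1 - ((q : ℕ) : ℤ)) (((q : ℕ) : k)⁻¹) * LaurentSeries.derivative k v := rfl

theorem derivRam_ramify_mul [CharZero k] (q : ℕ+) (c v : LaurentSeries k) :
    derivRam q (ramify k q c * v) =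
      ramify k q c * derivRam q v + ramify k q (LaurentSeries.derivative k c) * v := by
  have hq : ((q : ℕ) : k) ≠ 0 := by exact_mod_cast q.ne_zero
  have h : HahnSeries.single (1 - ((q : ℕ) : ℤ)) (((q : ℕ) : k)⁻¹) *
      HahnSeries.single (((q : ℕ) : ℤ) - 1) ((q : ℕ) : k) = 1 := by
    rw [HahnSeries.single_mul_single, inv_mul_cancel₀ hq]
    simp
  rw [derivRam_apply, derivRam_apply, derivative_mul, derivative_ramify, mul_add, ← mul_assoc _ _ v,
    ← mul_assoc _ _ (ramify k q _), h, one_mul, mul_left_comm]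

/-- The operator `d/dx + x⁻¹ f` on `K_q`. -/
def nablaE (q : ℕ+) (f : LaurentSeries k) : LaurentSeries k →ₗ[k] LaurentSeries k :=
  derivRam q + mulOp (ramify k q (HahnSeries.single (-1) 1) * f)

theorem nablaE_ramify_mul [CharZero k] (q : ℕ+) (f c v : LaurentSeries k) :
    nablaE q f (ramify k q c * v) =
      ramify k q c * nablaE q f v + ramify k q (LaurentSeries.derivative k c) * v := by
  simp only [nablaE, LinearMap.add_apply, mulOp_apply, derivRam_ramify_mul]
  ring

/-- The connection `E_f = (K_q, d/dx + x⁻¹ f)` for `f ∈ K_q`. -/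
def E [CharZero k] (q : ℕ+) (f : LaurentSeries k) : FormalConnection k where
  carrier := RamExt k q
  nabla := (show RamExt k q →ₗ[k] RamExt k q from nablaE q f)
  leibniz := fun c v => nablaE_ramify_mul q f c v

/-- The irreducible connection `S` has slope `s`: it is isomorphic to some `E_f` with
`s = max (0, -ord f)`, where `ord` is normalized by `ord x = 1`. -/
def HasSlope [CharZero k] (S : FormalConnection k) (s : ℚ) : Prop :=
  ∃ (q : ℕ+) (f : LaurentSeries k), Nonempty (S ≅ E q f) ∧
    s = max 0 (-((f.order : ℚ) / ((q : ℕ) : ℚ)))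

/-- All irreducible components have positive slope. -/
def posSlope (k : Type u) [Field k] [CharZero k] : ObjectProperty (FormalConnection k) :=
  fun E => ∀ S : FormalConnection k, S.IsIrreducibleComponent E → ∃ s : ℚ, 0 < s ∧ S.HasSlope s

end FormalConnection

/-! ### Difference operators -/

/-- A finite-dimensional vector space over `K = k((θ))` with an invertible difference
operator `Φ`. -/
structure DifferenceModule (k : Type u) [Field k] where
  carrier : Type u
  [addCommGroup : AddCommGroup carrier]
  [moduleBase : Module k carrier]
  [module : Module (LaurentSeries k) carrier]
  [isScalarTower : IsScalarTower k (LaurentSeries k) carrier]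
  [finiteDimensional : FiniteDimensional (LaurentSeries k) carrier]
  Phi : carrier →ₗ[k] carrier
  Phi_smul : ∀ (f : LaurentSeries k) (v : carrier), Phi (f • v) = phi k f • Phi v
  bijective : Function.Bijective Phi

attribute [instance] DifferenceModule.addCommGroup DifferenceModule.moduleBase
  DifferenceModule.module DifferenceModule.isScalarTower DifferenceModule.finiteDimensional

namespace DifferenceModule

variable {k : Type u} [Field k]

/-- `K`-linear maps that commute with the difference operators. -/
@[ext]
structure Hom (D D' : DifferenceModule k) where
  toLinearMap : D.carrier →ₗ[LaurentSeries k] D'.carrier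
  comm : ∀ v, toLinearMap (D.Phi v) = D'.Phi (toLinearMap v)

instance : Category (DifferenceModule k) where
  Hom D D' := Hom D D'
  id D := ⟨LinearMap.id, fun _ => rfl⟩
  comp f g := ⟨g.toLinearMap.comp f.toLinearMap, fun v => by
    simp [f.comm, g.comm]⟩

/-- `D ≠ 0` and `D` has no `Φ`-invariant subspaces other than `0` and `D`. -/
def IsIrreducible (D : DifferenceModule k) : Prop :=
  Nontrivial D.carrier ∧ ∀ W : Submodule (LaurentSeries k) D.carrier,
    (∀ w ∈ W, D.Phi w ∈ W) → W = ⊥ ∨ W = ⊤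

/-- `S` is an irreducible component (Jordan–Hölder factor) of `D`: an irreducible quotient of a
subobject of `D`. -/
def IsIrreducibleComponent (S D : DifferenceModule k) : Prop :=
  S.IsIrreducible ∧ ∃ (X : DifferenceModule k) (i : X ⟶ D) (p : X ⟶ S),
    Function.Injective i.toLinearMap ∧ Function.Surjective p.toLinearMap

/-- The operator `g φ` on `K_q`. -/
def phiD [CharZero k] (q : ℕ+) (g : LaurentSeries k) : LaurentSeries k →ₗ[k] LaurentSeries k where
  toFun v := g * phiRam k q v
  map_add' v w := by rw [map_add, mul_add]
  map_smul' c v := by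
    rw [RingHom.id_apply, ← HahnSeries.C_mul_eq_smul, ← HahnSeries.C_mul_eq_smul, map_mul, phiRam,
      substHom_C, mul_left_comm]

theorem phiD_ramify_mul [CharZero k] (q : ℕ+) (g c v : LaurentSeries k) :
    phiD q g (ramify k q c * v) = ramify k q (phi k c) * phiD q g v := by
  change g * phiRam k q (ramify k q c * v) = ramify k q (phi k c) * (g * phiRam k q v)
  rw [map_mul, phiRam_ramify, mul_left_comm]

theorem phiD_bijective [CharZero k] (q : ℕ+) (g : LaurentSeries k) (hg : g ≠ 0) :
    Function.Bijective (phiD q g) :=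
  (mulLeft_bijective₀ g hg).comp (phiRam_bijective q)

/-- The difference module `D_g = (K_q, g φ)` for `0 ≠ g ∈ K_q`. -/
def D [CharZero k] (q : ℕ+) (g : LaurentSeries k) (hg : g ≠ 0) : DifferenceModule k where
  carrier := RamExt k q
  Phi := (show RamExt k q →ₗ[k] RamExt k q from phiD q g)
  Phi_smul := fun c v => phiD_ramify_mul q g c v
  bijective := phiD_bijective q g hg

/-- The irreducible difference module `S` has order `r`: it is isomorphic to some `D_g` with
`r = ord g`, where `ord` is normalized by `ord θ = 1`. -/
def HasOrder [CharZero k] (S : DifferenceModule k) (r : ℚ) : Prop :=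
  ∃ (q : ℕ+) (g : LaurentSeries k) (hg : g ≠ 0), Nonempty (S ≅ D q g hg) ∧
    r = (g.order : ℚ) / ((q : ℕ) : ℚ)

/-- All irreducible components have negative order. -/
def negOrder (k : Type u) [Field k] [CharZero k] : ObjectProperty (DifferenceModule k) :=
  fun D => ∀ S : DifferenceModule k, S.IsIrreducibleComponent D → ∃ r : ℚ, r < 0 ∧ S.HasOrder r

end DifferenceModule

/-! ### The local Mellin transform from infinity to infinity -/

/-- A lattice in a `k((x))`-vector space `V`: a subset `⊕ k[[x]] eᵢ` for a basis `eᵢ` of `V`. -/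
def IsLattice (k : Type u) [Field k] (V : Type u) [AddCommGroup V] [Module (LaurentSeries k) V]
    (L : Set V) : Prop :=
  ∃ (n : ℕ) (b : Module.Basis (Fin n) (LaurentSeries k) V),
    L = {v | ∀ i, b.repr v i ∈ Set.range (HahnSeries.ofPowerSeries ℤ k)}

/-- The `x`-adic topology on a `k((x))`-vector space, generated by the cosets of lattices. -/
@[reducible]
def adicTopology (k : Type u) [Field k] (V : Type u) [AddCommGroup V]
    [Module (LaurentSeries k) V] : TopologicalSpace V :=
  TopologicalSpace.generateFrom
    {U | ∃ (v : V) (L : Set V), IsLattice k V L ∧ U = (fun w => v + w) '' L}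

section Transform

variable {k : Type u} [Field k]

/-- Here the local coordinate of `E` is `ζ`, and `z = ζ⁻¹` acts on `E`. -/
def zAct (E : FormalConnection k) (v : E.carrier) : E.carrier :=
  (HahnSeries.single (-1 : ℤ) (1 : k) : LaurentSeries k) • v

/-- The connection written in terms of `z = ζ⁻¹`: `∇_z = -ζ² ∇_ζ`. -/
def nablaZ (E : FormalConnection k) (v : E.carrier) : E.carrier :=
  -((HahnSeries.single (2 : ℤ) (1 : k) : LaurentSeries k) • E.nabla v)

/-- `e` identifies the `k`-vector space underlying `E` with `D`, so that `D = (V_θ, Φ)`: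
* `θ` acts as `-(z ∇_z)⁻¹` (as `θ` is invertible on `D`, this contains the invertibility
  of `z ∇_z`);
* `Φ` acts as `z`;
* the action of `k((θ))` is the one extending that of `θ` by continuity: the `θ`-adic topology
  of `V_θ` coincides with the `ζ`-adic topology of `V`. -/
structure IsMellinTransform (E : FormalConnection k) (D : DifferenceModule k)
    (e : E.carrier ≃ₗ[k] D.carrier) : Prop where
  theta : ∀ v, (HahnSeries.single (1 : ℤ) (1 : k) : LaurentSeries k) •
    e (-(zAct E (nablaZ E v))) = e v
  Phi : ∀ v, D.Phi (e v) = e (zAct E v)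
  topology : (adicTopology k D.carrier).induced e = adicTopology k E.carrier

/-- The category `C_∞^{>0}`. -/
abbrev CInftyPos (k : Type u) [Field k] [CharZero k] :=
  (FormalConnection.posSlope k).FullSubcategory

/-- The category `N^{<0}`. -/
abbrev NNeg (k : Type u) [Field k] [CharZero k] :=
  (DifferenceModule.negOrder k).FullSubcategory

/-- The functor `M` is the local Mellin transform `(V, ∇) ↦ (V_θ, Φ)`, which does not change
the underlying maps of morphisms. -/
def IsLocalMellin [CharZero k] (M : CInftyPos k ⥤ NNeg k) : Prop :=
  ∃ e : ∀ E : CInftyPos k, E.obj.carrier ≃ₗ[k] (M.obj E).obj.carrier,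
    (∀ E, IsMellinTransform E.obj (M.obj E).obj (e E)) ∧
    ∀ (E E' : CInftyPos k) (f : E ⟶ E') (v : E.obj.carrier),
      (M.map f).hom.toLinearMap (e E v) = e E' (f.hom.toLinearMap v)

end Transform

end LocalMellin

end

/-!
On the transform, `θ⁻¹ = -z∇_z` is the operator `ζ∇_ζ`, and `Φ` is `ζ⁻¹`. So `M(E)` is the space `V`
with the `k((θ))`-structure in which multiplication by `θ⁻¹` is the continuous operator `ζ∇_ζ`;
symmetrically, the inverse transform is the `k((ζ))`-structure in which multiplication by `ζ⁻¹` is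
`Φ`. The commutation relation `(ζ∇_ζ) ζ⁻¹ = ζ⁻¹ (ζ∇_ζ) - ζ⁻¹` reads `Φ θ⁻¹ = (θ⁻¹ + 1) Φ`, and by
continuity it gives the semilinearity of `Φ` and the Leibniz rule of `∇`. Likewise continuous maps
commuting with the operators are automatically linear for the new structures, which gives full
faithfulness and uniqueness.

It remains to construct the new structures. For `E_f` with `ord f < 0` and for `D_g` with
`ord g < 0`, the coefficients of the operator `B` (`ζ∇_ζ` or `Φ`) on `x ^ n` are polynomials in `n`
and its leading coefficient is constant. An operator `T` of the same kind with `T x⁻ᵖ = B T` is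
found by solving difference equations between polynomials, which is possible in characteristic
zero; the remaining operator is then identified by comparing polynomials in `n` at infinitely many
`n`. An extension of `M₂` by `M₁` turns `x⁻¹` into a block triangular operator with off-diagonal
entry `β`, which is removed by the solution `τ` of `β = x⁻¹ τ - τ x⁻¹`. Induction on the length then
treats all objects of positive slope and of negative order. Irreducibility of the rank one pieces is
preserved because a subspace of `E_f` stable under `ζ∇_ζ` is stable under `(ζ∇_ζ)⁻¹`.
-/

noncomputable section

namespace LocalMellin

/-! ### Order filtrations and continuity -/

section OrderFiltration

variable {k : Type*} [Field k]

/-- The monomial `x ^ n` of `k((x))`. -/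
abbrev xpow (k : Type*) [Field k] (n : ℤ) : LaurentSeries k := HahnSeries.single n (1 : k)

theorem xpow_mul_xpow (m n : ℤ) : xpow k m * xpow k n = xpow k (m + n) := by
  rw [HahnSeries.single_mul_single, one_mul]

theorem xpow_zero : xpow k 0 = 1 := rfl

theorem xpow_ne_zero (n : ℤ) : xpow k n ≠ 0 := by simp [xpow]

theorem coeff_xpow_mul (n : ℤ) (f : LaurentSeries k) (m : ℤ) :
    (xpow k n * f).coeff m = f.coeff (m - n) := by
  rw [HahnSeries.coeff_single_mul, one_mul]

theorem xpow_mul_xpow_neg (n : ℤ) : xpow k n * xpow k (-n) = 1 := by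
  rw [xpow_mul_xpow, add_neg_cancel, xpow_zero]

theorem xpow_neg_mul_xpow (n : ℤ) : xpow k (-n) * xpow k n = 1 := by
  rw [mul_comm, xpow_mul_xpow_neg]

section Module

variable {V : Type*} [AddCommGroup V] [Module (LaurentSeries k) V]
variable {W : Type*} [AddCommGroup W] [Module (LaurentSeries k) W]

theorem xpow_smul_xpow_neg_smul (n : ℤ) (v : V) : xpow k n • xpow k (-n) • v = v := by
  rw [smul_smul, xpow_mul_xpow_neg, one_smul]

theorem xpow_neg_smul_xpow_smul (n : ℤ) (v : V) : xpow k (-n) • xpow k n • v = v := by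
  rw [smul_smul, xpow_neg_mul_xpow, one_smul]

theorem map_xpow_smul_of_xpow_neg_one {A : V →+ W} {σ : LaurentSeries k →+* LaurentSeries k}
    (h : ∀ v, A (xpow k (-1) • v) = σ (xpow k (-1)) • A v) (n : ℤ) (v : V) :
    A (xpow k n • v) = σ (xpow k n) • A v := by
  have hneg : ∀ (m : ℕ) (v : V), A (xpow k (-m) • v) = σ (xpow k (-m)) • A v := by
    intro m
    induction m with
    | zero => intro v; simp
    | succ m ih =>
      intro v
      have : (-((m + 1 : ℕ) : ℤ)) = -m + -1 := by push_cast; ring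
      rw [this, ← xpow_mul_xpow, mul_smul, ih, h, map_mul, mul_smul]
  obtain ⟨m, rfl | rfl⟩ := n.eq_nat_or_neg
  · have hσ : σ (xpow k m) * σ (xpow k (-m)) = 1 := by
      rw [← map_mul, xpow_mul_xpow_neg, map_one]
    have hv := hneg m (xpow k m • v)
    rw [xpow_neg_smul_xpow_smul] at hv
    rw [hv, smul_smul, hσ, one_smul]
  · exact hneg m v

end Module

/-- The fractional ideal `x ^ n k[[x]]` of `k((x))`, as a `k`-subspace. -/
def ordGE (k : Type*) [Field k] (n : ℤ) : Submodule k (LaurentSeries k) where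
  carrier := {f | ∀ m < n, f.coeff m = 0}
  add_mem' hf hg m hm := by rw [HahnSeries.coeff_add, hf m hm, hg m hm, add_zero]
  zero_mem' _ _ := HahnSeries.coeff_zero
  smul_mem' c f hf m hm := by rw [HahnSeries.coeff_smul, hf m hm, smul_zero]

theorem ordGE_anti {m n : ℤ} (h : m ≤ n) : ordGE k n ≤ ordGE k m :=
  fun _ hf j hj => hf j (hj.trans_le h)

theorem ordGE_mul {m n : ℤ} {f g : LaurentSeries k} (hf : f ∈ ordGE k m) (hg : g ∈ ordGE k n) :
    f * g ∈ ordGE k (m + n) := by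
  intro j hj
  rw [HahnSeries.coeff_mul]
  refine Finset.sum_eq_zero fun ij hij => ?_
  have h := (Finset.mem_antidiagonal.1 hij).2.2
  by_cases h1 : ij.1 < m
  · rw [hf _ h1, zero_mul]
  · rw [hg _ (by lia), mul_zero]

theorem mem_ordGE_order (f : LaurentSeries k) : f ∈ ordGE k f.order :=
  fun _ hm => HahnSeries.coeff_eq_zero_of_lt_order hm

theorem xpow_mem_ordGE (n : ℤ) : xpow k n ∈ ordGE k n :=
  fun _ hm => HahnSeries.coeff_single_of_ne hm.ne

theorem xpow_mul_mem_ordGE {m n : ℤ} {f : LaurentSeries k} :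
    xpow k m * f ∈ ordGE k (m + n) ↔ f ∈ ordGE k n := by
  refine ⟨fun h => ?_, ordGE_mul (xpow_mem_ordGE m)⟩
  have := ordGE_mul (xpow_mem_ordGE (-m)) h
  rwa [← mul_assoc, xpow_neg_mul_xpow, one_mul, neg_add_cancel_left] at this

theorem mem_ordGE_zero_iff {f : LaurentSeries k} :
    f ∈ ordGE k 0 ↔ f ∈ Set.range (HahnSeries.ofPowerSeries ℤ k) := by
  constructor
  · intro h
    refine ⟨PowerSeries.mk fun i => f.coeff i, ?_⟩
    ext m
    rw [PowerSeries.coeff_coe]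
    split_ifs with hm
    · exact (h m hm).symm
    · rw [PowerSeries.coeff_mk, Int.natAbs_of_nonneg (not_lt.1 hm)]
  · rintro ⟨p, rfl⟩ m hm
    rw [PowerSeries.coeff_coe, if_pos hm]

theorem mem_ordGE_iff_exists {n : ℤ} {f : LaurentSeries k} :
    f ∈ ordGE k n ↔ ∃ p : PowerSeries k, f = xpow k n * HahnSeries.ofPowerSeries ℤ k p := by
  constructor
  · intro h
    have h1 := ordGE_mul (xpow_mem_ordGE (-n)) h
    rw [neg_add_cancel, mem_ordGE_zero_iff] at h1
    obtain ⟨p, hp⟩ := h1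
    refine ⟨p, ?_⟩
    rw [hp, ← mul_assoc, xpow_mul_xpow_neg, one_mul]
  · rintro ⟨p, rfl⟩
    have := ordGE_mul (xpow_mem_ordGE n) (mem_ordGE_zero_iff.2 ⟨p, rfl⟩)
    rwa [add_zero] at this

theorem eq_zero_of_forall_mem_ordGE {f : LaurentSeries k} (h : ∀ n, f ∈ ordGE k n) : f = 0 := by
  ext m
  exact h (m + 1) m (lt_add_one m)

theorem sub_sum_xpow_mem_ordGE {a : ℤ} {f : LaurentSeries k} (hf : f ∈ ordGE k a) (n : ℤ) :
    f - ∑ j ∈ Finset.Ico a n, f.coeff j • xpow k j ∈ ordGE k n := by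
  intro m hm
  rw [HahnSeries.coeff_sub, HahnSeries.coeff_sum]
  simp only [HahnSeries.coeff_smul, xpow, HahnSeries.coeff_single, smul_eq_mul, mul_ite, mul_one,
    mul_zero, Finset.sum_ite_eq, Finset.mem_Ico]
  split_ifs with h
  · exact sub_self _
  · rw [sub_zero]
    exact hf m (by lia)

theorem smul_eq_C_smul {V : Type*} [AddCommGroup V] [Module k V] [Module (LaurentSeries k) V]
    [IsScalarTower k (LaurentSeries k) V] (c : k) (v : V) :
    c • v = (HahnSeries.C c : LaurentSeries k) • v := by
  rw [← one_smul (LaurentSeries k) v, ← smul_assoc, smul_smul, ← HahnSeries.C_mul_eq_smul]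

instance : IsScalarTower k (LaurentSeries k) (LaurentSeries k) where
  smul_assoc c f g := by
    rw [smul_eq_mul, smul_eq_mul, ← HahnSeries.C_mul_eq_smul, ← HahnSeries.C_mul_eq_smul, mul_assoc]

end OrderFiltration

section Cofinal

variable {k : Type*} [Field k] {V : Type*} [AddCommGroup V] [Module k V]

/-- Mutual cofinality of two descending filtrations, that is, equality of the linear topologies they
define. -/
def Cofinal (F G : ℤ → Submodule k V) : Prop :=
  (∀ m, ∃ n, F n ≤ G m) ∧ ∀ m, ∃ n, G n ≤ F m

theorem Cofinal.refl (F : ℤ → Submodule k V) : Cofinal F F :=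
  ⟨fun m => ⟨m, le_rfl⟩, fun m => ⟨m, le_rfl⟩⟩

end Cofinal

section BasisFiltration

variable {k : Type*} [Field k]
variable {V : Type*} [AddCommGroup V] [Module k V] [Module (LaurentSeries k) V]
  [IsScalarTower k (LaurentSeries k) V]
variable {W : Type*} [AddCommGroup W] [Module k W] [Module (LaurentSeries k) W]
  [IsScalarTower k (LaurentSeries k) W]
variable {ι κ : Type*}

/-- The filtration of a `k((x))`-vector space by the multiples `x ^ n L` of the lattice `L` spanned
by a basis `b`. -/
def basisFiltration (b : Module.Basis ι (LaurentSeries k) V) (n : ℤ) : Submodule k V where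
  carrier := {v | ∀ i, b.repr v i ∈ ordGE k n}
  add_mem' hv hw i := by
    rw [map_add, Finsupp.add_apply]
    exact add_mem (hv i) (hw i)
  zero_mem' i := by
    rw [map_zero, Finsupp.zero_apply]
    exact zero_mem _
  smul_mem' c v hv i := by
    rw [smul_eq_C_smul c v, map_smul, Finsupp.smul_apply, smul_eq_mul, HahnSeries.C_mul_eq_smul]
    exact Submodule.smul_mem _ c (hv i)

theorem mem_basisFiltration {b : Module.Basis ι (LaurentSeries k) V} {n : ℤ} {v : V} :
    v ∈ basisFiltration b n ↔ ∀ i, b.repr v i ∈ ordGE k n := Iff.rfl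

theorem basisFiltration_anti (b : Module.Basis ι (LaurentSeries k) V) {m n : ℤ} (h : m ≤ n) :
    basisFiltration b n ≤ basisFiltration b m := fun _ hv i => ordGE_anti h (hv i)

theorem smul_mem_basisFiltration {b : Module.Basis ι (LaurentSeries k) V} {m n : ℤ}
    {f : LaurentSeries k} {v : V} (hf : f ∈ ordGE k m) (hv : v ∈ basisFiltration b n) :
    f • v ∈ basisFiltration b (m + n) := by
  intro i
  rw [map_smul, Finsupp.smul_apply, smul_eq_mul]
  exact ordGE_mul hf (hv i)

theorem exists_mem_basisFiltration [Finite ι] (b : Module.Basis ι (LaurentSeries k) V) (v : V) :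
    ∃ n, v ∈ basisFiltration b n := by
  obtain ⟨n, hn⟩ := Finite.bddBelow_range fun i => (b.repr v i).order
  exact ⟨n, fun i => ordGE_anti (hn ⟨i, rfl⟩) (mem_ordGE_order _)⟩

theorem eq_zero_of_forall_mem_basisFiltration (b : Module.Basis ι (LaurentSeries k) V) {v : V}
    (h : ∀ n, v ∈ basisFiltration b n) : v = 0 := by
  refine b.ext_elem fun i => ?_
  rw [map_zero, Finsupp.zero_apply]
  exact eq_zero_of_forall_mem_ordGE fun n => h n i

theorem exists_map_mem_basisFiltration [Finite ι] [Finite κ]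
    (b : Module.Basis ι (LaurentSeries k) V) (b' : Module.Basis κ (LaurentSeries k) W)
    (A : V →ₗ[LaurentSeries k] W) :
    ∃ d : ℤ, ∀ n, ∀ v ∈ basisFiltration b n, A v ∈ basisFiltration b' (n + d) := by
  cases nonempty_fintype ι
  choose d hd using fun j => exists_mem_basisFiltration b' (A (b j))
  obtain ⟨e, he⟩ := Finite.bddBelow_range d
  refine ⟨e, fun n v hv => ?_⟩
  rw [← b.sum_repr v, map_sum]
  refine Submodule.sum_mem _ fun j _ => ?_
  rw [map_smul]
  exact smul_mem_basisFiltration (hv j) (basisFiltration_anti b' (he ⟨j, rfl⟩) (hd j))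

theorem cofinal_basisFiltration [Finite ι] [Finite κ] (b : Module.Basis ι (LaurentSeries k) V)
    (b' : Module.Basis κ (LaurentSeries k) V) :
    Cofinal (basisFiltration b) (basisFiltration b') := by
  constructor
  · intro m
    obtain ⟨d, hd⟩ := exists_map_mem_basisFiltration b b' LinearMap.id
    exact ⟨m - d, fun v hv => by simpa using hd _ v hv⟩
  · intro m
    obtain ⟨d, hd⟩ := exists_map_mem_basisFiltration b' b LinearMap.id
    exact ⟨m - d, fun v hv => by simpa using hd _ v hv⟩

/-- Scalar multiplication by `f`, as a `k`-linear operator. -/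
def smulOp (V : Type*) [AddCommGroup V] [Module k V] [Module (LaurentSeries k) V]
    [IsScalarTower k (LaurentSeries k) V] (f : LaurentSeries k) : V →ₗ[k] V :=
  (LinearMap.lsmul (LaurentSeries k) V f).restrictScalars k

@[simp]
theorem smulOp_apply (f : LaurentSeries k) (v : V) : smulOp V f v = f • v := rfl

/-- The orbit map `f ↦ f • v`, as a `k`-linear map. -/
def smulVec (v : V) : LaurentSeries k →ₗ[k] V :=
  (LinearMap.toSpanSingleton (LaurentSeries k) V v).restrictScalars k

@[simp]
theorem smulVec_apply (f : LaurentSeries k) (v : V) : smulVec v f = f • v := rfl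

end BasisFiltration

section AdicContinuous

variable {k : Type*} [Field k]
variable {V : Type*} [AddCommGroup V] [Module k V] [Module (LaurentSeries k) V]
  [IsScalarTower k (LaurentSeries k) V] [FiniteDimensional (LaurentSeries k) V]
variable {W : Type*} [AddCommGroup W] [Module k W] [Module (LaurentSeries k) W]
  [IsScalarTower k (LaurentSeries k) W] [FiniteDimensional (LaurentSeries k) W]
variable {U : Type*} [AddCommGroup U] [Module k U] [Module (LaurentSeries k) U]
  [IsScalarTower k (LaurentSeries k) U] [FiniteDimensional (LaurentSeries k) U]
variable {ι : Type*}

/-- The filtration of a finite-dimensional `k((x))`-vector space by the multiples of one lattice.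
The lattice is an arbitrary choice: all of them give cofinal filtrations. -/
def adicFiltration (k : Type*) [Field k] (V : Type*) [AddCommGroup V] [Module k V]
    [Module (LaurentSeries k) V] [IsScalarTower k (LaurentSeries k) V]
    [FiniteDimensional (LaurentSeries k) V] (n : ℤ) : Submodule k V :=
  basisFiltration (Module.finBasis (LaurentSeries k) V) n

/-- Continuity of a `k`-linear map for the adic topologies, in terms of filtrations. -/
def AdicContinuous (A : V →ₗ[k] W) : Prop :=
  ∀ m, ∃ n, ∀ v ∈ adicFiltration k V n, A v ∈ adicFiltration k W m

theorem cofinal_basisFiltration_adicFiltration [Finite ι] (b : Module.Basis ι (LaurentSeries k) V) :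
    Cofinal (basisFiltration b) (adicFiltration k V) := cofinal_basisFiltration _ _

theorem adicContinuous_iff {F : ℤ → Submodule k V} {G : ℤ → Submodule k W}
    (hF : Cofinal F (adicFiltration k V)) (hG : Cofinal G (adicFiltration k W)) {A : V →ₗ[k] W} :
    AdicContinuous A ↔ ∀ m, ∃ n, ∀ v ∈ F n, A v ∈ G m := by
  constructor
  · intro h m
    obtain ⟨m', hm'⟩ := hG.2 m
    obtain ⟨n', hn'⟩ := h m'
    obtain ⟨n, hn⟩ := hF.1 n'
    exact ⟨n, fun v hv => hm' (hn' v (hn hv))⟩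
  · intro h m
    obtain ⟨m', hm'⟩ := hG.1 m
    obtain ⟨n', hn'⟩ := h m'
    obtain ⟨n, hn⟩ := hF.2 n'
    exact ⟨n, fun v hv => hm' (hn' v (hn hv))⟩

theorem AdicContinuous.comp {B : W →ₗ[k] U} {A : V →ₗ[k] W} (hB : AdicContinuous B)
    (hA : AdicContinuous A) : AdicContinuous (B ∘ₗ A) := by
  intro m
  obtain ⟨l, hl⟩ := hB m
  obtain ⟨n, hn⟩ := hA l
  exact ⟨n, fun v hv => hl _ (hn v hv)⟩

theorem AdicContinuous.add {A B : V →ₗ[k] W} (hA : AdicContinuous A) (hB : AdicContinuous B) :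
    AdicContinuous (A + B) := by
  intro m
  obtain ⟨l, hl⟩ := hA m
  obtain ⟨n, hn⟩ := hB m
  exact ⟨max l n, fun v hv => add_mem (hl v (basisFiltration_anti _ (le_max_left l n) hv))
    (hn v (basisFiltration_anti _ (le_max_right l n) hv))⟩

theorem AdicContinuous.neg {A : V →ₗ[k] W} (hA : AdicContinuous A) : AdicContinuous (-A) := by
  intro m
  obtain ⟨l, hl⟩ := hA m
  exact ⟨l, fun v hv => neg_mem (hl v hv)⟩

theorem AdicContinuous.sub {A B : V →ₗ[k] W} (hA : AdicContinuous A) (hB : AdicContinuous B) :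
    AdicContinuous (A - B) := by
  rw [sub_eq_add_neg]
  exact hA.add hB.neg

theorem AdicContinuous.sum {α : Type*} (s : Finset α) {A : α → V →ₗ[k] W}
    (hA : ∀ a, AdicContinuous (A a)) : AdicContinuous (∑ a ∈ s, A a) := by
  classical
  induction s using Finset.induction_on with
  | empty => exact fun m => ⟨0, fun v _ => by simp⟩
  | insert a s ha ih =>
    rw [Finset.sum_insert ha]
    exact (hA a).add ih

theorem adicContinuous_restrictScalars (A : V →ₗ[LaurentSeries k] W) :
    AdicContinuous (A.restrictScalars k) := by
  intro m
  obtain ⟨d, hd⟩ := exists_map_mem_basisFiltration (Module.finBasis (LaurentSeries k) V)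
    (Module.finBasis (LaurentSeries k) W) A
  refine ⟨m - d, fun v hv => ?_⟩
  have := hd _ v hv
  rwa [sub_add_cancel] at this

theorem AdicContinuous.of_eq {A B : V →ₗ[k] W} (hA : AdicContinuous A) (h : ∀ v, A v = B v) :
    AdicContinuous B := by
  obtain rfl : A = B := LinearMap.ext h
  exact hA

theorem adicContinuous_id : AdicContinuous (LinearMap.id : V →ₗ[k] V) :=
  (adicContinuous_restrictScalars (LinearMap.id : V →ₗ[LaurentSeries k] V)).of_eq fun _ => rfl

theorem adicContinuous_smulOp (f : LaurentSeries k) : AdicContinuous (smulOp V f) :=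
  adicContinuous_restrictScalars _

theorem adicContinuous_smulVec (v : V) : AdicContinuous (smulVec (k := k) v) :=
  adicContinuous_restrictScalars _

theorem AdicContinuous.of_basis [Finite ι] (b : Module.Basis ι (LaurentSeries k) V)
    {A : V →ₗ[k] W} (h : ∀ i, AdicContinuous (A ∘ₗ smulVec (b i))) : AdicContinuous A := by
  cases nonempty_fintype ι
  have hsum : AdicContinuous (∑ i, (A ∘ₗ smulVec (b i)) ∘ₗ (b.coord i).restrictScalars k) :=
    AdicContinuous.sum _ fun i => (h i).comp (adicContinuous_restrictScalars _)
  refine hsum.of_eq fun v => ?_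
  conv_rhs => rw [← b.sum_repr v, map_sum]
  simp

theorem cofinal_ordGE : Cofinal (ordGE k) (adicFiltration k (LaurentSeries k)) := by
  have h : ordGE k = basisFiltration (Module.Basis.singleton Unit (LaurentSeries k)) := by
    funext n
    ext f
    simp [mem_basisFiltration]
  rw [h]
  exact cofinal_basisFiltration_adicFiltration _

theorem AdicContinuous.eq_zero_of_xpow {A : LaurentSeries k →ₗ[k] W} (hA : AdicContinuous A)
    (h : ∀ n, A (xpow k n) = 0) : A = 0 := by
  ext1 f
  rw [LinearMap.zero_apply]
  refine eq_zero_of_forall_mem_basisFiltration (Module.finBasis (LaurentSeries k) W) fun m => ?_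
  obtain ⟨n, hn⟩ := (adicContinuous_iff cofinal_ordGE (Cofinal.refl _)).1 hA m
  have := hn _ (sub_sum_xpow_mem_ordGE (mem_ordGE_order f) n)
  rw [map_sub, map_sum] at this
  simp only [map_smul, h, smul_zero, Finset.sum_const_zero, sub_zero] at this
  exact this

theorem AdicContinuous.ext_xpow {A B : LaurentSeries k →ₗ[k] W} (hA : AdicContinuous A)
    (hB : AdicContinuous B) (h : ∀ n, A (xpow k n) = B (xpow k n)) : A = B :=
  sub_eq_zero.1 ((hA.sub hB).eq_zero_of_xpow fun n => sub_eq_zero.2 (h n))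

theorem AdicContinuous.map_smul_of_xpow {A : V →ₗ[k] W} (hA : AdicContinuous A)
    {σ : LaurentSeries k →ₗ[k] LaurentSeries k} (hσ : AdicContinuous σ) {v : V}
    (h : ∀ n, A (xpow k n • v) = σ (xpow k n) • A v) (f : LaurentSeries k) :
    A (f • v) = σ f • A v :=
  LinearMap.congr_fun ((hA.comp (adicContinuous_smulVec v)).ext_xpow
    ((adicContinuous_smulVec (A v)).comp hσ) h) f

theorem AdicContinuous.map_smul_of_xpow_neg_one {A : V →ₗ[k] W} (hA : AdicContinuous A)
    (h : ∀ v, A (xpow k (-1) • v) = xpow k (-1) • A v) (f : LaurentSeries k) (v : V) :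
    A (f • v) = f • A v :=
  hA.map_smul_of_xpow (σ := LinearMap.id) adicContinuous_id
    (fun n => map_xpow_smul_of_xpow_neg_one (A := A.toAddMonoidHom) (σ := RingHom.id _) h n v) f

end AdicContinuous

section StrongLinear

variable {k : Type*} [Field k]

/-- The series `∑ n, f_n s_n`, where the sequence `s` tends to `0` at `+∞`. -/
def strongSum (s : ℤ → LaurentSeries k) (hs : ∀ m, ∃ N, ∀ n ≥ N, s n ∈ ordGE k m)
    (f : LaurentSeries k) : LaurentSeries k where
  coeff m := ∑ᶠ n, f.coeff n * (s n).coeff m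
  isPWO_support' := by
    refine (BddBelow.isWF ?_).isPWO
    obtain ⟨N, hN⟩ := hs 0
    obtain ⟨d, hd⟩ := ((Finset.Ico f.order N).image fun n => (s n).order).bddBelow
    refine ⟨min 0 d, fun m hm => ?_⟩
    by_contra hlt
    apply hm
    refine finsum_eq_zero_of_forall_eq_zero fun n => ?_
    by_cases h1 : n < f.order
    · rw [mem_ordGE_order f n h1, zero_mul]
    · by_cases h2 : N ≤ n
      · rw [hN n h2 m (by lia), mul_zero]
      · have := hd (Finset.mem_coe.2 (Finset.mem_image_of_mem (fun n => (s n).order)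
          (Finset.mem_Ico.2 ⟨not_lt.1 h1, not_le.1 h2⟩)))
        rw [mem_ordGE_order (s n) m (by lia), mul_zero]

theorem strongSum_finite {s : ℤ → LaurentSeries k} (hs : ∀ m, ∃ N, ∀ n ≥ N, s n ∈ ordGE k m)
    (f : LaurentSeries k) (m : ℤ) :
    (Function.support fun n => f.coeff n * (s n).coeff m).Finite := by
  obtain ⟨N, hN⟩ := hs (m + 1)
  refine (Set.finite_Ico f.order N).subset fun n hn => ⟨?_, ?_⟩
  · by_contra h
    exact hn (mul_eq_zero_of_left (mem_ordGE_order f n (not_le.1 h)) _)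
  · by_contra h
    exact hn (mul_eq_zero_of_right _ (hN n (not_lt.1 h) m (lt_add_one m)))

/-- The continuous `k`-linear endomorphism of `k((x))` sending `x ^ n` to `s n`. -/
def strongLinear (s : ℤ → LaurentSeries k) (hs : ∀ m, ∃ N, ∀ n ≥ N, s n ∈ ordGE k m) :
    LaurentSeries k →ₗ[k] LaurentSeries k where
  toFun := strongSum s hs
  map_add' f g := by
    ext m
    rw [HahnSeries.coeff_add]
    simp only [strongSum, HahnSeries.coeff_add, add_mul]
    exact finsum_add_distrib (strongSum_finite hs f m) (strongSum_finite hs g m)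
  map_smul' c f := by
    ext m
    simp only [strongSum, HahnSeries.coeff_smul, smul_eq_mul, mul_assoc, RingHom.id_apply]
    exact (smul_finsum c _).symm

theorem strongLinear_coeff (s : ℤ → LaurentSeries k)
    (hs : ∀ m, ∃ N, ∀ n ≥ N, s n ∈ ordGE k m) (f : LaurentSeries k) (m : ℤ) :
    (strongLinear s hs f).coeff m = ∑ᶠ n, f.coeff n * (s n).coeff m := rfl

theorem strongLinear_xpow (s : ℤ → LaurentSeries k)
    (hs : ∀ m, ∃ N, ∀ n ≥ N, s n ∈ ordGE k m) (n : ℤ) : strongLinear s hs (xpow k n) = s n := by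
  ext m
  rw [strongLinear_coeff, finsum_eq_single _ n]
  · simp
  · intro j hj
    rw [xpow, HahnSeries.coeff_single_of_ne hj, zero_mul]

theorem strongLinear_mem_ordGE {s : ℤ → LaurentSeries k}
    (hs : ∀ m, ∃ N, ∀ n ≥ N, s n ∈ ordGE k m) {N m : ℤ} (hN : ∀ n ≥ N, s n ∈ ordGE k m)
    {f : LaurentSeries k} (hf : f ∈ ordGE k N) : strongLinear s hs f ∈ ordGE k m := by
  intro j hj
  rw [strongLinear_coeff]
  refine finsum_eq_zero_of_forall_eq_zero fun n => ?_
  by_cases h : n < N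
  · rw [hf n h, zero_mul]
  · rw [hN n (not_lt.1 h) j hj, mul_zero]

theorem adicContinuous_strongLinear (s : ℤ → LaurentSeries k)
    (hs : ∀ m, ∃ N, ∀ n ≥ N, s n ∈ ordGE k m) : AdicContinuous (strongLinear s hs) := by
  refine (adicContinuous_iff cofinal_ordGE cofinal_ordGE).2 fun m => ?_
  obtain ⟨N, hN⟩ := hs m
  exact ⟨N, fun f hf => strongLinear_mem_ordGE hs hN hf⟩

variable {W : Type*} [AddCommGroup W] [Module k W] [Module (LaurentSeries k) W]
  [IsScalarTower k (LaurentSeries k) W] [FiniteDimensional (LaurentSeries k) W]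

theorem exists_adicContinuous_xpow (s : ℤ → W)
    (hs : ∀ m, ∃ N, ∀ n ≥ N, s n ∈ adicFiltration k W m) :
    ∃ T : LaurentSeries k →ₗ[k] W, AdicContinuous T ∧ ∀ n, T (xpow k n) = s n := by
  let b := Module.finBasis (LaurentSeries k) W
  have hs' : ∀ i m, ∃ N, ∀ n ≥ N, b.repr (s n) i ∈ ordGE k m := by
    intro i m
    obtain ⟨N, hN⟩ := hs m
    exact ⟨N, fun n hn => hN n hn i⟩
  refine ⟨∑ i, smulVec (b i) ∘ₗ strongLinear (fun n => b.repr (s n) i) (hs' i),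
    AdicContinuous.sum _ fun i =>
      (adicContinuous_smulVec _).comp (adicContinuous_strongLinear _ _), fun n => ?_⟩
  rw [LinearMap.sum_apply]
  simp only [LinearMap.comp_apply, strongLinear_xpow, smulVec_apply]
  exact b.sum_repr (s n)

end StrongLinear

section Topology

variable {k : Type u} [Field k]
variable {V : Type u} [AddCommGroup V] [Module k V] [Module (LaurentSeries k) V]
  [IsScalarTower k (LaurentSeries k) V]
variable {W : Type u} [AddCommGroup W] [Module k W] [Module (LaurentSeries k) W]
  [IsScalarTower k (LaurentSeries k) W] [FiniteDimensional (LaurentSeries k) W]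

theorem isLattice_iff {L : Set V} : IsLattice k V L ↔
    ∃ (n : ℕ) (b : Module.Basis (Fin n) (LaurentSeries k) V),
      L = (basisFiltration b 0 : Set V) := by
  simp only [IsLattice, ← mem_ordGE_zero_iff]
  rfl

theorem isLattice_basisFiltration {n : ℕ} (b : Module.Basis (Fin n) (LaurentSeries k) V) (m : ℤ) :
    IsLattice k V (basisFiltration b m : Set V) := by
  have hu : ∀ _ : Fin n, IsUnit (xpow k m) := fun _ => (xpow_ne_zero m).isUnit
  refine isLattice_iff.2 ⟨n, b.isUnitSMul hu, ?_⟩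
  ext v
  refine forall_congr' fun i => ?_
  have h : b.repr v i = xpow k m * (b.isUnitSMul hu).repr v i := by
    rw [Module.Basis.repr_isUnitSMul, Units.smul_def, smul_eq_mul, ← mul_assoc,
      IsUnit.mul_val_inv, one_mul]
  rw [h]
  have := xpow_mul_mem_ordGE (m := m) (n := 0) (f := (b.isUnitSMul hu).repr v i)
  rwa [add_zero] at this

variable [FiniteDimensional (LaurentSeries k) V]

theorem isOpen_adicTopology_iff {U : Set V} : @IsOpen V (adicTopology k V) U ↔
    ∀ u ∈ U, ∃ n, ∀ w ∈ adicFiltration k V n, u + w ∈ U := by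
  constructor
  · intro h
    change TopologicalSpace.GenerateOpen _ U at h
    induction h with
    | basic U hU =>
      obtain ⟨v, L, hL, rfl⟩ := hU
      obtain ⟨m, b, rfl⟩ := isLattice_iff.1 hL
      rintro _ ⟨w, hw, rfl⟩
      obtain ⟨n, hn⟩ := (cofinal_basisFiltration_adicFiltration b).2 0
      exact ⟨n, fun w' hw' => ⟨w + w', add_mem hw (hn hw'), (add_assoc v w w').symm⟩⟩
    | univ => exact fun _ _ => ⟨0, fun _ _ => trivial⟩
    | inter U U' _ _ ih ih' =>
      intro u hu
      obtain ⟨n, hn⟩ := ih u hu.1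
      obtain ⟨n', hn'⟩ := ih' u hu.2
      exact ⟨max n n', fun w hw => ⟨hn w (basisFiltration_anti _ (le_max_left n n') hw),
        hn' w (basisFiltration_anti _ (le_max_right n n') hw)⟩⟩
    | sUnion S _ ih =>
      rintro u ⟨U, hU, hu⟩
      obtain ⟨n, hn⟩ := ih U hU u hu
      exact ⟨n, fun w hw => ⟨U, hU, hn w hw⟩⟩
  · intro h
    let _ := adicTopology k V
    refine isOpen_iff_forall_mem_open.2 fun u hu => ?_
    obtain ⟨n, hn⟩ := h u hu
    refine ⟨(fun w => u + w) '' (adicFiltration k V n : Set V), ?_, ?_, ⟨0, zero_mem _, add_zero u⟩⟩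
    · rintro _ ⟨w, hw, rfl⟩
      exact hn w hw
    · exact TopologicalSpace.isOpen_generateFrom_of_mem ⟨u, _, isLattice_basisFiltration _ n, rfl⟩

theorem adicContinuous_iff_continuous {A : V →ₗ[k] W} :
    AdicContinuous A ↔ @Continuous V W (adicTopology k V) (adicTopology k W) A := by
  let _ := adicTopology k V
  let _ := adicTopology k W
  rw [continuous_def]
  constructor
  · intro h U hU
    refine isOpen_adicTopology_iff.2 fun u hu => ?_
    obtain ⟨m, hm⟩ := isOpen_adicTopology_iff.1 hU _ hu
    obtain ⟨n, hn⟩ := h m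
    refine ⟨n, fun w hw => ?_⟩
    rw [Set.mem_preimage, map_add]
    exact hm _ (hn w hw)
  · intro h m
    have hU : @IsOpen W (adicTopology k W) (adicFiltration k W m : Set W) :=
      isOpen_adicTopology_iff.2 fun u hu => ⟨m, fun w hw => add_mem hu hw⟩
    obtain ⟨n, hn⟩ := isOpen_adicTopology_iff.1 (h _ hU) 0 (by simp)
    exact ⟨n, fun v hv => by simpa using hn v hv⟩

theorem induced_adicTopology_eq_iff {e : V ≃ₗ[k] W} :
    (adicTopology k W).induced e = adicTopology k V ↔
      AdicContinuous (e : V →ₗ[k] W) ∧ AdicContinuous (e.symm : W →ₗ[k] V) := by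
  rw [adicContinuous_iff_continuous, adicContinuous_iff_continuous]
  let _ := adicTopology k V
  let _ := adicTopology k W
  constructor
  · intro h
    have hi : Topology.IsInducing e := ⟨h.symm⟩
    refine ⟨hi.continuous, hi.continuous_iff.2 ?_⟩
    convert continuous_id (X := W) using 1
    funext w
    exact e.apply_symm_apply w
  · rintro ⟨h, h'⟩
    exact (Homeomorph.isInducing ⟨e.toEquiv, h, h'⟩).eq_induced.symm

end Topology

/-! ### Operators on connections and difference modules -/

section Operators

variable {k : Type*} [Field k]

theorem adicContinuous_derivative : AdicContinuous (LaurentSeries.derivative k (V := k)) := by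
  refine (adicContinuous_iff cofinal_ordGE cofinal_ordGE).2 fun m => ⟨m + 1, fun f hf j hj => ?_⟩
  rw [LaurentSeries.derivative_apply, LaurentSeries.hasseDeriv_coeff, hf _ (by push_cast; lia),
    smul_zero]

theorem derivative_xpow (n : ℤ) :
    LaurentSeries.derivative k (xpow k n) = HahnSeries.single (n - 1) (n : k) := by
  rw [LaurentSeries.derivative_apply, LaurentSeries.hasseDeriv_single]
  simp

theorem xpow_one_mul_derivative_xpow (n : ℤ) :
    xpow k 1 * LaurentSeries.derivative k (xpow k n) = n • xpow k n := by
  rw [derivative_xpow, HahnSeries.single_mul_single, add_sub_cancel, one_mul]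
  ext j
  rw [HahnSeries.coeff_smul, HahnSeries.coeff_single, HahnSeries.coeff_single]
  split_ifs <;> simp

end Operators

section Substitution

variable {k : Type u} [Field k]

/-- The substitution `x ↦ s(x)` of `substHom`, as a `k`-linear map. -/
def substLin (s : PowerSeries k) (h0 : PowerSeries.constantCoeff s = 0) (hs : s ≠ 0) :
    LaurentSeries k →ₗ[k] LaurentSeries k where
  toFun := substHom s h0 hs
  map_add' := map_add _
  map_smul' c f := by
    rw [RingHom.id_apply, ← HahnSeries.C_mul_eq_smul, ← HahnSeries.C_mul_eq_smul, map_mul,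
      substHom_C]

theorem adicContinuous_substLin (s : PowerSeries k) (h0 : PowerSeries.constantCoeff s = 0)
    (hs : s ≠ 0) : AdicContinuous (substLin s h0 hs) := by
  refine (adicContinuous_iff cofinal_ordGE cofinal_ordGE).2 fun m => ⟨m.toNat, fun f hf => ?_⟩
  refine ordGE_anti (Int.self_le_toNat m) ?_
  obtain ⟨p, rfl⟩ := mem_ordGE_iff_exists.1 hf
  obtain ⟨r, hr⟩ := PowerSeries.X_dvd_iff.2 h0
  have hX : xpow k m.toNat = HahnSeries.ofPowerSeries ℤ k (PowerSeries.X ^ m.toNat) :=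
    (HahnSeries.ofPowerSeries_X_pow _).symm
  have hsub := PowerSeries.HasSubst.of_constantCoeff_zero' h0
  refine mem_ordGE_iff_exists.2 ⟨r ^ m.toNat * p.subst s, ?_⟩
  change substHom s h0 hs _ = _
  rw [hX, ← map_mul, ← map_mul, substHom_coe, PowerSeries.subst_mul hsub,
    PowerSeries.subst_pow hsub, PowerSeries.subst_X hsub, hr, mul_pow, mul_assoc]

/-- The automorphism `φ` of `k((x))`, as a `k`-linear map. -/
def phiLin (k : Type u) [Field k] : LaurentSeries k →ₗ[k] LaurentSeries k :=
  substLin (shiftSeries k) shiftSeries_constantCoeff shiftSeries_ne_zero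

theorem adicContinuous_phiLin : AdicContinuous (phiLin k) := adicContinuous_substLin _ _ _

theorem phi_xpow_neg_one : phi k (xpow k (-1)) = xpow k (-1) + 1 := by
  have h1 : phi k (xpow k 1) * (1 + xpow k 1) = xpow k 1 := by
    have hX : xpow k 1 = HahnSeries.ofPowerSeries ℤ k PowerSeries.X :=
      HahnSeries.ofPowerSeries_X.symm
    rw [hX, phi, substHom_coe, PowerSeries.subst_X
      (PowerSeries.HasSubst.of_constantCoeff_zero' shiftSeries_constantCoeff), ← map_one
      (HahnSeries.ofPowerSeries ℤ k), ← map_add, ← map_mul, shiftSeries, mul_assoc,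
      PowerSeries.inv_mul_cancel _ (by simp), mul_one]
  have h2 : xpow k (-1) * xpow k 1 = 1 := xpow_neg_mul_xpow 1
  have h3 : phi k (xpow k (-1)) * phi k (xpow k 1) = 1 := by rw [← map_mul, h2, map_one]
  calc phi k (xpow k (-1))
      = phi k (xpow k (-1)) * (xpow k (-1) * xpow k 1) := by rw [h2, mul_one]
    _ = phi k (xpow k (-1)) * (xpow k (-1) * (phi k (xpow k 1) * (1 + xpow k 1))) := by rw [h1]
    _ = (phi k (xpow k (-1)) * phi k (xpow k 1)) * (xpow k (-1) + xpow k (-1) * xpow k 1) := by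
      ring
    _ = xpow k (-1) + 1 := by rw [h2, h3, one_mul]

end Substitution

section Euler

variable {k : Type u} [Field k]

theorem FormalConnection.adicContinuous_nabla (E : FormalConnection k) :
    AdicContinuous E.nabla := by
  refine .of_basis (Module.finBasis (LaurentSeries k) E.carrier) fun i => ?_
  exact ((adicContinuous_smulVec _).add ((adicContinuous_smulVec _).comp
    adicContinuous_derivative)).of_eq fun f => (E.leibniz f _).symm

theorem DifferenceModule.adicContinuous_Phi (D : DifferenceModule k) : AdicContinuous D.Phi := by
  refine .of_basis (Module.finBasis (LaurentSeries k) D.carrier) fun i => ?_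
  exact ((adicContinuous_smulVec _).comp adicContinuous_phiLin).of_eq
    fun f => (D.Phi_smul f _).symm

/-- The operator `ζ ∇_ζ = -z ∇_z`, which becomes multiplication by `θ⁻¹` on the Mellin transform. -/
def FormalConnection.euler (E : FormalConnection k) : E.carrier →ₗ[k] E.carrier :=
  smulOp E.carrier (xpow k 1) ∘ₗ E.nabla

theorem FormalConnection.euler_apply (E : FormalConnection k) (v : E.carrier) :
    E.euler v = xpow k 1 • E.nabla v := rfl

theorem FormalConnection.adicContinuous_euler (E : FormalConnection k) : AdicContinuous E.euler :=
  (adicContinuous_smulOp _).comp E.adicContinuous_nabla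

theorem FormalConnection.nabla_eq (E : FormalConnection k) (v : E.carrier) :
    E.nabla v = xpow k (-1) • E.euler v := by
  rw [E.euler_apply, xpow_neg_smul_xpow_smul]

theorem FormalConnection.Hom.map_euler {E E' : FormalConnection k} (f : E ⟶ E') (v : E.carrier) :
    f.toLinearMap (E.euler v) = E'.euler (f.toLinearMap v) := by
  rw [E.euler_apply, E'.euler_apply, map_smul, f.horizontal]

theorem neg_zAct_nablaZ (E : FormalConnection k) (v : E.carrier) :
    -(zAct E (nablaZ E v)) = E.euler v := by
  rw [zAct, nablaZ, smul_neg, neg_neg, smul_smul, xpow_mul_xpow]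
  rfl

theorem FormalConnection.euler_xpow_neg_one (E : FormalConnection k) (v : E.carrier) :
    E.euler (xpow k (-1) • v) = xpow k (-1) • E.euler v - xpow k (-1) • v := by
  have h : xpow k 1 * LaurentSeries.derivative k (xpow k (-1)) = -xpow k (-1) := by
    rw [xpow_one_mul_derivative_xpow, neg_one_zsmul]
  rw [E.euler_apply, E.leibniz, smul_add, smul_smul, smul_smul, h, neg_smul, ← sub_eq_add_neg,
    mul_comm, mul_smul, E.euler_apply]

end Euler

/-! ### Linearization of operators -/

section Leibniz

variable {k : Type*} [Field k]

theorem map_xpow_smul_of_commutator {V : Type*} [AddCommGroup V] [Module (LaurentSeries k) V]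
    {N : V →+ V} (h : ∀ v, N (xpow k (-1) • v) = xpow k (-1) • N v - xpow k (-1) • v)
    (n : ℤ) (v : V) : N (xpow k n • v) = xpow k n • N v + n • xpow k n • v := by
  have hneg (n : ℕ) (v : V) : N (xpow k (-n) • v) = xpow k (-n) • N v - n • xpow k (-n) • v := by
    induction n generalizing v with
    | zero => simp
    | succ n ih =>
      have hn : (-((n + 1 : ℕ) : ℤ)) = -n + -1 := by push_cast; ring
      rw [hn, ← xpow_mul_xpow, mul_smul, ih, h, smul_sub, ← mul_smul, ← mul_smul, succ_nsmul']
      abel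
  obtain ⟨n, rfl | rfl⟩ := n.eq_nat_or_neg
  · have hn := hneg n (xpow k n • v)
    rw [xpow_neg_smul_xpow_smul] at hn
    rw [hn, smul_sub, smul_comm (xpow k n) n, xpow_smul_xpow_neg_smul,
      natCast_zsmul, sub_add_cancel]
  · rw [hneg, neg_smul, natCast_zsmul, sub_eq_add_neg]

theorem AdicContinuous.leibniz_of_commutator {V : Type*} [AddCommGroup V] [Module k V]
    [Module (LaurentSeries k) V] [IsScalarTower k (LaurentSeries k) V]
    [FiniteDimensional (LaurentSeries k) V] {N : V →ₗ[k] V} (hN : AdicContinuous N)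
    (h : ∀ v, N (xpow k (-1) • v) = xpow k (-1) • N v - xpow k (-1) • v)
    (f : LaurentSeries k) (v : V) :
    N (f • v) = f • N v + (xpow k 1 * LaurentSeries.derivative k f) • v := by
  have hext : N ∘ₗ smulVec v = smulVec (N v) +
      smulVec v ∘ₗ smulOp (LaurentSeries k) (xpow k 1) ∘ₗ LaurentSeries.derivative k := by
    refine (hN.comp (adicContinuous_smulVec v)).ext_xpow ((adicContinuous_smulVec _).add
      ((adicContinuous_smulVec v).comp ((adicContinuous_smulOp _).comp
        adicContinuous_derivative))) fun n => ?_
    simp only [LinearMap.add_apply, LinearMap.comp_apply, smulVec_apply, smulOp_apply, smul_eq_mul,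
      xpow_one_mul_derivative_xpow, smul_assoc]
    exact map_xpow_smul_of_commutator (N := N.toAddMonoidHom) h n v
  exact LinearMap.congr_fun hext f

end Leibniz

section Linearizes

variable {k : Type*} [Field k]
variable {V : Type*} [AddCommGroup V] [Module k V] [Module (LaurentSeries k) V]
  [IsScalarTower k (LaurentSeries k) V] [FiniteDimensional (LaurentSeries k) V]
variable {V' : Type*} [AddCommGroup V'] [Module k V'] [Module (LaurentSeries k) V']
  [IsScalarTower k (LaurentSeries k) V'] [FiniteDimensional (LaurentSeries k) V']
variable {M : Type*} [AddCommGroup M] [Module k M] [Module (LaurentSeries k) M]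
  [IsScalarTower k (LaurentSeries k) M] [FiniteDimensional (LaurentSeries k) M]
variable {M' : Type*} [AddCommGroup M'] [Module k M'] [Module (LaurentSeries k) M']
  [IsScalarTower k (LaurentSeries k) M'] [FiniteDimensional (LaurentSeries k) M']

/-- The homeomorphism `e : V ≃ M` of `k((x))`-vector spaces conjugates the operator `N` on `V` to
multiplication by `x⁻¹` on `M`. In other words, `M` is the space `V` with the new `k((x))`-structure
in which `x` acts as `N⁻¹`. -/
structure Linearizes (N : V →ₗ[k] V) (e : V ≃ₗ[k] M) : Prop where
  map_apply : ∀ v, e (N v) = xpow k (-1) • e v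
  continuous : AdicContinuous (e : V →ₗ[k] M)
  continuous_symm : AdicContinuous (e.symm : M →ₗ[k] V)

namespace Linearizes

variable {N : V →ₗ[k] V} {e : V ≃ₗ[k] M} {N' : V' →ₗ[k] V'} {e' : V' ≃ₗ[k] M'}

theorem symm_apply_xpow_neg_one_smul (h : Linearizes N e) (m : M) :
    e.symm (xpow k (-1) • m) = N (e.symm m) := by
  rw [LinearEquiv.symm_apply_eq, h.map_apply, e.apply_symm_apply]

theorem continuous_conj (h : Linearizes N e) {A : V →ₗ[k] V} (hA : AdicContinuous A) :
    AdicContinuous (e.conj A) := h.continuous.comp (hA.comp h.continuous_symm)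

/-- A continuous map commuting with the linearized operators is `k((x))`-linear for the new
structures. -/
def transport (h : Linearizes N e) (h' : Linearizes N' e') (A : V →ₗ[k] V')
    (hA : AdicContinuous A) (comm : ∀ v, A (N v) = N' (A v)) : M →ₗ[LaurentSeries k] M' where
  toFun m := e' (A (e.symm m))
  map_add' m m' := by simp only [map_add]
  map_smul' := (h'.continuous.comp (hA.comp h.continuous_symm)).map_smul_of_xpow_neg_one fun m => by
    simp only [LinearMap.comp_apply, LinearEquiv.coe_coe]
    rw [h.symm_apply_xpow_neg_one_smul, comm, h'.map_apply]

end Linearizes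

end Linearizes

section Transform

variable {k : Type u} [Field k]

theorem isMellinTransform_iff {E : FormalConnection k} {D : DifferenceModule k}
    {e : E.carrier ≃ₗ[k] D.carrier} : IsMellinTransform E D e ↔
      Linearizes E.euler e ∧ Linearizes D.Phi e.symm := by
  have theta_iff (v) : xpow k 1 • e (E.euler v) = e v ↔ e (E.euler v) = xpow k (-1) • e v :=
    ⟨fun h => by rw [← h, xpow_neg_smul_xpow_smul], fun h => by rw [h, xpow_smul_xpow_neg_smul]⟩
  constructor
  · rintro ⟨htheta, hPhi, htop⟩
    obtain ⟨hc, hc'⟩ := induced_adicTopology_eq_iff.1 htop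
    refine ⟨⟨fun v => ?_, hc, hc'⟩, fun m => ?_, hc', hc⟩
    · rw [← theta_iff, ← neg_zAct_nablaZ]
      exact htheta v
    · rw [LinearEquiv.symm_apply_eq, ← e.apply_symm_apply m, hPhi, e.symm_apply_apply]
      rfl
  · rintro ⟨h, h'⟩
    refine ⟨fun v => ?_, fun v => ?_, induced_adicTopology_eq_iff.2 ⟨h.continuous, h'.continuous⟩⟩
    · rw [neg_zAct_nablaZ]
      exact (theta_iff v).2 (h.map_apply v)
    · rw [← LinearEquiv.symm_apply_eq, h'.map_apply, e.symm_apply_apply]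
      rfl

namespace IsMellinTransform

variable {E E' : FormalConnection k} {D D' : DifferenceModule k}
  {e : E.carrier ≃ₗ[k] D.carrier} {e' : E'.carrier ≃ₗ[k] D'.carrier}

theorem linearizes_euler (h : IsMellinTransform E D e) : Linearizes E.euler e :=
  (isMellinTransform_iff.1 h).1

theorem linearizes_Phi (h : IsMellinTransform E D e) : Linearizes D.Phi e.symm :=
  (isMellinTransform_iff.1 h).2

/-- A horizontal map, transported to the Mellin transforms. -/
def mapHom (h : IsMellinTransform E D e) (h' : IsMellinTransform E' D' e') (f : E ⟶ E') :
    D ⟶ D' where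
  toLinearMap := h.linearizes_euler.transport h'.linearizes_euler (f.toLinearMap.restrictScalars k)
    (adicContinuous_restrictScalars _) f.map_euler
  comm m := by
    change e' (f.toLinearMap (e.symm (D.Phi m))) = D'.Phi (e' (f.toLinearMap (e.symm m)))
    rw [h.linearizes_Phi.map_apply, map_smul]
    exact (h'.Phi _).symm

theorem mapHom_apply (h : IsMellinTransform E D e) (h' : IsMellinTransform E' D' e')
    (f : E ⟶ E') (v : E.carrier) :
    (h.mapHom h' f).toLinearMap (e v) = e' (f.toLinearMap v) :=
  congrArg (fun w => e' (f.toLinearMap w)) (e.symm_apply_apply v)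

/-- A morphism of Mellin transforms, transported to the connections. -/
def comapHom (h : IsMellinTransform E D e) (h' : IsMellinTransform E' D' e') (g : D ⟶ D') :
    E ⟶ E' where
  toLinearMap := h.linearizes_Phi.transport h'.linearizes_Phi (g.toLinearMap.restrictScalars k)
    (adicContinuous_restrictScalars _) g.comm
  horizontal v := by
    rw [E.nabla_eq, E'.nabla_eq, map_smul]
    congr 1
    change e'.symm (g.toLinearMap (e (E.euler v))) = E'.euler (e'.symm (g.toLinearMap (e v)))
    rw [h.linearizes_euler.map_apply, map_smul, h'.linearizes_euler.symm_apply_xpow_neg_one_smul]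

theorem comapHom_apply (h : IsMellinTransform E D e) (h' : IsMellinTransform E' D' e')
    (g : D ⟶ D') (v : E.carrier) :
    e' ((h.comapHom h' g).toLinearMap v) = g.toLinearMap (e v) :=
  e'.apply_symm_apply _

end IsMellinTransform

variable {M : Type u} [AddCommGroup M] [Module k M] [Module (LaurentSeries k) M]
  [IsScalarTower k (LaurentSeries k) M] [FiniteDimensional (LaurentSeries k) M]

/-- The Mellin transform on `M` of a connection `E`, given an identification of `E` with `M` that
turns `ζ ∇_ζ` into `θ⁻¹`. -/
def differenceModuleOf (E : FormalConnection k) (e : E.carrier ≃ₗ[k] M)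
    (h : Linearizes E.euler e) : DifferenceModule k where
  carrier := M
  Phi := e.conj (smulOp E.carrier (xpow k (-1)))
  Phi_smul f m := by
    refine AdicContinuous.map_smul_of_xpow (σ := phiLin k)
      (h.continuous_conj (adicContinuous_smulOp _)) adicContinuous_phiLin (fun n =>
        map_xpow_smul_of_xpow_neg_one (σ := phi k)
          (A := (e.conj (smulOp E.carrier (xpow k (-1)))).toAddMonoidHom) (fun v => ?_) n m) f
    simp only [LinearMap.toAddMonoidHom_coe, LinearEquiv.conj_apply_apply, smulOp_apply]
    rw [h.symm_apply_xpow_neg_one_smul, phi_xpow_neg_one, add_smul, one_smul, ← h.map_apply,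
      E.euler_xpow_neg_one, ← map_add, sub_add_cancel]
  bijective := by
    have hz : Function.Bijective (smulOp E.carrier (xpow k (-1))) :=
      Function.bijective_iff_has_inverse.2 ⟨smulOp E.carrier (xpow k 1),
        xpow_smul_xpow_neg_smul 1, xpow_neg_smul_xpow_smul 1⟩
    exact e.bijective.comp (hz.comp e.symm.bijective)

theorem isMellinTransform_differenceModuleOf (E : FormalConnection k) (e : E.carrier ≃ₗ[k] M)
    (h : Linearizes E.euler e) : IsMellinTransform E (differenceModuleOf E e h) e :=
  isMellinTransform_iff.2 ⟨h, fun m => e.symm_apply_apply (xpow k (-1) • e.symm m),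
    h.continuous_symm, h.continuous⟩

/-- The connection on `M` whose Mellin transform is a difference module `D`, given an identification
of `D` with `M` that turns `Φ` into `ζ⁻¹`. -/
def formalConnectionOf (D : DifferenceModule k) (e : D.carrier ≃ₗ[k] M)
    (h : Linearizes D.Phi e) : FormalConnection k where
  carrier := M
  nabla := smulOp M (xpow k (-1)) ∘ₗ e.conj (smulOp D.carrier (xpow k (-1)))
  leibniz f m := by
    have comm (m : M) : e.conj (smulOp D.carrier (xpow k (-1))) (xpow k (-1) • m) =
        xpow k (-1) • e.conj (smulOp D.carrier (xpow k (-1))) m - xpow k (-1) • m := by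
      obtain ⟨v, rfl⟩ := e.surjective m
      simp only [LinearEquiv.conj_apply_apply, smulOp_apply, e.symm_apply_apply]
      rw [← h.map_apply, e.symm_apply_apply, ← h.map_apply, D.Phi_smul, phi_xpow_neg_one, add_smul,
        one_smul, map_add, add_sub_cancel_right]
    simp only [LinearMap.comp_apply, smulOp_apply]
    rw [(h.continuous_conj (adicContinuous_smulOp _)).leibniz_of_commutator comm, smul_add,
      mul_smul, xpow_neg_smul_xpow_smul, smul_comm]

theorem isMellinTransform_formalConnectionOf (D : DifferenceModule k) (e : D.carrier ≃ₗ[k] M)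
    (h : Linearizes D.Phi e) : IsMellinTransform (formalConnectionOf D e h) D e.symm := by
  refine isMellinTransform_iff.2 ⟨⟨fun m => ?_, h.continuous_symm, h.continuous⟩, h⟩
  change e.symm (xpow k 1 • xpow k (-1) • e (xpow k (-1) • e.symm m)) = _
  rw [xpow_smul_xpow_neg_smul, e.symm_apply_apply]
  rfl

end Transform

/-! ### Extensions -/

section Recursion

theorem exists_seq_add_one_eq {A : Type*} [AddCommGroup A] (d : ℤ → A) :
    ∃ s : ℤ → A, ∀ n, s (n + 1) = s n + d n := by
  refine ⟨fun n => ∑ j ∈ Finset.Ico 0 n, d j - ∑ j ∈ Finset.Ico n 0, d j, fun n => ?_⟩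
  rcases le_or_gt 0 n with hn | hn
  · have h : Finset.Ico 0 (n + 1) = insert n (Finset.Ico 0 n) := by
      ext j
      simp only [Finset.mem_Ico, Finset.mem_insert]
      lia
    simp only [h, Finset.sum_insert (show n ∉ Finset.Ico 0 n by simp),
      Finset.Ico_eq_empty_of_le hn, Finset.Ico_eq_empty_of_le (show 0 ≤ n + 1 by lia),
      Finset.sum_empty]
    abel
  · have h : Finset.Ico n 0 = insert n (Finset.Ico (n + 1) 0) := by
      ext j
      simp only [Finset.mem_Ico, Finset.mem_insert]
      lia
    simp only [h, Finset.sum_insert (show n ∉ Finset.Ico (n + 1) 0 by simp),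
      Finset.Ico_eq_empty_of_le hn.le, Finset.Ico_eq_empty_of_le (show n + 1 ≤ 0 by lia),
      Finset.sum_empty]
    abel

variable {k : Type*} [Field k]
variable {V : Type*} [AddCommGroup V] [Module k V] [Module (LaurentSeries k) V]
  [IsScalarTower k (LaurentSeries k) V] [FiniteDimensional (LaurentSeries k) V]

theorem eventually_mem_of_recursion {s c : ℤ → V}
    (hc : ∀ m, ∃ N, ∀ n ≥ N, c n ∈ adicFiltration k V m)
    (h : ∀ n, s (n + 1) = xpow k 1 • s n + c n) (m : ℤ) :
    ∃ N, ∀ n ≥ N, s n ∈ adicFiltration k V m := by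
  obtain ⟨N, hN⟩ := hc m
  obtain ⟨d, hd⟩ := exists_mem_basisFiltration (Module.finBasis (LaurentSeries k) V) (s N)
  have hmem (l : ℕ) : s (N + l) ∈ adicFiltration k V (min m (d + l)) := by
    induction l with
    | zero =>
      rw [Nat.cast_zero, add_zero, add_zero]
      exact basisFiltration_anti _ (min_le_right m d) hd
    | succ l ih =>
      rw [Nat.cast_succ, ← add_assoc N, h]
      refine add_mem
        (basisFiltration_anti _ ?_ (smul_mem_basisFiltration (xpow_mem_ordGE 1) ih))
        (basisFiltration_anti _ (min_le_left _ _) (hN _ (by lia)))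
      lia
  refine ⟨N + (m - d).toNat, fun n hn => ?_⟩
  have hn' := hmem (n - N).toNat
  rw [show N + ((n - N).toNat : ℤ) = n by lia] at hn'
  exact basisFiltration_anti _ (by lia) hn'

end Recursion

section Shear

variable {k : Type*} [Field k] {M₁ : Type*} [AddCommGroup M₁] [Module k M₁]
  {M₂ : Type*} [AddCommGroup M₂] [Module k M₂]

/-- The shear `(a, b) ↦ (a + τ b, b)`. -/
def shear (τ : M₂ →ₗ[k] M₁) : (M₁ × M₂) ≃ₗ[k] M₁ × M₂ :=
  LinearEquiv.ofLinearMap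
    (LinearMap.id + LinearMap.inl k M₁ M₂ ∘ₗ τ ∘ₗ LinearMap.snd k M₁ M₂)
    (LinearMap.id - LinearMap.inl k M₁ M₂ ∘ₗ τ ∘ₗ LinearMap.snd k M₁ M₂)
    (by ext <;> simp) (by ext <;> simp)

theorem shear_apply (τ : M₂ →ₗ[k] M₁) (p : M₁ × M₂) : shear τ p = (p.1 + τ p.2, p.2) := by
  ext <;> simp [shear]

end Shear

section Extension

variable {k : Type*} [Field k]
variable {V : Type*} [AddCommGroup V] [Module k V] [Module (LaurentSeries k) V]
  [IsScalarTower k (LaurentSeries k) V] [FiniteDimensional (LaurentSeries k) V]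
variable {M₁ : Type*} [AddCommGroup M₁] [Module k M₁] [Module (LaurentSeries k) M₁]
  [IsScalarTower k (LaurentSeries k) M₁] [FiniteDimensional (LaurentSeries k) M₁]
variable {M₂ : Type*} [AddCommGroup M₂] [Module k M₂] [Module (LaurentSeries k) M₂]
  [IsScalarTower k (LaurentSeries k) M₂] [FiniteDimensional (LaurentSeries k) M₂]

theorem exists_commutator_eq_laurentSeries {γ : LaurentSeries k →ₗ[k] M₁} (hγ : AdicContinuous γ) :
    ∃ T : LaurentSeries k →ₗ[k] M₁, AdicContinuous T ∧
      ∀ f, γ f + T (xpow k (-1) * f) = xpow k (-1) • T f := by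
  obtain ⟨s, hs⟩ := exists_seq_add_one_eq fun n => xpow k (-n) • γ (xpow k (n + 1))
  have hrec (n : ℤ) : xpow k (n + 1) • s (n + 1) =
      xpow k 1 • xpow k n • s n + xpow k 1 • γ (xpow k (n + 1)) := by
    rw [hs, smul_add, smul_smul, smul_smul, xpow_mul_xpow, xpow_mul_xpow, add_comm 1 n,
      add_neg_cancel_comm]
  obtain ⟨T, hT, hTx⟩ := exists_adicContinuous_xpow (fun n => xpow k n • s n) <| by
    refine eventually_mem_of_recursion (fun m => ?_) hrec
    obtain ⟨N, hN⟩ := (adicContinuous_iff cofinal_ordGE (Cofinal.refl _)).1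
      ((adicContinuous_smulOp (xpow k 1)).comp hγ) m
    exact ⟨N, fun n hn => hN _ (ordGE_anti (by lia) (xpow_mem_ordGE (n + 1)))⟩
  have hext : γ + T ∘ₗ smulOp _ (xpow k (-1)) = smulOp M₁ (xpow k (-1)) ∘ₗ T := by
    refine (hγ.add (hT.comp (adicContinuous_smulOp _))).ext_xpow
      ((adicContinuous_smulOp _).comp hT) fun n => ?_
    have hn := hrec (-1 + n)
    rw [neg_add_cancel_comm] at hn
    simp only [LinearMap.add_apply, LinearMap.comp_apply, smulOp_apply, smul_eq_mul, xpow_mul_xpow,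
      hTx, hn, smul_add]
    rw [xpow_neg_smul_xpow_smul, xpow_neg_smul_xpow_smul, add_comm]
  exact ⟨T, hT, LinearMap.congr_fun hext⟩

theorem exists_commutator_eq {β : M₂ →ₗ[k] M₁} (hβ : AdicContinuous β) :
    ∃ τ : M₂ →ₗ[k] M₁, AdicContinuous τ ∧
      ∀ w, β w + τ (xpow k (-1) • w) = xpow k (-1) • τ w := by
  let b := Module.finBasis (LaurentSeries k) M₂
  choose T hT hTβ using fun i =>
    exists_commutator_eq_laurentSeries (hβ.comp (adicContinuous_smulVec (b i)))
  refine ⟨∑ i, T i ∘ₗ (b.coord i).restrictScalars k,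
    AdicContinuous.sum _ fun i => (hT i).comp (adicContinuous_restrictScalars _), fun w => ?_⟩
  have hw : β w = ∑ i, β (b.coord i w • b i) := by
    rw [← map_sum]
    exact congrArg β (b.sum_repr w).symm
  simp only [LinearMap.sum_apply, LinearMap.comp_apply, LinearMap.restrictScalars_apply, map_smul,
    smul_eq_mul, Finset.smul_sum, hw, ← Finset.sum_add_distrib]
  exact Finset.sum_congr rfl fun i _ => hTβ i _

theorem AdicContinuous.inl_comp_snd {τ : M₂ →ₗ[k] M₁} (hτ : AdicContinuous τ) :
    AdicContinuous (LinearMap.inl k M₁ M₂ ∘ₗ τ ∘ₗ LinearMap.snd k M₁ M₂) :=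
  (adicContinuous_restrictScalars (LinearMap.inl (LaurentSeries k) M₁ M₂)).comp
    (hτ.comp (adicContinuous_restrictScalars (LinearMap.snd (LaurentSeries k) M₁ M₂)))

theorem AdicContinuous.shear {τ : M₂ →ₗ[k] M₁} (hτ : AdicContinuous τ) :
    AdicContinuous (shear τ : M₁ × M₂ →ₗ[k] M₁ × M₂) :=
  adicContinuous_id.add hτ.inl_comp_snd

theorem AdicContinuous.shear_symm {τ : M₂ →ₗ[k] M₁} (hτ : AdicContinuous τ) :
    AdicContinuous ((LocalMellin.shear τ).symm : M₁ × M₂ →ₗ[k] M₁ × M₂) :=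
  adicContinuous_id.sub hτ.inl_comp_snd

theorem exists_linearizes_trans_shear {N : V →ₗ[k] V} (hN : AdicContinuous N)
    {e : V ≃ₗ[k] M₁ × M₂} (he : AdicContinuous (e : V →ₗ[k] M₁ × M₂))
    (he' : AdicContinuous (e.symm : M₁ × M₂ →ₗ[k] V))
    (hfst : ∀ a, e (N (e.symm (a, 0))) = xpow k (-1) • (a, 0))
    (hsnd : ∀ v, (e (N v)).2 = xpow k (-1) • (e v).2) :
    ∃ τ : M₂ →ₗ[k] M₁, Linearizes N (e.trans (shear τ)) := by
  let β : M₂ →ₗ[k] M₁ := LinearMap.fst k M₁ M₂ ∘ₗ (e : V →ₗ[k] M₁ × M₂) ∘ₗ N ∘ₗ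
    (e.symm : M₁ × M₂ →ₗ[k] V) ∘ₗ LinearMap.inr k M₁ M₂
  have hβ : AdicContinuous β :=
    (adicContinuous_restrictScalars (LinearMap.fst (LaurentSeries k) M₁ M₂)).comp
      (he.comp (hN.comp (he'.comp
        (adicContinuous_restrictScalars (LinearMap.inr (LaurentSeries k) M₁ M₂)))))
  -- `N` becomes `(a, b) ↦ (x⁻¹ a + β b, x⁻¹ b)`; the shear by `τ` removes `β`.
  obtain ⟨τ, hτ, comm⟩ := exists_commutator_eq hβ
  refine ⟨τ, fun v => ?_, hτ.shear.comp he, he'.comp hτ.shear_symm⟩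
  have hv : (e (N v)).1 = xpow k (-1) • (e v).1 + β (e v).2 := by
    have hsplit : v = e.symm ((e v).1, 0) + e.symm (0, (e v).2) := by
      rw [← map_add, Prod.mk_add_mk, add_zero, zero_add, e.symm_apply_apply]
    conv_lhs => rw [hsplit, map_add, map_add, hfst]
    rfl
  rw [LinearEquiv.trans_apply, LinearEquiv.trans_apply, shear_apply, shear_apply, hv, hsnd,
    Prod.smul_mk, smul_add, ← comm, add_assoc]

variable {V₁ : Type*} [AddCommGroup V₁] [Module k V₁] [Module (LaurentSeries k) V₁]
  [IsScalarTower k (LaurentSeries k) V₁] [FiniteDimensional (LaurentSeries k) V₁]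
variable {V₂ : Type*} [AddCommGroup V₂] [Module k V₂] [Module (LaurentSeries k) V₂]
  [IsScalarTower k (LaurentSeries k) V₂] [FiniteDimensional (LaurentSeries k) V₂]

theorem AdicContinuous.prodMap {A : V₁ →ₗ[k] M₁} {B : V₂ →ₗ[k] M₂} (hA : AdicContinuous A)
    (hB : AdicContinuous B) : AdicContinuous (A.prodMap B) := by
  refine AdicContinuous.of_eq
    (((adicContinuous_restrictScalars (LinearMap.inl (LaurentSeries k) M₁ M₂)).comp
      (hA.comp (adicContinuous_restrictScalars (LinearMap.fst (LaurentSeries k) V₁ V₂)))).add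
    ((adicContinuous_restrictScalars (LinearMap.inr (LaurentSeries k) M₁ M₂)).comp
      (hB.comp (adicContinuous_restrictScalars (LinearMap.snd (LaurentSeries k) V₁ V₂)))))
    fun v => ?_
  ext <;> simp

theorem exists_equiv_prod_of_exact {R A B C : Type*} [DivisionRing R] [AddCommGroup A]
    [Module R A] [AddCommGroup B] [Module R B] [AddCommGroup C] [Module R C]
    {i : A →ₗ[R] B} {π : B →ₗ[R] C} (hi : Function.Injective i) (hπ : Function.Surjective π)
    (hex : Function.Exact i π) :
    ∃ e : B ≃ₗ[R] A × C, (∀ v, e (i v) = (v, 0)) ∧ ∀ v, (e v).2 = π v := by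
  obtain ⟨l, hl⟩ := π.exists_rightInverse_of_surjective (LinearMap.range_eq_top.2 hπ)
  obtain ⟨e, he, he'⟩ := hex.splitSurjectiveEquiv hi ⟨l, hl⟩
  refine ⟨e, fun v => ?_, fun v => (LinearMap.congr_fun he' v).symm⟩
  rw [← e.eq_symm_apply]
  exact LinearMap.congr_fun he v

theorem Linearizes.exists_of_exact {i : V₁ →ₗ[LaurentSeries k] V} {π : V →ₗ[LaurentSeries k] V₂}
    (hi : Function.Injective i) (hπ : Function.Surjective π) (hex : Function.Exact i π)
    {N₁ : V₁ →ₗ[k] V₁} {N : V →ₗ[k] V} {N₂ : V₂ →ₗ[k] V₂} (hN : AdicContinuous N)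
    (hNi : ∀ v, N (i v) = i (N₁ v)) (hNπ : ∀ v, π (N v) = N₂ (π v))
    {e₁ : V₁ ≃ₗ[k] M₁} {e₂ : V₂ ≃ₗ[k] M₂} (h₁ : Linearizes N₁ e₁) (h₂ : Linearizes N₂ e₂) :
    ∃ e : V ≃ₗ[k] M₁ × M₂, Linearizes N e := by
  obtain ⟨s, hsi, hsπ⟩ := exists_equiv_prod_of_exact hi hπ hex
  let e : V ≃ₗ[k] M₁ × M₂ := (s.restrictScalars k).trans (e₁.prodCongr e₂)
  have ei (v) : e (i v) = (e₁ v, 0) := by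
    simp only [e, LinearEquiv.trans_apply, LinearEquiv.restrictScalars_apply, hsi,
      LinearEquiv.prodCongr_apply, map_zero]
  have eπ (v) : (e v).2 = e₂ (π v) := congrArg e₂ (hsπ v)
  obtain ⟨τ, hτ⟩ := exists_linearizes_trans_shear (e := e) hN
    ((h₁.continuous.prodMap h₂.continuous).comp (adicContinuous_restrictScalars s.toLinearMap))
    ((adicContinuous_restrictScalars s.symm.toLinearMap).comp
      (h₁.continuous_symm.prodMap h₂.continuous_symm))
    (fun a => by
      have ha : e.symm (a, 0) = i (e₁.symm a) := by
        rw [LinearEquiv.symm_apply_eq, ei, e₁.apply_symm_apply]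
      rw [ha, hNi, ei, h₁.map_apply, e₁.apply_symm_apply, Prod.smul_mk, smul_zero])
    (fun v => by rw [eπ, eπ, hNπ, h₂.map_apply])
  exact ⟨_, hτ⟩

end Extension

/-! ### Operators with polynomial coefficients -/

section DifferenceEquation

variable {k : Type*} [Field k] [CharZero k]

theorem exists_polynomial_eval_add {h : k} (hh : h ≠ 0) (R : Polynomial k) :
    ∃ Q : Polynomial k, ∀ x, Q.eval (x + h) = Q.eval x + R.eval x := by
  induction R using Polynomial.induction_on' with
  | add p q hp hq =>
    obtain ⟨P, hP⟩ := hp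
    obtain ⟨Q, hQ⟩ := hq
    refine ⟨P + Q, fun x => ?_⟩
    rw [Polynomial.eval_add, Polynomial.eval_add, Polynomial.eval_add, hP, hQ]
    ring
  | monomial n a =>
    let B : Polynomial k := (Polynomial.bernoulli (n + 1)).map (algebraMap ℚ k)
    have hB (y : k) : B.eval (1 + y) = B.eval y + (n + 1) * y ^ n := by
      have := congrArg (fun P => (P.map (algebraMap ℚ k)).eval y)
        (Polynomial.bernoulli_comp_one_add_X (n + 1))
      simpa [B, Polynomial.map_comp] using this
    have hn : (n + 1 : k) ≠ 0 := by exact_mod_cast n.succ_ne_zero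
    refine ⟨Polynomial.C (a * h ^ n / (n + 1)) *
      B.comp (Polynomial.C h⁻¹ * Polynomial.X), fun x => ?_⟩
    have hx : h⁻¹ * (x + h) = 1 + h⁻¹ * x := by field_simp; ring
    simp only [Polynomial.eval_mul, Polynomial.eval_C, Polynomial.eval_comp, Polynomial.eval_X, hx,
      hB, Polynomial.eval_monomial, mul_pow, inv_pow]
    field_simp

/-- A solution `Q` of the difference equation `Q(x + h) - Q(x) = R(x)`. -/
def diffInv {h : k} (hh : h ≠ 0) (R : Polynomial k) : Polynomial k :=
  (exists_polynomial_eval_add hh R).choose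

theorem diffInv_eval {h : k} (hh : h ≠ 0) (R : Polynomial k) (x : k) :
    (diffInv hh R).eval (x + h) = (diffInv hh R).eval x + R.eval x :=
  (exists_polynomial_eval_add hh R).choose_spec x

/-- Polynomials `q m` with `q 0 = 1` and
`b (q m (x + h) - q m (x)) = ∑ i < m, q i (x) a (m - i) (x + i)`. -/
def diffSeq {h : k} (hh : h ≠ 0) (b : k) (a : ℕ → Polynomial k) (m : ℕ) : Polynomial k :=
  if m = 0 then 1 else diffInv hh (Polynomial.C b⁻¹ *
    ∑ i : Fin m, diffSeq hh b a i * (a (m - i)).comp (Polynomial.X + Polynomial.C ((i : ℕ) : k)))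
termination_by m
decreasing_by exact i.2

theorem diffSeq_zero {h : k} (hh : h ≠ 0) (b : k) (a : ℕ → Polynomial k) :
    diffSeq hh b a 0 = 1 := by
  rw [diffSeq, if_pos rfl]

theorem diffSeq_eval {h : k} (hh : h ≠ 0) {b : k} (hb : b ≠ 0) {a : ℕ → Polynomial k}
    (ha : a 0 = Polynomial.C b) (m : ℕ) (x : k) :
    b * (diffSeq hh b a m).eval (x + h) = ∑ i ∈ Finset.range (m + 1),
      (diffSeq hh b a i).eval x * (a (m - i)).eval (x + i) := by
  rw [Finset.sum_range_succ, Nat.sub_self, ha, Polynomial.eval_C]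
  by_cases hm : m = 0
  · subst hm
    simp [diffSeq_zero]
  · rw [diffSeq, if_neg hm, diffInv_eval]
    simp only [Polynomial.eval_mul, Polynomial.eval_C, Polynomial.eval_finsetSum,
      Polynomial.eval_comp, Polynomial.eval_add, Polynomial.eval_X]
    rw [Fin.sum_univ_eq_sum_range fun i => (diffSeq hh b a i).eval x * (a (m - i)).eval (x + i)]
    field_simp
    ring

end DifferenceEquation

section RaisesOrder

variable {k : Type*} [Field k]

/-- The operator `A` on `k((x))` raises orders by at least `d`. -/
def RaisesOrder (d : ℤ) (A : LaurentSeries k →ₗ[k] LaurentSeries k) : Prop :=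
  ∀ ⦃n f⦄, f ∈ ordGE k n → A f ∈ ordGE k (n + d)

namespace RaisesOrder

variable {d : ℤ} {A : LaurentSeries k →ₗ[k] LaurentSeries k}

protected theorem adicContinuous (hA : RaisesOrder d A) : AdicContinuous A := by
  refine (adicContinuous_iff cofinal_ordGE cofinal_ordGE).2 fun m => ⟨m - d, fun f hf => ?_⟩
  have := hA hf
  rwa [sub_add_cancel] at this

theorem coeff_apply (hA : RaisesOrder d A) {n : ℤ} {f : LaurentSeries k} (hf : f ∈ ordGE k n)
    (m : ℕ) : (A f).coeff (n + d + m) =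
      ∑ i ∈ Finset.range (m + 1), f.coeff (n + i) * (A (xpow k (n + i))).coeff (n + d + m) := by
  have htail := hA (sub_sum_xpow_mem_ordGE hf (n + (m + 1 : ℕ))) (n + d + m) (by lia)
  rw [map_sub, HahnSeries.coeff_sub, sub_eq_zero] at htail
  have hIco : Finset.Ico n (n + (m + 1 : ℕ)) =
      (Finset.range (m + 1)).image fun i : ℕ => n + (i : ℤ) := by
    ext j
    simp only [Finset.mem_Ico, Finset.mem_image, Finset.mem_range]
    exact ⟨fun h => ⟨(j - n).toNat, by lia, by lia⟩, by rintro ⟨i, hi, rfl⟩; lia⟩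
  rw [htail, map_sum, HahnSeries.coeff_sum, hIco,
    Finset.sum_image fun i _ j _ hij => by exact_mod_cast add_left_cancel hij]
  simp only [map_smul, HahnSeries.coeff_smul, smul_eq_mul]

theorem coeff_apply_add (hA : RaisesOrder d A) {n : ℤ} {f : LaurentSeries k}
    (hf : f ∈ ordGE k n) :
    (A f).coeff (n + d) = f.coeff n * (A (xpow k n)).coeff (n + d) := by
  simpa only [Nat.cast_zero, add_zero, zero_add, Finset.sum_range_one] using hA.coeff_apply hf 0

theorem comp {d' : ℤ} {B : LaurentSeries k →ₗ[k] LaurentSeries k} (hA : RaisesOrder d A)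
    (hB : RaisesOrder d' B) : RaisesOrder (d + d') (A ∘ₗ B) := fun n f hf => by
  rw [add_comm d, ← add_assoc]
  exact hA (hB hf)

theorem mem_ordGE_of_apply (hA : RaisesOrder d A)
    (hlead : ∀ n, (A (xpow k n)).coeff (n + d) ≠ 0) {f : LaurentSeries k} {n : ℤ}
    (hf : A f ∈ ordGE k (n + d)) : f ∈ ordGE k n := by
  by_cases h0 : f = 0
  · rw [h0]
    exact zero_mem _
  · refine ordGE_anti ?_ (mem_ordGE_order f)
    by_contra hlt
    have hcoeff := hA.coeff_apply_add (mem_ordGE_order f)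
    rw [hf _ (by lia)] at hcoeff
    exact mul_ne_zero (HahnSeries.coeff_order_eq_zero.not.2 h0) (hlead _) hcoeff.symm

end RaisesOrder

theorem raisesOrder_smulOp {d : ℤ} {f : LaurentSeries k} (hf : f ∈ ordGE k d) :
    RaisesOrder d (smulOp (LaurentSeries k) f) := fun n g hg => by
  rw [add_comm]
  exact ordGE_mul hf hg

end RaisesOrder

section Triangular

variable {k : Type*} [Field k]

theorem ext_of_mem_ordGE {n : ℤ} {f g : LaurentSeries k} (hf : f ∈ ordGE k n) (hg : g ∈ ordGE k n)
    (h : ∀ m : ℕ, f.coeff (n + m) = g.coeff (n + m)) : f = g := by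
  ext j
  by_cases hj : j < n
  · rw [hf j hj, hg j hj]
  · rw [show j = n + ((j - n).toNat : ℤ) by lia]
    exact h _

/-- The Laurent series `∑ m, z m x ^ (n + m)`. -/
def seriesFrom (n : ℤ) (z : ℕ → k) : LaurentSeries k :=
  xpow k n * HahnSeries.ofPowerSeries ℤ k (PowerSeries.mk z)

theorem seriesFrom_mem_ordGE (n : ℤ) (z : ℕ → k) : seriesFrom n z ∈ ordGE k n :=
  mem_ordGE_iff_exists.2 ⟨_, rfl⟩

theorem coeff_seriesFrom (n : ℤ) (z : ℕ → k) (m : ℕ) : (seriesFrom n z).coeff (n + m) = z m := by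
  rw [seriesFrom, coeff_xpow_mul, add_sub_cancel_left, HahnSeries.ofPowerSeries_apply_coeff,
    PowerSeries.coeff_mk]

/-- The solution `z` of the triangular system `∑ i ≤ m, z i * a i m = y m`. -/
def triangularSolution (y : ℕ → k) (a : ℕ → ℕ → k) (m : ℕ) : k :=
  (a m m)⁻¹ * (y m - ∑ i : Fin m, triangularSolution y a i * a i m)
termination_by m
decreasing_by exact i.2

theorem triangularSolution_spec (y : ℕ → k) {a : ℕ → ℕ → k} (ha : ∀ m, a m m ≠ 0) (m : ℕ) :
    ∑ i ∈ Finset.range (m + 1), triangularSolution y a i * a i m = y m := by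
  rw [Finset.sum_range_succ]
  conv_lhs =>
    arg 2
    rw [triangularSolution]
  rw [Fin.sum_univ_eq_sum_range fun i => triangularSolution y a i * a i m]
  field_simp [ha m]
  ring

theorem RaisesOrder.bijective {d : ℤ} {A : LaurentSeries k →ₗ[k] LaurentSeries k}
    (hA : RaisesOrder d A) (hlead : ∀ n, (A (xpow k n)).coeff (n + d) ≠ 0) :
    Function.Bijective A := by
  refine ⟨(injective_iff_map_eq_zero A).2 fun f hf => eq_zero_of_forall_mem_ordGE fun n =>
    hA.mem_ordGE_of_apply hlead (by rw [hf]; exact zero_mem _), fun y => ?_⟩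
  obtain ⟨n, hy⟩ : ∃ n, y ∈ ordGE k (n + d) :=
    ⟨y.order - d, by rw [sub_add_cancel]; exact mem_ordGE_order y⟩
  let z := triangularSolution (fun m => y.coeff (n + d + m))
    fun i m => (A (xpow k (n + i))).coeff (n + d + m)
  have hz := seriesFrom_mem_ordGE n z
  refine ⟨seriesFrom n z, ext_of_mem_ordGE (hA hz) hy fun m => ?_⟩
  simp only [hA.coeff_apply hz, coeff_seriesFrom]
  refine triangularSolution_spec (fun m => y.coeff (n + d + m)) (fun m => ?_) m
  rw [add_right_comm]
  exact hlead _

end Triangular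

section IsPolynomial

variable {k : Type*} [Field k]

/-- The operator `A` on `k((x))` raises orders by at least `d`, and the coefficient of `x ^ (n + m)`
in `A (x ^ n)` is `c ^ n` times a polynomial in `n`, for every `m`. Both `ζ ∇_ζ` and `Φ` are of this
form on objects of rank one. -/
structure IsPolynomial (c : k) (d : ℤ) (A : LaurentSeries k →ₗ[k] LaurentSeries k) : Prop where
  raisesOrder : RaisesOrder d A
  exists_polynomial : ∀ m : ℤ, ∃ P : Polynomial k, ∀ n : ℤ,
    (A (xpow k n)).coeff (n + m) = c ^ n * P.eval (n : k)

namespace IsPolynomial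

variable {c : k} {d : ℤ} {A B : LaurentSeries k →ₗ[k] LaurentSeries k}

theorem comp (hc : c ≠ 0) {c' : k} {d' : ℤ} (hA : IsPolynomial c d A) (hB : IsPolynomial c' d' B) :
    IsPolynomial (c * c') (d + d') (A ∘ₗ B) where
  raisesOrder := hA.raisesOrder.comp hB.raisesOrder
  exists_polynomial m := by
    by_cases hm : m < d + d'
    · refine ⟨0, fun n => ?_⟩
      rw [hA.raisesOrder.comp hB.raisesOrder (xpow_mem_ordGE n) _ (by lia), Polynomial.eval_zero,
        mul_zero]
    obtain ⟨l, rfl⟩ : ∃ l : ℕ, m = d' + d + l := ⟨(m - (d' + d)).toNat, by lia⟩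
    choose P hP using hA.exists_polynomial
    choose Q hQ using hB.exists_polynomial
    refine ⟨∑ i ∈ Finset.range (l + 1), Polynomial.C (c ^ (d' + (i : ℤ))) * Q (d' + i) *
      (P (d + l - i)).comp (Polynomial.X + Polynomial.C ((d' + (i : ℤ) : ℤ) : k)), fun n => ?_⟩
    rw [LinearMap.comp_apply, ← add_assoc, ← add_assoc,
      hA.raisesOrder.coeff_apply (hB.raisesOrder (xpow_mem_ordGE n)), Polynomial.eval_finsetSum,
      Finset.mul_sum]
    refine Finset.sum_congr rfl fun i _ => ?_
    have hAi := hP (d + l - i) (n + d' + i)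
    rw [show n + d' + i + (d + l - i) = n + d' + d + l by ring] at hAi
    simp only [Polynomial.eval_mul, Polynomial.eval_C, Polynomial.eval_comp, Polynomial.eval_add,
      Polynomial.eval_X, hAi]
    rw [add_assoc, hQ, mul_zpow, zpow_add₀ hc n]
    push_cast
    ring

theorem add (hA : IsPolynomial c d A) (hB : IsPolynomial c d B) : IsPolynomial c d (A + B) where
  raisesOrder _ _ hf := add_mem (hA.raisesOrder hf) (hB.raisesOrder hf)
  exists_polynomial m := by
    obtain ⟨P, hP⟩ := hA.exists_polynomial m
    obtain ⟨Q, hQ⟩ := hB.exists_polynomial m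
    refine ⟨P + Q, fun n => ?_⟩
    rw [LinearMap.add_apply, HahnSeries.coeff_add, hP, hQ, Polynomial.eval_add, mul_add]

theorem mono {d' : ℤ} (hA : IsPolynomial c d A) (h : d' ≤ d) : IsPolynomial c d' A where
  raisesOrder _ _ hf := ordGE_anti (by lia) (hA.raisesOrder hf)
  exists_polynomial := hA.exists_polynomial

theorem eq_of_infinite [CharZero k] (hc : c ≠ 0) {d' : ℤ} (hA : IsPolynomial c d A)
    (hB : IsPolynomial c d' B) (h : {n : ℤ | A (xpow k n) = B (xpow k n)}.Infinite) : A = B := by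
  refine hA.raisesOrder.adicContinuous.ext_xpow hB.raisesOrder.adicContinuous fun n => ?_
  ext j
  obtain ⟨P, hP⟩ := hA.exists_polynomial (j - n)
  obtain ⟨Q, hQ⟩ := hB.exists_polynomial (j - n)
  have hPQ : P = Q := by
    refine Polynomial.eq_of_infinite_eval_eq P Q
      ((h.image (Int.cast_injective (α := k)).injOn).mono ?_)
    rintro _ ⟨i, hi, rfl⟩
    have hPi := hP i
    rw [hi, hQ] at hPi
    exact (mul_left_cancel₀ (zpow_ne_zero i hc) hPi).symm
  have hAn := hP n
  have hBn := hQ n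
  rw [add_sub_cancel] at hAn hBn
  rw [hAn, hBn, hPQ]

end IsPolynomial

theorem isPolynomial_smulOp {d : ℤ} {f : LaurentSeries k} (hf : f ∈ ordGE k d) :
    IsPolynomial 1 d (smulOp (LaurentSeries k) f) where
  raisesOrder := raisesOrder_smulOp hf
  exists_polynomial m := ⟨Polynomial.C (f.coeff m), fun n => by
    rw [smulOp_apply, smul_eq_mul, mul_comm, coeff_xpow_mul, one_zpow, one_mul, Polynomial.eval_C,
      add_sub_cancel_left]⟩

/-- The operator sending `x ^ n` to `c ^ n ∑ m, q m (n) x ^ (n + m)`. -/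
def polynomialOperator (c : k) (q : ℕ → Polynomial k) : LaurentSeries k →ₗ[k] LaurentSeries k :=
  strongLinear (fun n => seriesFrom n fun m => c ^ n * (q m).eval (n : k))
    fun m => ⟨m, fun n hn => ordGE_anti hn (seriesFrom_mem_ordGE n _)⟩

theorem raisesOrder_polynomialOperator (c : k) (q : ℕ → Polynomial k) :
    RaisesOrder 0 (polynomialOperator c q) := fun n f hf => by
  rw [add_zero]
  exact strongLinear_mem_ordGE _ (fun j hj => ordGE_anti hj (seriesFrom_mem_ordGE j _)) hf

theorem coeff_polynomialOperator_xpow (c : k) (q : ℕ → Polynomial k) (n : ℤ) (m : ℕ) :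
    (polynomialOperator c q (xpow k n)).coeff (n + m) = c ^ n * (q m).eval (n : k) := by
  rw [polynomialOperator, strongLinear_xpow, coeff_seriesFrom]

theorem isPolynomial_polynomialOperator (c : k) (q : ℕ → Polynomial k) :
    IsPolynomial c 0 (polynomialOperator c q) where
  raisesOrder := raisesOrder_polynomialOperator c q
  exists_polynomial m := by
    by_cases hm : m < 0
    · refine ⟨0, fun n => ?_⟩
      rw [raisesOrder_polynomialOperator c q (xpow_mem_ordGE n) _ (by lia), Polynomial.eval_zero,
        mul_zero]
    · obtain ⟨m, rfl⟩ := Int.eq_ofNat_of_zero_le (not_lt.1 hm)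
      exact ⟨q m, fun n => coeff_polynomialOperator_xpow c q n m⟩

end IsPolynomial

section Conjugation

variable {k : Type*} [Field k]

theorem IsPolynomial.exists_coeff_eq {d : ℤ} {b : k}
    {B : LaurentSeries k →ₗ[k] LaurentSeries k} (hB : IsPolynomial 1 d B)
    (hlead : ∀ n, (B (xpow k n)).coeff (n + d) = b) :
    ∃ a : ℕ → Polynomial k, a 0 = Polynomial.C b ∧
      ∀ (m : ℕ) (n : ℤ), (B (xpow k n)).coeff (n + d + m) = (a m).eval (n : k) := by
  choose P hP using fun m : ℕ => hB.exists_polynomial (d + m)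
  refine ⟨fun m => if m = 0 then Polynomial.C b else P m, if_pos rfl, fun m n => ?_⟩
  by_cases hm : m = 0
  · simp only [hm, if_true, Nat.cast_zero, add_zero, hlead, Polynomial.eval_C]
  · simp only [if_neg hm, add_assoc, hP, one_zpow, one_mul]

theorem polynomialOperator_xpow_mul {d : ℤ} {c : k} (hc : c ≠ 0) {a q : ℕ → Polynomial k}
    {B : LaurentSeries k →ₗ[k] LaurentSeries k} (hB : RaisesOrder d B)
    (ha : ∀ (m : ℕ) (n : ℤ), (B (xpow k n)).coeff (n + d + m) = (a m).eval (n : k))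
    (hq : ∀ m (x : k), c ^ d * (q m).eval (x + d) =
      ∑ i ∈ Finset.range (m + 1), (q i).eval x * (a (m - i)).eval (x + i))
    (f : LaurentSeries k) :
    polynomialOperator c q (xpow k d * f) = B (polynomialOperator c q f) := by
  have hT := raisesOrder_polynomialOperator c q
  have hx := raisesOrder_smulOp (xpow_mem_ordGE (k := k) d)
  have hext : polynomialOperator c q ∘ₗ smulOp (LaurentSeries k) (xpow k d) =
      B ∘ₗ polynomialOperator c q := by
    refine (hT.comp hx).adicContinuous.ext_xpow (hB.comp hT).adicContinuous fun n => ?_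
    have hTn := hT (xpow_mem_ordGE n)
    rw [add_zero] at hTn
    refine ext_of_mem_ordGE (n := n + d) ?_ (hB hTn) fun m => ?_
    · simpa only [zero_add] using (hT.comp hx) (xpow_mem_ordGE n)
    rw [LinearMap.comp_apply, LinearMap.comp_apply, smulOp_apply, smul_eq_mul, xpow_mul_xpow,
      add_comm d, coeff_polynomialOperator_xpow, hB.coeff_apply hTn, zpow_add₀ hc, mul_assoc,
      Int.cast_add, hq, Finset.mul_sum]
    refine Finset.sum_congr rfl fun i hi => ?_
    have hai := ha (m - i) (n + i)
    rw [show n + (i : ℤ) + d + ((m - i : ℕ) : ℤ) = n + d + m by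
      rw [Finset.mem_range] at hi; lia] at hai
    rw [coeff_polynomialOperator_xpow, hai, mul_assoc, Int.cast_add, Int.cast_natCast]
  exact LinearMap.congr_fun hext f

theorem IsPolynomial.exists_conj_eq_xpow_mul [CharZero k]
    {B : LaurentSeries k →ₗ[k] LaurentSeries k} {d : ℤ} (hd : d ≠ 0) {c : k} (hc : c ≠ 0)
    (hB : IsPolynomial 1 d B) (hlead : ∀ n, (B (xpow k n)).coeff (n + d) = c ^ d) :
    ∃ T : LaurentSeries k →ₗ[k] LaurentSeries k, IsPolynomial c 0 T ∧ Function.Bijective T ∧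
      (∀ n f, T f ∈ ordGE k n ↔ f ∈ ordGE k n) ∧ ∀ f, T (xpow k d * f) = B (T f) := by
  obtain ⟨a, ha₀, ha⟩ := hB.exists_coeff_eq hlead
  have hd' : (d : k) ≠ 0 := by exact_mod_cast hd
  let q := diffSeq hd' (c ^ d) a
  have hT := isPolynomial_polynomialOperator c q
  have hdiag (n : ℤ) : (polynomialOperator c q (xpow k n)).coeff (n + 0) ≠ 0 := by
    rw [← Nat.cast_zero, coeff_polynomialOperator_xpow, show q 0 = 1 from diffSeq_zero _ _ _,
      Polynomial.eval_one, mul_one]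
    exact zpow_ne_zero _ hc
  refine ⟨polynomialOperator c q, hT, hT.raisesOrder.bijective hdiag,
    fun n f => ⟨fun hf => ?_, fun hf => ?_⟩, polynomialOperator_xpow_mul hc hB.raisesOrder ha
      (diffSeq_eval hd' (zpow_ne_zero _ hc) ha₀)⟩
  · exact hT.raisesOrder.mem_ordGE_of_apply hdiag (by rwa [add_zero])
  · simpa only [add_zero] using hT.raisesOrder hf

end Conjugation

/-! ### Rank one objects -/

section Order

variable {k : Type*} [Field k]

theorem order_eq_of_forall_mem_ordGE_iff {f : LaurentSeries k} {a : ℤ}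
    (h : ∀ n, f ∈ ordGE k n ↔ n ≤ a) : f ≠ 0 ∧ f.order = a := by
  have hf : f ≠ 0 := by
    rintro rfl
    have := (h (a + 1)).1 (zero_mem _)
    lia
  refine ⟨hf, le_antisymm ((h _).1 (mem_ordGE_order f)) ?_⟩
  by_contra hlt
  exact HahnSeries.coeff_order_eq_zero.not.2 hf ((h a).2 le_rfl _ (not_le.1 hlt))

theorem one_mem_ordGE_iff {n : ℤ} : (1 : LaurentSeries k) ∈ ordGE k n ↔ n ≤ 0 := by
  refine ⟨fun h => ?_, fun h => ordGE_anti h (xpow_mem_ordGE 0)⟩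
  by_contra hlt
  simpa using h 0 (not_le.1 hlt)

theorem order_eq_of_map_eq_xpow_mul {T : LaurentSeries k →ₗ[k] LaurentSeries k}
    (hT : ∀ n f, T f ∈ ordGE k n ↔ f ∈ ordGE k n) {g : LaurentSeries k} {d : ℤ}
    (hg : T g = xpow k d * T 1) : g ≠ 0 ∧ g.order = d := by
  refine order_eq_of_forall_mem_ordGE_iff fun n => ?_
  have h := xpow_mul_mem_ordGE (m := d) (n := n - d) (f := T 1)
  rw [add_sub_cancel] at h
  rw [← hT, hg, h, hT, one_mem_ordGE_iff, sub_nonpos]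

end Order

section Ramified

variable {k : Type u} [Field k]

/-- The filtration of `k((x ^ (1/q)))` by the order in `x ^ (1/q)`. -/
def ramFiltration (q : ℕ+) (n : ℤ) : Submodule k (RamExt k q) := ordGE k n

/-- The combination of `x ^ (j/q)`, `j < q`, with the given coefficients in `k((x))`. -/
def ramCombination (q : ℕ+) : (Fin q → LaurentSeries k) →ₗ[LaurentSeries k] RamExt k q :=
  Fintype.linearCombination (LaurentSeries k) fun j : Fin q => (xpow k (j : ℕ) : RamExt k q)

theorem ramCombination_apply (q : ℕ+) (c : Fin q → LaurentSeries k) :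
    ramCombination q c = (∑ j, ramify k q (c j) * xpow k (j : ℕ) : LaurentSeries k) := rfl

theorem coeff_ramCombination (q : ℕ+) (c : Fin q → LaurentSeries k) (n : ℤ) (j : Fin q) :
    HahnSeries.coeff (show LaurentSeries k from ramCombination q c) (((q : ℕ) : ℤ) * n + (j : ℕ)) =
      (c j).coeff n := by
  change HahnSeries.coeff (∑ j, ramify k q (c j) * xpow k (j : ℕ)) _ = _
  rw [HahnSeries.coeff_sum, Finset.sum_eq_single j]
  · rw [mul_comm, coeff_xpow_mul, add_sub_cancel_right, ramify_coeff_mul]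
  · intro i _ hij
    rw [mul_comm, coeff_xpow_mul]
    refine ramify_coeff_of_not_dvd q _ _ fun hdvd => hij ?_
    rw [add_sub_assoc, dvd_add_right (dvd_mul_right _ _)] at hdvd
    have hi := i.2
    have hj := j.2
    have := Int.eq_zero_of_abs_lt_dvd hdvd (by rw [abs_lt]; omega)
    exact Fin.ext (by omega)
  · simp only [Finset.mem_univ, not_true_eq_false, IsEmpty.forall_iff]

theorem bijective_ramCombination (q : ℕ+) : Function.Bijective (ramCombination (k := k) q) := by
  constructor
  · intro c c' h
    funext j
    ext n
    rw [← coeff_ramCombination q c, ← coeff_ramCombination q c', h]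
  · intro v
    refine ⟨fun j => part q v j, ?_⟩
    rw [ramCombination_apply]
    conv_rhs => rw [eq_sum_part q v]
    exact Fin.sum_univ_eq_sum_range
      (fun j => ramify k q (part q v j) * HahnSeries.single (j : ℤ) (1 : k)) q

/-- The basis `x ^ (j/q)`, `j < q`, of `k((x ^ (1/q)))` over `k((x))`. -/
def ramBasis (k : Type u) [Field k] (q : ℕ+) :
    Module.Basis (Fin q) (LaurentSeries k) (RamExt k q) :=
  Module.Basis.ofEquivFun (LinearEquiv.ofBijective _ (bijective_ramCombination q)).symm

theorem ramBasis_repr_ramCombination (q : ℕ+) (c : Fin q → LaurentSeries k) (j : Fin q) :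
    (ramBasis k q).repr (ramCombination q c) j = c j := by
  rw [ramBasis, Module.Basis.ofEquivFun_repr_apply]
  exact congrFun ((LinearEquiv.ofBijective _ (bijective_ramCombination q)).symm_apply_apply c) j

theorem mem_basisFiltration_ramBasis {q : ℕ+} {n : ℤ} {v : RamExt k q} :
    v ∈ basisFiltration (ramBasis k q) n ↔ v ∈ ramFiltration q (((q : ℕ) : ℤ) * n) := by
  obtain ⟨c, rfl⟩ := (bijective_ramCombination q).2 v
  simp only [mem_basisFiltration, ramBasis_repr_ramCombination]
  constructor
  · intro h m hm
    obtain ⟨⟨a, j⟩, rfl⟩ := (Int.divModEquiv q).symm.surjective m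
    rw [Int.divModEquiv_symm_apply, mul_comm] at hm ⊢
    refine (coeff_ramCombination q c a j).trans (h j a ?_)
    have : ((q : ℕ) : ℤ) * a < ((q : ℕ) : ℤ) * n := by lia
    exact lt_of_mul_lt_mul_left this (by positivity)
  · intro h j a ha
    rw [← coeff_ramCombination q c]
    refine h _ ?_
    have := mul_le_mul_of_nonneg_left (Int.add_one_le_iff.2 ha) (Int.natCast_nonneg (q : ℕ))
    rw [mul_add, mul_one] at this
    have hj := j.2
    lia

theorem cofinal_ramFiltration (q : ℕ+) :
    Cofinal (ramFiltration (k := k) q) (adicFiltration k (RamExt k q)) := by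
  have hq : (1 : ℤ) ≤ ((q : ℕ) : ℤ) := by exact_mod_cast q.pos
  obtain ⟨h₁, h₂⟩ := cofinal_basisFiltration_adicFiltration (ramBasis k q)
  constructor
  · intro m
    obtain ⟨n, hn⟩ := h₁ m
    exact ⟨_, fun v hv => hn (mem_basisFiltration_ramBasis.2 hv)⟩
  · intro m
    obtain ⟨n, hn⟩ := h₂ |m|
    refine ⟨n, fun v hv => ordGE_anti ?_ (mem_basisFiltration_ramBasis.1 (hn hv))⟩
    exact (le_abs_self m).trans (le_mul_of_one_le_left (abs_nonneg m) hq)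

theorem adicContinuous_of_map_ramFiltration_le {q p : ℕ+} {A : RamExt k q →ₗ[k] RamExt k p}
    (h : ∀ n, ∀ v ∈ ramFiltration q n, A v ∈ ramFiltration p n) : AdicContinuous A :=
  (adicContinuous_iff (cofinal_ramFiltration q) (cofinal_ramFiltration p)).2 fun m => ⟨m, h m⟩

theorem ramify_xpow (q : ℕ+) (n : ℤ) : ramify k q (xpow k n) = xpow k (((q : ℕ) : ℤ) * n) := by
  ext m
  by_cases h : ((q : ℕ) : ℤ) ∣ m
  · obtain ⟨a, rfl⟩ := h
    rw [ramify_coeff_mul, xpow, xpow, HahnSeries.coeff_single, HahnSeries.coeff_single]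
    simp
  · rw [ramify_coeff_of_not_dvd q _ _ h, xpow, HahnSeries.coeff_single_of_ne]
    rintro rfl
    exact h (dvd_mul_right _ _)

theorem xpow_smul_ramExt (q : ℕ+) (n : ℤ) (v : LaurentSeries k) :
    (xpow k n • (show RamExt k q from v) : RamExt k q) =
      (xpow k (((q : ℕ) : ℤ) * n) * v : LaurentSeries k) := by
  rw [RamExt.smul_def, ramify_xpow]

end Ramified

section ShiftRam

variable {k : Type u} [Field k] [CharZero k]

/-- The series `(1 + t ^ q) ^ r` in `t = x ^ (1/q)`. -/
def binomialRam (k : Type u) [Field k] [CharZero k] (q : ℕ+) (r : ℚ) : LaurentSeries k :=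
  HahnSeries.ofPowerSeries ℤ k ((PowerSeries.binomialSeries k r).subst
    (PowerSeries.X ^ (q : ℕ) : PowerSeries k))

theorem binomialRam_add (q : ℕ+) (r s : ℚ) :
    binomialRam k q (r + s) = binomialRam k q r * binomialRam k q s := by
  rw [binomialRam, PowerSeries.binomialSeries_add,
    PowerSeries.subst_mul (PowerSeries.HasSubst.X_pow q.ne_zero), map_mul]
  rfl

theorem binomialRam_zero (q : ℕ+) : binomialRam k q 0 = 1 := by
  rw [binomialRam, PowerSeries.binomialSeries_zero, ← map_one PowerSeries.C, PowerSeries.subst_C]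
  simp

theorem phiRam_xpow_one (q : ℕ+) :
    phiRam k q (xpow k 1) = xpow k 1 * binomialRam k q (-(1 / (q : ℕ))) := by
  have hX : xpow k 1 = HahnSeries.ofPowerSeries ℤ k PowerSeries.X :=
    HahnSeries.ofPowerSeries_X.symm
  rw [hX, phiRam, substHom_coe, PowerSeries.subst_X
    (PowerSeries.HasSubst.of_constantCoeff_zero' (shiftSeriesRam_constantCoeff q)),
    shiftSeriesRam, map_mul]
  rfl

theorem phiRam_xpow_natCast (q : ℕ+) (n : ℕ) :
    phiRam k q (xpow k n) = xpow k n * binomialRam k q (-(n / (q : ℕ))) := by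
  induction n with
  | zero => simp [binomialRam_zero]
  | succ n ih =>
    have hn : -(((n + 1 : ℕ) : ℚ) / (q : ℕ)) = -(n / (q : ℕ)) + -(1 / (q : ℕ)) := by
      push_cast
      ring
    rw [hn, binomialRam_add, Nat.cast_succ, ← xpow_mul_xpow, map_mul, ih, phiRam_xpow_one]
    ring

theorem phiRam_xpow (q : ℕ+) (n : ℤ) :
    phiRam k q (xpow k n) = xpow k n * binomialRam k q (-(n / (q : ℕ))) := by
  obtain ⟨m, rfl | rfl⟩ := n.eq_nat_or_neg
  · exact phiRam_xpow_natCast q m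
  · have hinv : phiRam k q (xpow k (-m)) * phiRam k q (xpow k m) = 1 := by
      rw [← map_mul, xpow_mul_xpow, neg_add_cancel, xpow_zero, map_one]
    have hexp : -(((-(m : ℤ) : ℤ) : ℚ) / (q : ℕ)) + -((m : ℚ) / (q : ℕ)) = 0 := by
      push_cast
      ring
    refine mul_right_cancel₀ (b := phiRam k q (xpow k m))
      (right_ne_zero_of_mul (hinv.symm ▸ one_ne_zero)) ?_
    rw [hinv, phiRam_xpow_natCast, mul_mul_mul_comm, xpow_mul_xpow, ← binomialRam_add,
      neg_add_cancel, xpow_zero, hexp, binomialRam_zero, one_mul]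

theorem exists_polynomial_eval_eq_choose (r : ℚ) (j : ℕ) :
    ∃ P : Polynomial ℚ, ∀ n : ℤ, Ring.choose (r * n) j = P.eval (n : ℚ) := by
  refine ⟨Polynomial.C (j.factorial : ℚ)⁻¹ * ((descPochhammer ℤ j).map (Int.castRingHom ℚ)).comp
    (Polynomial.C r * Polynomial.X), fun n => ?_⟩
  have hfact := Ring.descPochhammer_eq_factorial_smul_choose (r * n) j
  rw [nsmul_eq_mul, ← Polynomial.aeval_eq_smeval, Polynomial.aeval_def] at hfact
  rw [Polynomial.eval_mul, Polynomial.eval_C, Polynomial.eval_comp, Polynomial.eval_map,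
    eq_inv_mul_iff_mul_eq₀ (by exact_mod_cast j.factorial_ne_zero), ← hfact]
  simp

/-- The substitution `t ↦ t (1 + t ^ q) ^ (-1/q)`, the extension of `φ` to `k((x ^ (1/q)))`, as a
`k`-linear map. -/
def phiRamLin (k : Type u) [Field k] [CharZero k] (q : ℕ+) :
    LaurentSeries k →ₗ[k] LaurentSeries k :=
  substLin (shiftSeriesRam k q) (shiftSeriesRam_constantCoeff q) (shiftSeriesRam_ne_zero q)

theorem phiRamLin_apply (q : ℕ+) (f : LaurentSeries k) : phiRamLin k q f = phiRam k q f := rfl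

theorem isPolynomial_phiRamLin (q : ℕ+) : IsPolynomial 1 0 (phiRamLin k q) where
  raisesOrder n f hf := by
    obtain ⟨p, rfl⟩ := mem_ordGE_iff_exists.1 hf
    rw [phiRamLin_apply, map_mul, phiRam_xpow, add_zero, phiRam, substHom_coe, mul_assoc,
      binomialRam, ← map_mul]
    exact mem_ordGE_iff_exists.2 ⟨_, rfl⟩
  exists_polynomial m := by
    simp only [phiRamLin_apply, phiRam_xpow, coeff_xpow_mul, add_sub_cancel_left, one_zpow, one_mul,
      binomialRam, PowerSeries.coeff_coe, PowerSeries.coeff_subst_X_pow q.ne_zero]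
    split_ifs with hneg hdvd
    · exact ⟨0, fun n => Polynomial.eval_zero.symm⟩
    · obtain ⟨P, hP⟩ := exists_polynomial_eval_eq_choose (-(1 / (q : ℕ))) (m.natAbs / q)
      refine ⟨P.map (algebraMap ℚ k), fun n => ?_⟩
      have hr : -((n : ℚ) / (q : ℕ)) = -(1 / (q : ℕ)) * n := by ring
      rw [Polynomial.eval_intCast_map, ← hP, Algebra.algebraMap_self_apply,
        PowerSeries.binomialSeries_coeff, Rat.smul_one_eq_cast, hr, eq_ratCast]
    · exact ⟨0, fun n => Polynomial.eval_zero.symm⟩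

theorem coeff_phiRamLin_xpow_self (q : ℕ+) (n : ℤ) : (phiRamLin k q (xpow k n)).coeff n = 1 := by
  rw [phiRamLin_apply, phiRam_xpow, coeff_xpow_mul, sub_self, binomialRam, PowerSeries.coeff_coe]
  simp [PowerSeries.coeff_subst_X_pow q.ne_zero]

theorem phiRam_xpow_neg (q : ℕ+) :
    phiRam k q (xpow k (-((q : ℕ) : ℤ))) = xpow k (-((q : ℕ) : ℤ)) + 1 := by
  have h := phiRam_ramify (k := k) q (xpow k (-1))
  rwa [phi_xpow_neg_one, map_add, map_one, ramify_xpow, mul_neg_one] at h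

end ShiftRam

section RankOneOperators

variable {k : Type u} [Field k]

/-- The derivation `x d/dx` of `k((x ^ (1/q)))`. -/
def eulerRam (k : Type u) [Field k] (q : ℕ+) : LaurentSeries k →ₗ[k] LaurentSeries k :=
  ((q : ℕ) : k)⁻¹ • (smulOp (LaurentSeries k) (xpow k 1) ∘ₗ LaurentSeries.derivative k)

theorem coeff_eulerRam (q : ℕ+) (f : LaurentSeries k) (n : ℤ) :
    (eulerRam k q f).coeff n = ((q : ℕ) : k)⁻¹ * (n * f.coeff n) := by
  rw [eulerRam, LinearMap.smul_apply, HahnSeries.coeff_smul, LinearMap.comp_apply, smulOp_apply,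
    smul_eq_mul, smul_eq_mul, single_one_mul_derivative_coeff]

theorem isPolynomial_eulerRam (q : ℕ+) : IsPolynomial 1 0 (eulerRam k q) where
  raisesOrder n f hf m hm := by
    rw [coeff_eulerRam, hf m (by lia), mul_zero, mul_zero]
  exists_polynomial m := by
    by_cases hm : m = 0
    · exact ⟨Polynomial.C ((q : ℕ) : k)⁻¹ * Polynomial.X, fun n => by simp [coeff_eulerRam, hm]⟩
    · refine ⟨0, fun n => ?_⟩
      rw [coeff_eulerRam, xpow, HahnSeries.coeff_single_of_ne (by lia), mul_zero, mul_zero,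
        Polynomial.eval_zero, mul_zero]

/-- The operator `ζ ∇_ζ` of the connection `E_f`. -/
def connectionOp (q : ℕ+) (f : LaurentSeries k) : LaurentSeries k →ₗ[k] LaurentSeries k :=
  smulOp (LaurentSeries k) f + eulerRam k q

theorem connectionOp_apply (q : ℕ+) (f v : LaurentSeries k) :
    connectionOp q f v = f * v + eulerRam k q v := rfl

theorem connectionOp_one (q : ℕ+) (f : LaurentSeries k) : connectionOp q f 1 = f := by
  have heuler : eulerRam k q 1 = 0 := by
    ext n
    rw [coeff_eulerRam, HahnSeries.coeff_one]
    split_ifs with hn <;> simp [hn]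
  rw [connectionOp_apply, heuler, mul_one, add_zero]

theorem isPolynomial_connectionOp {d : ℤ} (hd : d ≤ 0) (q : ℕ+) {f : LaurentSeries k}
    (hf : f ∈ ordGE k d) : IsPolynomial 1 d (connectionOp q f) :=
  (isPolynomial_smulOp hf).add ((isPolynomial_eulerRam q).mono hd)

theorem coeff_connectionOp_xpow {d : ℤ} (hd : d ≠ 0) (q : ℕ+) (f : LaurentSeries k) (n : ℤ) :
    (connectionOp q f (xpow k n)).coeff (n + d) = f.coeff d := by
  rw [connectionOp_apply, HahnSeries.coeff_add, mul_comm, coeff_xpow_mul, coeff_eulerRam, xpow,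
    HahnSeries.coeff_single_of_ne (by lia), mul_zero, mul_zero, add_zero, add_sub_cancel_left]

variable [CharZero k]

theorem xpow_neg_mul_connectionOp (q : ℕ+) (f v : LaurentSeries k) :
    xpow k (-((q : ℕ) : ℤ)) * connectionOp q f v =
      connectionOp q f (xpow k (-((q : ℕ) : ℤ)) * v) + xpow k (-((q : ℕ) : ℤ)) * v := by
  have hq : ((q : ℕ) : k) ≠ 0 := by exact_mod_cast q.ne_zero
  have heuler : xpow k (-((q : ℕ) : ℤ)) * eulerRam k q v =
      eulerRam k q (xpow k (-((q : ℕ) : ℤ)) * v) + xpow k (-((q : ℕ) : ℤ)) * v := by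
    ext m
    rw [HahnSeries.coeff_add, coeff_eulerRam, coeff_xpow_mul, coeff_xpow_mul, coeff_eulerRam]
    push_cast
    field_simp
    ring
  rw [connectionOp_apply, connectionOp_apply, mul_add, heuler]
  ring

theorem phiD_one (q : ℕ+) (g : LaurentSeries k) : DifferenceModule.phiD q g 1 = g := by
  change g * phiRam k q 1 = g
  rw [map_one, mul_one]

theorem phiD_xpow_neg_mul (q : ℕ+) (g v : LaurentSeries k) :
    DifferenceModule.phiD q g (xpow k (-((q : ℕ) : ℤ)) * v) =
      xpow k (-((q : ℕ) : ℤ)) * DifferenceModule.phiD q g v + DifferenceModule.phiD q g v := by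
  change g * phiRam k q _ = _ * (g * phiRam k q v) + g * phiRam k q v
  rw [map_mul, phiRam_xpow_neg]
  ring

theorem isPolynomial_phiD {d : ℤ} (q : ℕ+) {g : LaurentSeries k} (hg : g ∈ ordGE k d) :
    IsPolynomial 1 d (DifferenceModule.phiD q g) := by
  have h := (isPolynomial_smulOp hg).comp one_ne_zero (isPolynomial_phiRamLin q)
  rwa [mul_one, add_zero] at h

theorem coeff_phiD_xpow {d : ℤ} (q : ℕ+) {g : LaurentSeries k} (hg : g ∈ ordGE k d) (n : ℤ) :
    (DifferenceModule.phiD q g (xpow k n)).coeff (n + d) = g.coeff d := by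
  have hmem := (isPolynomial_phiRamLin (k := k) q).raisesOrder (xpow_mem_ordGE n)
  rw [add_zero] at hmem
  have hcoeff := (raisesOrder_smulOp hg).coeff_apply hmem 0
  simp only [zero_add, Finset.sum_range_one, Nat.cast_zero, add_zero, coeff_phiRamLin_xpow_self,
    one_mul, smulOp_apply, smul_eq_mul] at hcoeff
  change (g * phiRamLin k q (xpow k n)).coeff (n + d) = _
  rw [hcoeff, mul_comm, coeff_xpow_mul, add_sub_cancel_left]

end RankOneOperators

section RankOneTransform

variable {k : Type u} [Field k]

theorem xpow_mul_nablaE (q : ℕ+) (f v : LaurentSeries k) :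
    xpow k ((q : ℕ) : ℤ) * FormalConnection.nablaE q f v = connectionOp q f v := by
  rw [FormalConnection.nablaE, LinearMap.add_apply, mulOp_apply, FormalConnection.derivRam_apply,
    ramify_xpow, mul_add, ← mul_assoc, ← mul_assoc, ← mul_assoc, xpow_mul_xpow,
    HahnSeries.single_mul_single, add_comm, connectionOp_apply]
  congr 1
  · rw [show ((q : ℕ) : ℤ) + ((q : ℕ) : ℤ) * -1 = 0 by ring, xpow_zero, one_mul]
  · rw [eulerRam, LinearMap.smul_apply, LinearMap.comp_apply, smulOp_apply, smul_eq_mul,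
      ← HahnSeries.C_mul_eq_smul, ← mul_assoc, HahnSeries.C_apply, HahnSeries.single_mul_single]
    congr 2 <;> simp

variable [CharZero k]

theorem euler_E (q : ℕ+) (f v : LaurentSeries k) :
    (FormalConnection.E q f).euler v = connectionOp q f v := by
  have h := xpow_smul_ramExt (k := k) q 1 (FormalConnection.nablaE q f v)
  rw [mul_one] at h
  exact h.trans (xpow_mul_nablaE q f v)

theorem isMellinTransform_E_D {q p : ℕ+} {f g : LaurentSeries k} (hg : g ≠ 0)
    {S : LaurentSeries k ≃ₗ[k] LaurentSeries k} (hS : ∀ n v, S v ∈ ordGE k n ↔ v ∈ ordGE k n)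
    (htheta : ∀ v, S (connectionOp q f v) = xpow k (-((p : ℕ) : ℤ)) * S v)
    (hPhi : ∀ v, DifferenceModule.phiD p g (S v) = S (xpow k (-((q : ℕ) : ℤ)) * v)) :
    IsMellinTransform (FormalConnection.E q f) (DifferenceModule.D p g hg)
      (show RamExt k q ≃ₗ[k] RamExt k p from S) := by
  have hx (r : ℕ+) (w : LaurentSeries k) : xpow k (-1) • (show RamExt k r from w) =
      (xpow k (-((r : ℕ) : ℤ)) * w : LaurentSeries k) := by
    rw [xpow_smul_ramExt, mul_neg_one]
  let S' : RamExt k q ≃ₗ[k] RamExt k p := S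
  have hcont : AdicContinuous S'.toLinearMap :=
    adicContinuous_of_map_ramFiltration_le fun n v hv => (hS n v).2 hv
  have hcont_symm : AdicContinuous S'.symm.toLinearMap :=
    adicContinuous_of_map_ramFiltration_le fun n v hv =>
      (hS n _).1 ((S.apply_symm_apply v).symm ▸ hv)
  refine isMellinTransform_iff.2
    ⟨⟨fun v => ?_, hcont, hcont_symm⟩, ⟨fun v => ?_, hcont_symm, hcont⟩⟩
  · exact (congrArg S (euler_E q f v)).trans ((htheta v).trans (hx p (S v)).symm)
  · refine S.injective ((S.apply_symm_apply _).trans ?_)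
    refine Eq.trans ?_ ((hPhi (S.symm v)).trans (congrArg S (hx q (S.symm v)).symm))
    exact congrArg (DifferenceModule.phiD p g) (S.apply_symm_apply v).symm

end RankOneTransform

section Conjugation

theorem exists_eq_zpow_neg {K : Type*} [Field K] [IsAlgClosed K] {b : K} (hb : b ≠ 0) (p : ℕ+) :
    ∃ c : K, c ≠ 0 ∧ b = c ^ (-((p : ℕ) : ℤ)) := by
  obtain ⟨c, hc⟩ := IsAlgClosed.exists_pow_nat_eq b⁻¹ p.pos
  refine ⟨c, ?_, by rw [zpow_neg, zpow_natCast, hc, inv_inv]⟩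
  rintro rfl
  rw [zero_pow p.ne_zero] at hc
  exact inv_ne_zero hb hc.symm

variable {k : Type u} [Field k] [CharZero k]

theorem IsPolynomial.eq_of_xpow_mul {c : k} (hc : c ≠ 0) {d d' p : ℤ} (hp : p ≠ 0)
    {A B : LaurentSeries k →ₗ[k] LaurentSeries k} (hA : IsPolynomial c d A)
    (hB : IsPolynomial c d' B) (hone : A 1 = B 1)
    (hstep : ∀ v, A v = B v → A (xpow k p * v) = B (xpow k p * v)) : A = B := by
  have hmul (j : ℕ) : A (xpow k (p * j)) = B (xpow k (p * j)) := by
    induction j with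
    | zero => rwa [Nat.cast_zero, mul_zero, xpow_zero]
    | succ j ih =>
      rw [Nat.cast_succ, mul_add, mul_one, add_comm, ← xpow_mul_xpow]
      exact hstep _ ih
  have hinj : Function.Injective fun j : ℕ => p * (j : ℤ) :=
    (mul_right_injective₀ hp).comp Nat.cast_injective
  exact hA.eq_of_infinite hc hB
    ((Set.infinite_range_of_injective hinj).mono (Set.range_subset_iff.2 hmul))

variable [IsAlgClosed k]

theorem IsPolynomial.exists_conj_eq_xpow_neg_mul (p q : ℕ+)
    {B : LaurentSeries k →ₗ[k] LaurentSeries k} (hB : IsPolynomial 1 (-((p : ℕ) : ℤ)) B) {b : k}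
    (hb : b ≠ 0) (hlead : ∀ n, (B (xpow k n)).coeff (n + -((p : ℕ) : ℤ)) = b) :
    ∃ c : k, c ≠ 0 ∧ ∃ T : LaurentSeries k ≃ₗ[k] LaurentSeries k,
      IsPolynomial c 0 T.toLinearMap ∧ (∀ n f, T f ∈ ordGE k n ↔ f ∈ ordGE k n) ∧
      (∀ f, T (xpow k (-((p : ℕ) : ℤ)) * f) = B (T f)) ∧
      ∃ g ≠ 0, g.order = -((q : ℕ) : ℤ) ∧ T g = xpow k (-((q : ℕ) : ℤ)) * T 1 := by
  obtain ⟨c, hc, rfl⟩ := exists_eq_zpow_neg hb p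
  have hp : -((p : ℕ) : ℤ) ≠ 0 := neg_ne_zero.2 (by exact_mod_cast p.ne_zero)
  obtain ⟨T, hT, hTbij, hTord, hTB⟩ := hB.exists_conj_eq_xpow_mul hp hc hlead
  obtain ⟨g, hg⟩ := hTbij.2 (xpow k (-((q : ℕ) : ℤ)) * T 1)
  obtain ⟨hg₀, hgord⟩ := order_eq_of_map_eq_xpow_mul hTord hg
  exact ⟨c, hc, LinearEquiv.ofBijective T hTbij, hT, hTord, hTB, g, hg₀, hgord, hg⟩

theorem exists_isMellinTransform_E (q p : ℕ+) (f : LaurentSeries k)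
    (hf : f.order = -((p : ℕ) : ℤ)) :
    ∃ (g : LaurentSeries k) (hg : g ≠ 0)
      (e : (FormalConnection.E q f).carrier ≃ₗ[k] (DifferenceModule.D p g hg).carrier),
      g.order = -((q : ℕ) : ℤ) ∧
      IsMellinTransform (FormalConnection.E q f) (DifferenceModule.D p g hg) e := by
  have hp : -((p : ℕ) : ℤ) ≠ 0 := neg_ne_zero.2 (by exact_mod_cast p.ne_zero)
  have hf₀ : f ≠ 0 := by
    rintro rfl
    exact hp (hf.symm.trans HahnSeries.order_zero)
  obtain ⟨c, hc, T, hT, hTord, hTB, g, hg₀, hgord, hg⟩ :=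
    (isPolynomial_connectionOp (by lia) q (hf ▸ mem_ordGE_order f)).exists_conj_eq_xpow_neg_mul p q
      (hf ▸ HahnSeries.coeff_order_eq_zero.not.2 hf₀) (coeff_connectionOp_xpow hp q f)
  have hPhi : smulOp (LaurentSeries k) (xpow k (-((q : ℕ) : ℤ))) ∘ₗ T.toLinearMap =
      T.toLinearMap ∘ₗ DifferenceModule.phiD p g := by
    have hleft := (isPolynomial_smulOp (xpow_mem_ordGE (-((q : ℕ) : ℤ)))).comp one_ne_zero hT
    have hright := hT.comp hc (isPolynomial_phiD p (mem_ordGE_order g))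
    rw [one_mul] at hleft
    rw [mul_one] at hright
    refine hleft.eq_of_xpow_mul hc hp hright ?_ fun v hv => ?_
    · exact hg.symm.trans (congrArg T (phiD_one p g).symm)
    · change xpow k _ * T v = T (DifferenceModule.phiD p g v) at hv
      change xpow k _ * T _ = T (DifferenceModule.phiD p g _)
      rw [hTB, xpow_neg_mul_connectionOp, hv, ← hTB, ← map_add, phiD_xpow_neg_mul]
  refine ⟨g, hg₀, _, hgord, isMellinTransform_E_D hg₀ (S := T.symm)
    (fun n v => ?_) (fun v => ?_) fun v => ?_⟩
  · rw [← hTord, T.apply_symm_apply]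
  · rw [T.symm_apply_eq, hTB, T.apply_symm_apply]
  · rw [T.eq_symm_apply]
    refine (LinearMap.congr_fun hPhi (T.symm v)).symm.trans ?_
    exact congrArg (xpow k _ * ·) (T.apply_symm_apply v)

theorem exists_isMellinTransform_D (q p : ℕ+) (g : LaurentSeries k) (hg : g ≠ 0)
    (hgp : g.order = -((p : ℕ) : ℤ)) :
    ∃ (f : LaurentSeries k)
      (e : (FormalConnection.E p f).carrier ≃ₗ[k] (DifferenceModule.D q g hg).carrier),
      f.order = -((q : ℕ) : ℤ) ∧
      IsMellinTransform (FormalConnection.E p f) (DifferenceModule.D q g hg) e := by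
  have hp : -((p : ℕ) : ℤ) ≠ 0 := neg_ne_zero.2 (by exact_mod_cast p.ne_zero)
  have hmem : g ∈ ordGE k (-((p : ℕ) : ℤ)) := hgp ▸ mem_ordGE_order g
  obtain ⟨c, hc, T, hT, hTord, hTB, f, -, hford, hf⟩ :=
    (isPolynomial_phiD q hmem).exists_conj_eq_xpow_neg_mul p q
      (hgp ▸ HahnSeries.coeff_order_eq_zero.not.2 hg) (coeff_phiD_xpow q hmem)
  have htheta : smulOp (LaurentSeries k) (xpow k (-((q : ℕ) : ℤ))) ∘ₗ T.toLinearMap =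
      T.toLinearMap ∘ₗ connectionOp p f := by
    have hleft := (isPolynomial_smulOp (xpow_mem_ordGE (-((q : ℕ) : ℤ)))).comp one_ne_zero hT
    have hright := hT.comp hc
      (isPolynomial_connectionOp (d := -((q : ℕ) : ℤ)) (by lia) p (hford ▸ mem_ordGE_order f))
    rw [one_mul] at hleft
    rw [mul_one] at hright
    refine hleft.eq_of_xpow_mul hc hp hright ?_ fun v hv => ?_
    · exact hf.symm.trans (congrArg T (connectionOp_one p f).symm)
    · change xpow k _ * T v = T (connectionOp p f v) at hv
      change xpow k _ * T _ = T (connectionOp p f _)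
      rw [← add_left_inj (T (xpow k (-((p : ℕ) : ℤ)) * v)), ← map_add,
        ← xpow_neg_mul_connectionOp, hTB, hTB, ← hv, phiD_xpow_neg_mul]
  exact ⟨f, _, hford, isMellinTransform_E_D hg (S := T) hTord
    (fun v => (LinearMap.congr_fun htheta v).symm) fun v => (hTB v).symm⟩

end Conjugation

/-! ### Subobjects, quotients and irreducibility -/

section Stable

theorem eq_map_of_le_map {α : Type*} [PartialOrder α] [WellFoundedGT α] {f : α → α}
    (hf : StrictMono f) {a : α} (ha : a ≤ f a) : a = f a := by
  by_contra hne
  exact not_strictMono_of_wellFoundedGT _ (hf.strictMono_iterate_of_lt_map (ha.lt_of_ne hne))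

theorem eq_comap_of_le_comap {K V : Type*} [Semiring K] [AddCommMonoid V] [Module K V]
    [IsNoetherian K V] {σ : K →+* K} {f : V →ₛₗ[σ] V} (hf : Function.Surjective f)
    {W : Submodule K V} (hW : W ≤ W.comap f) : W = W.comap f := by
  have hinj : Function.Injective (Submodule.comap f) := fun U U' h =>
    SetLike.coe_injective (hf.preimage_injective (congrArg SetLike.coe h))
  have hmono : Monotone (Submodule.comap f) := fun _ _ => Submodule.comap_mono
  exact eq_map_of_le_map (hmono.strictMono_of_injective hinj) hW

variable {k K : Type*} [Semiring k] [Ring K]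
variable {V : Type*} [AddCommGroup V] [Module k V] [Module K V] {N : V →ₗ[k] V}
variable {V' : Type*} [AddCommGroup V'] [Module k V'] [Module K V'] {N' : V' →ₗ[k] V'}
variable {V'' : Type*} [AddCommGroup V''] [Module k V''] [Module K V''] {N'' : V'' →ₗ[k] V''}

theorem apply_mem_ker {f : V →ₗ[K] V'} (hf : ∀ v, f (N v) = N' (f v)) :
    ∀ v ∈ LinearMap.ker f, N v ∈ LinearMap.ker f := fun v hv => by
  rw [LinearMap.mem_ker] at hv ⊢
  rw [hf, hv, map_zero]

theorem apply_mem_map {f : V →ₗ[K] V'} (hf : ∀ v, f (N v) = N' (f v)) {W : Submodule K V}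
    (hW : ∀ v ∈ W, N v ∈ W) : ∀ v ∈ W.map f, N' v ∈ W.map f := by
  rintro _ ⟨v, hv, rfl⟩
  exact ⟨N v, hW v hv, hf v⟩

/-- The operator `N` on the nonzero `K`-module `V` stabilizes no `K`-submodule except `0` and `V`.
Irreducibility of connections and of difference modules are the instances `N = ∇` and `N = Φ`. -/
def IsSimpleUnder (K : Type*) [Ring K] [Module K V] (N : V →ₗ[k] V) : Prop :=
  Nontrivial V ∧ ∀ W : Submodule K V, (∀ w ∈ W, N w ∈ W) → W = ⊥ ∨ W = ⊤

namespace IsSimpleUnder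

theorem bijective (hN : IsSimpleUnder K N) [Nontrivial V'] {f : V →ₗ[K] V'}
    (hf : ∀ v, f (N v) = N' (f v)) (hsurj : Function.Surjective f) : Function.Bijective f := by
  refine ⟨LinearMap.ker_eq_bot.1 ((hN.2 _ (apply_mem_ker hf)).resolve_right fun h => ?_), hsurj⟩
  obtain ⟨w, hw⟩ := exists_ne (0 : V')
  obtain ⟨v, rfl⟩ := hsurj w
  exact hw (LinearMap.mem_ker.1 (h ▸ Submodule.mem_top))

theorem surjective (hN' : IsSimpleUnder K N') {f : V →ₗ[K] V'} (hf : ∀ v, f (N v) = N' (f v))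
    (hne : LinearMap.ker f ≠ ⊤) : Function.Surjective f := by
  rw [← LinearMap.range_eq_top, ← Submodule.map_top]
  refine (hN'.2 _ (apply_mem_map hf fun _ _ => Submodule.mem_top)).resolve_left fun h => hne ?_
  rwa [Submodule.map_top, LinearMap.range_eq_bot, ← LinearMap.ker_eq_top] at h

theorem exists_bijective_of_ker_le (hN' : IsSimpleUnder K N') [Nontrivial V''] {f : V →ₗ[K] V'}
    (hf : ∀ v, f (N v) = N' (f v)) {g : V →ₗ[K] V''} (hg : ∀ v, g (N v) = N'' (g v))
    (hsurj : Function.Surjective g) (hker : LinearMap.ker f ≤ LinearMap.ker g) :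
    ∃ u : V' →ₗ[K] V'', (∀ v, u (N' v) = N'' (u v)) ∧ Function.Bijective u := by
  have hg_ker : LinearMap.ker g ≠ ⊤ := fun h => by
    obtain ⟨w, hw⟩ := exists_ne (0 : V'')
    obtain ⟨v, rfl⟩ := hsurj w
    exact hw (LinearMap.mem_ker.1 (h ▸ Submodule.mem_top))
  have hf_surj := hN'.surjective hf fun h => hg_ker (top_le_iff.1 (h ▸ hker))
  let u : V' →ₗ[K] V'' := (LinearMap.ker f).liftQ g hker ∘ₗ
    (f.quotKerEquivOfSurjective hf_surj).symm.toLinearMap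
  have hu (v : V) : u (f v) = g v := by
    have : (f.quotKerEquivOfSurjective hf_surj).symm (f v) = Submodule.Quotient.mk v :=
      (LinearEquiv.symm_apply_eq _).2 rfl
    simp only [u, LinearMap.comp_apply, LinearEquiv.coe_coe, this, Submodule.liftQ_apply]
  have hu_comm (v : V') : u (N' v) = N'' (u v) := by
    obtain ⟨v, rfl⟩ := hf_surj v
    rw [← hf, hu, hu, hg]
  refine ⟨u, hu_comm, hN'.bijective hu_comm fun w => ?_⟩
  obtain ⟨v, rfl⟩ := hsurj w
  exact ⟨f v, hu v⟩

end IsSimpleUnder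

theorem isSimpleUnder_of_maximal_ker {f : V →ₗ[K] V'} (hf : ∀ v, f (N v) = N' (f v))
    (hsurj : Function.Surjective f) (hne : LinearMap.ker f ≠ ⊤)
    (hmax : ∀ U : Submodule K V, (∀ v ∈ U, N v ∈ U) → U ≠ ⊤ → ¬LinearMap.ker f < U) :
    IsSimpleUnder K N' := by
  refine ⟨?_, fun W hW => ?_⟩
  · by_contra h
    rw [not_nontrivial_iff_subsingleton] at h
    exact hne (LinearMap.ker_eq_top.2 (Subsingleton.elim _ _))
  have hinj := Submodule.comap_injective_of_surjective hsurj
  have hstable : ∀ v ∈ W.comap f, N v ∈ W.comap f := fun v hv => by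
    rw [Submodule.mem_comap, hf]
    exact hW _ hv
  by_cases htop : W.comap f = ⊤
  · exact .inr (hinj htop)
  · exact .inl (hinj (eq_of_le_of_not_lt (Submodule.comap_mono bot_le)
      (hmax _ hstable htop)).symm)

theorem exists_maximal_stable (N : V →ₗ[k] V) [IsNoetherian K V] [Nontrivial V] :
    ∃ W : Submodule K V, (∀ v ∈ W, N v ∈ W) ∧ W ≠ ⊤ ∧
      ∀ U : Submodule K V, (∀ v ∈ U, N v ∈ U) → U ≠ ⊤ → ¬W < U := by
  obtain ⟨W, ⟨hW, hne⟩, hmax⟩ := set_has_maximal_iff_noetherian.2 (inferInstance : IsNoetherian K V)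
    {W | (∀ v ∈ W, N v ∈ W) ∧ W ≠ ⊤}
    ⟨⊥, fun v hv => by rw [(Submodule.mem_bot K).1 hv, map_zero]; exact zero_mem _, bot_ne_top⟩
  exact ⟨W, hW, hne, fun U hU hUne => hmax U ⟨hU, hUne⟩⟩

end Stable

section StableOperators

variable {k K V : Type*} [Ring k] [Ring K] [AddCommGroup V] [Module k V] [Module K V] [SMul k K]
  [IsScalarTower k K V]

/-- The restriction of a `k`-linear operator to a stable `K`-submodule. -/
def restrictOp (N : V →ₗ[k] V) (W : Submodule K V) (hW : ∀ w ∈ W, N w ∈ W) : W →ₗ[k] W :=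
  N.restrict (p := W.restrictScalars k) (q := W.restrictScalars k) hW

/-- The operator induced by a `k`-linear operator on the quotient by a stable `K`-submodule. -/
def quotientOp (N : V →ₗ[k] V) (W : Submodule K V) (hW : ∀ w ∈ W, N w ∈ W) : V ⧸ W →ₗ[k] V ⧸ W :=
  let e := Submodule.Quotient.restrictScalarsEquiv k W
  e.toLinearMap ∘ₗ (W.restrictScalars k).mapQ (W.restrictScalars k) N hW ∘ₗ e.symm.toLinearMap

end StableOperators

namespace FormalConnection

variable {k : Type u} [Field k]

/-- The subobject on a stable subspace. -/
def sub (E : FormalConnection k) (W : Submodule (LaurentSeries k) E.carrier)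
    (hW : ∀ w ∈ W, E.nabla w ∈ W) : FormalConnection k where
  carrier := W
  nabla := restrictOp E.nabla W hW
  leibniz f v := Subtype.ext (E.leibniz f v)

/-- The inclusion of a subobject. -/
def subι (E : FormalConnection k) (W : Submodule (LaurentSeries k) E.carrier)
    (hW : ∀ w ∈ W, E.nabla w ∈ W) : E.sub W hW ⟶ E :=
  (⟨W.subtype, fun _ => rfl⟩ : Hom (E.sub W hW) E)

/-- The quotient by a stable subspace. -/
def quot (E : FormalConnection k) (W : Submodule (LaurentSeries k) E.carrier)
    (hW : ∀ w ∈ W, E.nabla w ∈ W) : FormalConnection k where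
  carrier := E.carrier ⧸ W
  nabla := quotientOp E.nabla W hW
  leibniz f v := by
    obtain ⟨v, rfl⟩ := W.mkQ_surjective v
    exact congrArg W.mkQ (E.leibniz f v)

/-- The projection to a quotient. -/
def quotπ (E : FormalConnection k) (W : Submodule (LaurentSeries k) E.carrier)
    (hW : ∀ w ∈ W, E.nabla w ∈ W) : E ⟶ E.quot W hW :=
  (⟨W.mkQ, fun _ => rfl⟩ : Hom E (E.quot W hW))

/-- A bijective horizontal map, as an isomorphism. -/
def isoOfBijective {E E' : FormalConnection k} (f : E ⟶ E')
    (hf : Function.Bijective f.toLinearMap) : E ≅ E' :=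
  let e := LinearEquiv.ofBijective f.toLinearMap hf
  { hom := f
    inv := (⟨e.symm.toLinearMap, fun v => e.symm_apply_eq.2 <| by
      rw [LinearEquiv.ofBijective_apply, f.horizontal]
      exact congrArg E'.nabla (e.apply_symm_apply v).symm⟩ : Hom E' E)
    hom_inv_id := Hom.ext (LinearMap.ext e.symm_apply_apply)
    inv_hom_id := Hom.ext (LinearMap.ext e.apply_symm_apply) }

theorem bijective_of_iso {E E' : FormalConnection k} (f : E ≅ E') :
    Function.Bijective f.hom.toLinearMap :=
  Function.bijective_iff_has_inverse.2 ⟨f.inv.toLinearMap,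
    LinearMap.congr_fun (congrArg Hom.toLinearMap f.hom_inv_id),
    LinearMap.congr_fun (congrArg Hom.toLinearMap f.inv_hom_id)⟩

theorem IsIrreducibleComponent.of_injective {S E E' : FormalConnection k}
    (h : S.IsIrreducibleComponent E) (i : E ⟶ E') (hi : Function.Injective i.toLinearMap) :
    S.IsIrreducibleComponent E' := by
  obtain ⟨hS, X, j, p, hj, hp⟩ := h
  exact ⟨hS, X, j ≫ i, p, hi.comp hj, hp⟩

theorem IsIrreducible.isIrreducibleComponent {S E : FormalConnection k} (h : S.IsIrreducible)
    (p : E ⟶ S) (hp : Function.Surjective p.toLinearMap) : S.IsIrreducibleComponent E :=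
  ⟨h, E, 𝟙 E, p, Function.injective_id, hp⟩

theorem IsIrreducibleComponent.of_exact {E₁ E E₂ S : FormalConnection k} (i : E₁ ⟶ E) (π : E ⟶ E₂)
    (hi : Function.Injective i.toLinearMap) (hex : Function.Exact i.toLinearMap π.toLinearMap)
    (h₂ : E₂.IsIrreducible) (h : S.IsIrreducibleComponent E) :
    S.IsIrreducibleComponent E₁ ∨ Nonempty (S ≅ E₂) := by
  obtain ⟨hS, X, j, p, hj, hp⟩ := h
  let ρ : X ⟶ E₂ := j ≫ π
  have hker := apply_mem_ker ρ.horizontal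
  have := hS.1
  rcases hS.2 _ (apply_mem_map p.horizontal hker) with hbot | htop
  · obtain ⟨u, hu, hbij⟩ := IsSimpleUnder.exists_bijective_of_ker_le h₂ ρ.horizontal
      p.horizontal hp (Submodule.map_le_iff_le_comap.1 hbot.le)
    exact .inr ⟨(isoOfBijective (⟨u, hu⟩ : Hom E₂ S) hbij).symm⟩
  · let j₁ := LinearMap.codRestrictOfInjective
      (j.toLinearMap ∘ₗ (LinearMap.ker ρ.toLinearMap).subtype) i.toLinearMap hi
      fun x => (hex _).1 (LinearMap.mem_ker.1 x.2)
    have hj₁ : ∀ x, i.toLinearMap (j₁ x) = j.toLinearMap x :=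
      LinearMap.codRestrictOfInjective_comp_apply _ _ _ _
    refine .inl ⟨hS, X.sub _ hker, (⟨j₁, fun x => hi ?_⟩ : Hom (X.sub _ hker) E₁),
      X.subι _ hker ≫ p, fun x y hxy => ?_, fun s => ?_⟩
    · rw [i.horizontal]
      exact (hj₁ _).trans ((j.horizontal _).trans (congrArg E.nabla (hj₁ x).symm))
    · exact Subtype.ext (hj ((hj₁ x).symm.trans ((congrArg i.toLinearMap hxy).trans (hj₁ y))))
    · obtain ⟨x, hx, rfl⟩ : s ∈ (LinearMap.ker ρ.toLinearMap).map p.toLinearMap :=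
        htop ▸ Submodule.mem_top
      exact ⟨⟨x, hx⟩, rfl⟩

theorem exists_isIrreducible_quot (E : FormalConnection k) [Nontrivial E.carrier] :
    ∃ (W : Submodule (LaurentSeries k) E.carrier) (hW : ∀ w ∈ W, E.nabla w ∈ W),
      W ≠ ⊤ ∧ (E.quot W hW).IsIrreducible := by
  obtain ⟨W, hW, hne, hmax⟩ := exists_maximal_stable (K := LaurentSeries k) E.nabla
  have hker : LinearMap.ker (E.quotπ W hW).toLinearMap = W := W.ker_mkQ
  exact ⟨W, hW, hne, isSimpleUnder_of_maximal_ker (E.quotπ W hW).horizontal W.mkQ_surjective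
    (by rwa [hker]) (by rwa [hker])⟩

end FormalConnection

namespace DifferenceModule

variable {k : Type u} [Field k]

theorem mem_of_Phi_mem (D : DifferenceModule k) {W : Submodule (LaurentSeries k) D.carrier}
    (hW : ∀ w ∈ W, D.Phi w ∈ W) {v : D.carrier} (hv : D.Phi v ∈ W) : v ∈ W := by
  let Φ : D.carrier →ₛₗ[phi k] D.carrier := { D.Phi with map_smul' := D.Phi_smul }
  have hΦ : Function.Surjective Φ := D.bijective.2
  rw [eq_comap_of_le_comap hΦ hW]
  exact hv

/-- The subobject on a stable subspace. -/
def sub (D : DifferenceModule k) (W : Submodule (LaurentSeries k) D.carrier)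
    (hW : ∀ w ∈ W, D.Phi w ∈ W) : DifferenceModule k where
  carrier := W
  Phi := restrictOp D.Phi W hW
  Phi_smul f v := Subtype.ext (D.Phi_smul f v)
  bijective := by
    refine ⟨fun v w h => Subtype.ext (D.bijective.1 (congrArg Subtype.val h)), fun w => ?_⟩
    obtain ⟨v, hv⟩ := D.bijective.2 w
    exact ⟨⟨v, D.mem_of_Phi_mem hW (hv.symm ▸ w.2)⟩, Subtype.ext hv⟩

/-- The inclusion of a subobject. -/
def subι (D : DifferenceModule k) (W : Submodule (LaurentSeries k) D.carrier)
    (hW : ∀ w ∈ W, D.Phi w ∈ W) : D.sub W hW ⟶ D :=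
  (⟨W.subtype, fun _ => rfl⟩ : Hom (D.sub W hW) D)

/-- The quotient by a stable subspace. -/
def quot (D : DifferenceModule k) (W : Submodule (LaurentSeries k) D.carrier)
    (hW : ∀ w ∈ W, D.Phi w ∈ W) : DifferenceModule k where
  carrier := D.carrier ⧸ W
  Phi := quotientOp D.Phi W hW
  Phi_smul f v := by
    obtain ⟨v, rfl⟩ := W.mkQ_surjective v
    exact congrArg W.mkQ (D.Phi_smul f v)
  bijective := by
    refine ⟨(injective_iff_map_eq_zero _).2 fun v hv => ?_, fun v => ?_⟩
    all_goals obtain ⟨v, rfl⟩ := W.mkQ_surjective v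
    · have hmem : D.Phi v ∈ W := (Submodule.Quotient.mk_eq_zero W).1 hv
      exact (Submodule.Quotient.mk_eq_zero W).2 (D.mem_of_Phi_mem hW hmem)
    · obtain ⟨w, rfl⟩ := D.bijective.2 v
      exact ⟨W.mkQ w, rfl⟩

/-- The projection to a quotient. -/
def quotπ (D : DifferenceModule k) (W : Submodule (LaurentSeries k) D.carrier)
    (hW : ∀ w ∈ W, D.Phi w ∈ W) : D ⟶ D.quot W hW :=
  (⟨W.mkQ, fun _ => rfl⟩ : Hom D (D.quot W hW))

/-- A bijective morphism, as an isomorphism. -/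
def isoOfBijective {D D' : DifferenceModule k} (f : D ⟶ D')
    (hf : Function.Bijective f.toLinearMap) : D ≅ D' :=
  let e := LinearEquiv.ofBijective f.toLinearMap hf
  { hom := f
    inv := (⟨e.symm.toLinearMap, fun v => e.symm_apply_eq.2 <| by
      rw [LinearEquiv.ofBijective_apply, f.comm]
      exact congrArg D'.Phi (e.apply_symm_apply v).symm⟩ : Hom D' D)
    hom_inv_id := Hom.ext (LinearMap.ext e.symm_apply_apply)
    inv_hom_id := Hom.ext (LinearMap.ext e.apply_symm_apply) }

theorem bijective_of_iso {D D' : DifferenceModule k} (f : D ≅ D') :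
    Function.Bijective f.hom.toLinearMap :=
  Function.bijective_iff_has_inverse.2 ⟨f.inv.toLinearMap,
    LinearMap.congr_fun (congrArg Hom.toLinearMap f.hom_inv_id),
    LinearMap.congr_fun (congrArg Hom.toLinearMap f.inv_hom_id)⟩

theorem IsIrreducibleComponent.of_injective {S D D' : DifferenceModule k}
    (h : S.IsIrreducibleComponent D) (i : D ⟶ D') (hi : Function.Injective i.toLinearMap) :
    S.IsIrreducibleComponent D' := by
  obtain ⟨hS, X, j, p, hj, hp⟩ := h
  exact ⟨hS, X, j ≫ i, p, hi.comp hj, hp⟩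

theorem IsIrreducible.isIrreducibleComponent {S D : DifferenceModule k} (h : S.IsIrreducible)
    (p : D ⟶ S) (hp : Function.Surjective p.toLinearMap) : S.IsIrreducibleComponent D :=
  ⟨h, D, 𝟙 D, p, Function.injective_id, hp⟩

theorem IsIrreducibleComponent.of_exact {D₁ D D₂ S : DifferenceModule k} (i : D₁ ⟶ D) (π : D ⟶ D₂)
    (hi : Function.Injective i.toLinearMap) (hex : Function.Exact i.toLinearMap π.toLinearMap)
    (h₂ : D₂.IsIrreducible) (h : S.IsIrreducibleComponent D) :
    S.IsIrreducibleComponent D₁ ∨ Nonempty (S ≅ D₂) := by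
  obtain ⟨hS, X, j, p, hj, hp⟩ := h
  let ρ : X ⟶ D₂ := j ≫ π
  have hker := apply_mem_ker ρ.comm
  have := hS.1
  rcases hS.2 _ (apply_mem_map p.comm hker) with hbot | htop
  · obtain ⟨u, hu, hbij⟩ := IsSimpleUnder.exists_bijective_of_ker_le h₂ ρ.comm
      p.comm hp (Submodule.map_le_iff_le_comap.1 hbot.le)
    exact .inr ⟨(isoOfBijective (⟨u, hu⟩ : Hom D₂ S) hbij).symm⟩
  · let j₁ := LinearMap.codRestrictOfInjective
      (j.toLinearMap ∘ₗ (LinearMap.ker ρ.toLinearMap).subtype) i.toLinearMap hi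
      fun x => (hex _).1 (LinearMap.mem_ker.1 x.2)
    have hj₁ : ∀ x, i.toLinearMap (j₁ x) = j.toLinearMap x :=
      LinearMap.codRestrictOfInjective_comp_apply _ _ _ _
    refine .inl ⟨hS, X.sub _ hker, (⟨j₁, fun x => hi ?_⟩ : Hom (X.sub _ hker) D₁),
      X.subι _ hker ≫ p, fun x y hxy => ?_, fun s => ?_⟩
    · rw [i.comm]
      exact (hj₁ _).trans ((j.comm _).trans (congrArg D.Phi (hj₁ x).symm))
    · exact Subtype.ext (hj ((hj₁ x).symm.trans ((congrArg i.toLinearMap hxy).trans (hj₁ y))))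
    · obtain ⟨x, hx, rfl⟩ : s ∈ (LinearMap.ker ρ.toLinearMap).map p.toLinearMap :=
        htop ▸ Submodule.mem_top
      exact ⟨⟨x, hx⟩, rfl⟩

theorem exists_isIrreducible_quot (D : DifferenceModule k) [Nontrivial D.carrier] :
    ∃ (W : Submodule (LaurentSeries k) D.carrier) (hW : ∀ w ∈ W, D.Phi w ∈ W),
      W ≠ ⊤ ∧ (D.quot W hW).IsIrreducible := by
  obtain ⟨W, hW, hne, hmax⟩ := exists_maximal_stable (K := LaurentSeries k) D.Phi
  have hker : LinearMap.ker (D.quotπ W hW).toLinearMap = W := W.ker_mkQ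
  exact ⟨W, hW, hne, isSimpleUnder_of_maximal_ker (D.quotπ W hW).comm W.mkQ_surjective
    (by rwa [hker]) (by rwa [hker])⟩

end DifferenceModule

section ClosedSubspaces

variable {k : Type*} [Field k]
variable {V : Type*} [AddCommGroup V] [Module k V] [Module (LaurentSeries k) V]
  [IsScalarTower k (LaurentSeries k) V] [FiniteDimensional (LaurentSeries k) V]
variable {M : Type*} [AddCommGroup M] [Module k M] [Module (LaurentSeries k) M]
  [IsScalarTower k (LaurentSeries k) M] [FiniteDimensional (LaurentSeries k) M]

theorem AdicContinuous.smul_mem_of_xpow {e : V →ₗ[k] M} (he : AdicContinuous e)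
    {Y : Submodule (LaurentSeries k) M} {v : V} (h : ∀ n, e (xpow k n • v) ∈ Y)
    (f : LaurentSeries k) : e (f • v) ∈ Y := by
  have hzero := ((adicContinuous_restrictScalars Y.mkQ).comp
    (he.comp (adicContinuous_smulVec v))).eq_zero_of_xpow fun n =>
      (Submodule.Quotient.mk_eq_zero Y).2 (h n)
  exact (Submodule.Quotient.mk_eq_zero Y).1 (LinearMap.congr_fun hzero f)

theorem exists_forall_add_notMem {F : ℤ → Submodule k V} (hF : Cofinal F (adicFiltration k V))
    {X : Submodule (LaurentSeries k) V} {v : V} (hv : v ∉ X) : ∃ n, ∀ x ∈ X, v + x ∉ F n := by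
  obtain ⟨m, hm⟩ : ∃ m, X.mkQ v ∉ adicFiltration k (V ⧸ X) m := by
    by_contra! h
    exact hv ((Submodule.Quotient.mk_eq_zero X).1 (eq_zero_of_forall_mem_basisFiltration _ h))
  obtain ⟨n, hn⟩ :=
    (adicContinuous_iff hF (Cofinal.refl _)).1 (adicContinuous_restrictScalars X.mkQ) m
  refine ⟨n, fun x hx hmem => hm ?_⟩
  have hvx : X.mkQ (v + x) = X.mkQ v := by
    rw [map_add, Submodule.mkQ_apply, Submodule.mkQ_apply, (Submodule.Quotient.mk_eq_zero X).2 hx,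
      add_zero]
  exact hvx ▸ hn _ hmem

namespace Linearizes

variable {P : V →ₗ[k] V} {Q : M →ₗ[k] M} {e : V ≃ₗ[k] M}

theorem isSimpleUnder (hP : Linearizes P e) (hQ : Linearizes Q e.symm)
    (hV : IsSimpleUnder (LaurentSeries k) P)
    (hQinv : ∀ Y : Submodule (LaurentSeries k) M, (∀ m ∈ Y, Q m ∈ Y) → ∀ m, Q m ∈ Y → m ∈ Y) :
    IsSimpleUnder (LaurentSeries k) Q := by
  have := hV.1
  refine ⟨e.symm.toEquiv.nontrivial, fun Y hY => ?_⟩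
  have apply_xpow_neg_one (v : V) : e (xpow k (-1) • v) = Q (e v) := by
    simpa only [LinearEquiv.symm_symm, e.symm_apply_apply] using
      hQ.symm_apply_xpow_neg_one_smul v
  have apply_xpow (n : ℤ) {v : V} (hv : e v ∈ Y) : e (xpow k n • v) ∈ Y := by
    induction n using Int.induction_on with
    | zero => rwa [xpow_zero, one_smul]
    | succ n ih =>
      refine hQinv Y hY _ ?_
      rwa [← apply_xpow_neg_one, ← mul_smul, xpow_mul_xpow, neg_add_cancel_comm_assoc]
    | pred n ih =>
      rw [sub_eq_neg_add, ← xpow_mul_xpow, mul_smul, apply_xpow_neg_one]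
      exact hY _ ih
  let X : Submodule (LaurentSeries k) V :=
    { (Y.restrictScalars k).comap e.toLinearMap with
      smul_mem' := fun f _ hv => hP.continuous.smul_mem_of_xpow (fun n => apply_xpow n hv) f }
  have hX (v : V) : v ∈ X ↔ e v ∈ Y := Iff.rfl
  have hPX : ∀ v ∈ X, P v ∈ X := fun v hv => by
    rw [hX, hP.map_apply]
    exact Y.smul_mem _ hv
  refine (hV.2 X hPX).imp (fun h => eq_bot_iff.2 fun m hm => ?_) fun h => eq_top_iff.2 fun m _ => ?_
  all_goals obtain ⟨v, rfl⟩ := e.surjective m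
  · rw [← hX, h, Submodule.mem_bot] at hm
    rw [hm, map_zero]
    exact zero_mem _
  · rw [← hX, h]
    exact Submodule.mem_top

end Linearizes

end ClosedSubspaces

section LeadingCoefficients

variable {k : Type*} [Field k]

theorem mem_ordGE_add_one_iff {n : ℤ} {f : LaurentSeries k} :
    f ∈ ordGE k (n + 1) ↔ f ∈ ordGE k n ∧ f.coeff n = 0 := by
  refine ⟨fun h => ⟨ordGE_anti (by lia) h, h n (by lia)⟩, fun ⟨h, h₀⟩ m hm => ?_⟩
  rcases (Int.lt_add_one_iff.1 hm).lt_or_eq with hlt | rfl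
  · exact h m hlt
  · exact h₀

theorem mem_of_forall_exists_mem_ordGE {X : Submodule k (LaurentSeries k)} {v : LaurentSeries k}
    (hclosed : v ∉ X → ∃ n, ∀ x ∈ X, v + x ∉ ordGE k n)
    (happrox : ∀ n, ∀ x ∈ X, v + x ∈ ordGE k n → ∃ y ∈ X, v + y ∈ ordGE k (n + 1)) : v ∈ X := by
  by_contra hv
  obtain ⟨n, hn⟩ := hclosed hv
  have hexists (j : ℕ) : ∃ x ∈ X, v + x ∈ ordGE k (v.order + j) := by
    induction j with
    | zero => exact ⟨0, zero_mem X, by simpa using mem_ordGE_order v⟩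
    | succ j ih =>
      obtain ⟨x, hx, hvx⟩ := ih
      rw [Nat.cast_succ, ← add_assoc]
      exact happrox _ x hx hvx
  obtain ⟨x, hx, hvx⟩ := hexists (n - v.order).toNat
  exact hn x hx (ordGE_anti (by lia) hvx)

namespace RaisesOrder

variable {d : ℤ} {A : LaurentSeries k →ₗ[k] LaurentSeries k}

theorem iterate_mem_ordGE (hA : RaisesOrder d A) {n : ℤ} {f : LaurentSeries k}
    (hf : f ∈ ordGE k n) (j : ℕ) : A^[j] f ∈ ordGE k (n + j * d) := by
  induction j with
  | zero => simpa using hf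
  | succ j ih =>
    rw [Function.iterate_succ_apply', Nat.cast_succ, add_one_mul, ← add_assoc]
    exact hA ih

theorem coeff_iterate_ne_zero (hA : RaisesOrder d A)
    (hlead : ∀ n, (A (xpow k n)).coeff (n + d) ≠ 0) {n : ℤ} {f : LaurentSeries k}
    (hf : f ∈ ordGE k n) (hfn : f.coeff n ≠ 0) (j : ℕ) : (A^[j] f).coeff (n + j * d) ≠ 0 := by
  induction j with
  | zero => simpa using hfn
  | succ j ih =>
    rw [Function.iterate_succ_apply', Nat.cast_succ, add_one_mul, ← add_assoc,
      hA.coeff_apply_add (hA.iterate_mem_ordGE hf j)]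
    exact mul_ne_zero ih (hlead _)

/-- If `v + x` with `x ∈ X` has order `n`, then so has
`x ^ (-(j + 1) d) A ^ (j + 1) (v + x) ∈ X`, and subtracting a multiple of it approximates `v` by `X`
one order better. -/
theorem mem_of_apply_mem (hA : RaisesOrder d A) (hlead : ∀ n, (A (xpow k n)).coeff (n + d) ≠ 0)
    (j : ℕ) {X : Submodule k (LaurentSeries k)}
    (hxX : ∀ x ∈ X, xpow k (-((j + 1 : ℕ) * d)) * x ∈ X) (hAX : ∀ x ∈ X, A x ∈ X)
    {v : LaurentSeries k} (hclosed : v ∉ X → ∃ n, ∀ x ∈ X, v + x ∉ ordGE k n) (hv : A v ∈ X) :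
    v ∈ X := by
  refine mem_of_forall_exists_mem_ordGE hclosed fun n x hx hvx => ?_
  by_cases hlast : (v + x).coeff n = 0
  · exact ⟨x, hx, mem_ordGE_add_one_iff.2 ⟨hvx, hlast⟩⟩
  let y := xpow k (-((j + 1 : ℕ) * d)) * A^[j + 1] (v + x)
  have hy_mem : y ∈ X := by
    have hvxX : A (v + x) ∈ X := by
      rw [map_add]
      exact add_mem hv (hAX x hx)
    exact hxX _ (Set.MapsTo.iterate hAX j hvxX)
  have hy : y ∈ ordGE k n := by
    refine ordGE_anti (le_of_eq ?_)
      (ordGE_mul (xpow_mem_ordGE _) (hA.iterate_mem_ordGE hvx (j + 1)))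
    ring
  have hyn : y.coeff n ≠ 0 := by
    rw [coeff_xpow_mul, sub_neg_eq_add]
    exact hA.coeff_iterate_ne_zero hlead hvx hlast (j + 1)
  let c := (v + x).coeff n / y.coeff n
  refine ⟨x - c • y, sub_mem hx (X.smul_mem c hy_mem), mem_ordGE_add_one_iff.2 ?_⟩
  rw [← add_sub_assoc, HahnSeries.coeff_sub, HahnSeries.coeff_smul, smul_eq_mul,
    div_mul_cancel₀ _ hyn, sub_self]
  exact ⟨sub_mem hvx (Submodule.smul_mem _ c hy), rfl⟩

end RaisesOrder

end LeadingCoefficients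

section Irreducible

variable {k : Type u} [Field k]

theorem FormalConnection.isIrreducible_iff {E : FormalConnection k} :
    E.IsIrreducible ↔ IsSimpleUnder (LaurentSeries k) E.euler := by
  refine and_congr_right fun _ => forall_congr' fun W => imp_congr_left ⟨fun h w hw => ?_,
    fun h w hw => ?_⟩
  · exact W.smul_mem _ (h w hw)
  · rw [E.nabla_eq]
    exact W.smul_mem _ (h w hw)

theorem IsMellinTransform.isIrreducible {E : FormalConnection k} {D : DifferenceModule k}
    {e : E.carrier ≃ₗ[k] D.carrier} (h : IsMellinTransform E D e) (hE : E.IsIrreducible) :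
    D.IsIrreducible :=
  h.linearizes_euler.isSimpleUnder h.linearizes_Phi (FormalConnection.isIrreducible_iff.1 hE)
    fun _ hY _ => D.mem_of_Phi_mem hY

theorem mem_of_euler_E_mem [CharZero k] {q p : ℕ+} {f : LaurentSeries k}
    (hf : f.order = -((p : ℕ) : ℤ))
    {X : Submodule (LaurentSeries k) (FormalConnection.E q f).carrier}
    (hX : ∀ v ∈ X, (FormalConnection.E q f).euler v ∈ X) {v : (FormalConnection.E q f).carrier}
    (hv : (FormalConnection.E q f).euler v ∈ X) : v ∈ X := by
  have hp : -((p : ℕ) : ℤ) ≠ 0 := by simp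
  have hf₀ : f ≠ 0 := by
    rintro rfl
    exact hp (hf.symm.trans HahnSeries.order_zero)
  have hlead (n) : (connectionOp q f (xpow k n)).coeff (n + -((p : ℕ) : ℤ)) ≠ 0 := by
    rw [coeff_connectionOp_xpow hp, ← hf]
    exact HahnSeries.coeff_order_eq_zero.not.2 hf₀
  let X₀ : Submodule (LaurentSeries k) (RamExt k q) := X
  have hraise := (isPolynomial_connectionOp (by lia) q (hf ▸ mem_ordGE_order f)).raisesOrder
  refine hraise.mem_of_apply_mem hlead q.natPred (X := X₀.restrictScalars k) (fun x hx => ?_)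
    (fun x hx => euler_E q f x ▸ hX x hx)
    (exists_forall_add_notMem (X := X₀) (cofinal_ramFiltration q)) (euler_E q f v ▸ hv)
  have hmem := X₀.smul_mem (xpow k p) hx
  rw [q.natPred_add_one, ← mul_neg, neg_neg]
  exact xpow_smul_ramExt (k := k) q p x ▸ hmem

theorem IsMellinTransform.isIrreducible_E [CharZero k] {q p : ℕ+} {f : LaurentSeries k}
    (hf : f.order = -((p : ℕ) : ℤ)) {D : DifferenceModule k}
    {e : (FormalConnection.E q f).carrier ≃ₗ[k] D.carrier}
    (h : IsMellinTransform (FormalConnection.E q f) D e) (hD : D.IsIrreducible) :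
    (FormalConnection.E q f).IsIrreducible :=
  FormalConnection.isIrreducible_iff.2 <| h.linearizes_Phi.isSimpleUnder h.linearizes_euler hD
    fun _ hX _ => mem_of_euler_E_mem hf hX

end Irreducible

/-! ### The equivalence -/

section SlopesAndOrders

theorem exists_order_eq_neg {R : Type*} [Zero R] {f : LaurentSeries R} (hf : f.order < 0) :
    ∃ p : ℕ+, f.order = -((p : ℕ) : ℤ) :=
  ⟨⟨(-f.order).toNat, by lia⟩, by simp only [PNat.mk_coe]; lia⟩

variable {k : Type u} [Field k]

theorem IsSimpleUnder.of_bijective {K V V' : Type*} [Ring K] [AddCommGroup V] [Module k V]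
    [Module K V] [AddCommGroup V'] [Module k V'] [Module K V'] {N : V →ₗ[k] V} {N' : V' →ₗ[k] V'}
    (hN : IsSimpleUnder K N) {f : V →ₗ[K] V'} (hf : ∀ v, f (N v) = N' (f v))
    (hbij : Function.Bijective f) : IsSimpleUnder K N' := by
  have := hN.1
  refine isSimpleUnder_of_maximal_ker hf hbij.2 ?_ fun U hU hne hlt =>
    (hN.2 U hU).elim (fun h => not_lt_bot (h ▸ hlt)) hne
  rw [LinearMap.ker_eq_bot.2 hbij.1]
  exact bot_ne_top

namespace FormalConnection

theorem IsIrreducible.of_iso {E E' : FormalConnection k} (h : E.IsIrreducible) (j : E ≅ E') :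
    E'.IsIrreducible :=
  IsSimpleUnder.of_bijective (N := E.nabla) (N' := E'.nabla) h j.hom.horizontal (bijective_of_iso j)

variable [CharZero k]

theorem exists_pos_hasSlope_iff {S : FormalConnection k} : (∃ s, 0 < s ∧ S.HasSlope s) ↔
    ∃ (q p : ℕ+) (f : LaurentSeries k), f.order = -((p : ℕ) : ℤ) ∧ Nonempty (S ≅ E q f) := by
  constructor
  · rintro ⟨_, hs, q, f, hS, rfl⟩
    have hf : (f.order : ℚ) / (q : ℕ) < 0 :=
      neg_pos.1 ((lt_max_iff.1 hs).resolve_left (lt_irrefl _))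
    have hf' : f.order < 0 := by
      exact_mod_cast (div_lt_iff₀ (by exact_mod_cast q.pos)).1 hf |>.trans_eq (zero_mul _)
    obtain ⟨p, hp⟩ := exists_order_eq_neg hf'
    exact ⟨q, p, f, hp, hS⟩
  · rintro ⟨q, p, f, hf, hS⟩
    refine ⟨_, lt_max_of_lt_right ?_, q, f, hS, rfl⟩
    rw [hf, Int.cast_neg, Int.cast_natCast, neg_div, neg_neg]
    exact div_pos (by exact_mod_cast p.pos) (by exact_mod_cast q.pos)

theorem posSlope_of_subsingleton (E : FormalConnection k) [Subsingleton E.carrier] :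
    posSlope k E := by
  rintro S ⟨hS, X, i, π, hi, hπ⟩
  have := hi.subsingleton
  have := hπ.subsingleton
  exact (not_nontrivial S.carrier hS.1).elim

theorem posSlope_of_exact {E₁ E : FormalConnection k} {q p : ℕ+} {f : LaurentSeries k}
    {i : E₁ ⟶ E} {π : E ⟶ FormalConnection.E q f} (hi : Function.Injective i.toLinearMap)
    (hex : Function.Exact i.toLinearMap π.toLinearMap) (h₁ : posSlope k E₁)
    (hirr : (FormalConnection.E q f).IsIrreducible) (hf : f.order = -((p : ℕ) : ℤ)) :
    posSlope k E := fun S hS =>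
  (hS.of_exact i π hi hex hirr).elim (h₁ S) fun hS₂ =>
    exists_pos_hasSlope_iff.2 ⟨q, p, f, hf, hS₂⟩

theorem exists_exact_of_posSlope {E : FormalConnection k} [Nontrivial E.carrier]
    (hE : posSlope k E) : ∃ (E₁ : FormalConnection k) (q p : ℕ+) (f : LaurentSeries k)
      (i : E₁ ⟶ E) (π : E ⟶ FormalConnection.E q f),
      Function.Injective i.toLinearMap ∧ Function.Surjective π.toLinearMap ∧
      Function.Exact i.toLinearMap π.toLinearMap ∧
      Module.finrank (LaurentSeries k) E₁.carrier < Module.finrank (LaurentSeries k) E.carrier ∧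
      posSlope k E₁ ∧ (FormalConnection.E q f).IsIrreducible ∧ f.order = -((p : ℕ) : ℤ) := by
  obtain ⟨W, hW, hne, hirr⟩ := E.exists_isIrreducible_quot
  obtain ⟨q, p, f, hf, ⟨j⟩⟩ := exists_pos_hasSlope_iff.1 <|
    hE _ (hirr.isIrreducibleComponent (E.quotπ W hW) W.mkQ_surjective)
  have hj := bijective_of_iso j
  have hex : Function.Exact (E.subι W hW).toLinearMap (E.quotπ W hW).toLinearMap :=
    LinearMap.exact_subtype_mkQ W
  exact ⟨E.sub W hW, q, p, f, E.subι W hW, E.quotπ W hW ≫ j.hom, Subtype.val_injective,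
    hj.2.comp W.mkQ_surjective, hex.comp_injective j.hom.toLinearMap hj.1 (map_zero _),
    Submodule.finrank_lt hne,
    fun S hS => hE S (hS.of_injective (E.subι W hW) Subtype.val_injective), hirr.of_iso j, hf⟩

end FormalConnection

namespace DifferenceModule

theorem IsIrreducible.of_iso {D D' : DifferenceModule k} (h : D.IsIrreducible) (j : D ≅ D') :
    D'.IsIrreducible :=
  IsSimpleUnder.of_bijective (N := D.Phi) (N' := D'.Phi) h j.hom.comm (bijective_of_iso j)

variable [CharZero k]

theorem exists_neg_hasOrder_iff {S : DifferenceModule k} : (∃ r, r < 0 ∧ S.HasOrder r) ↔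
    ∃ (q p : ℕ+) (g : LaurentSeries k) (hg : g ≠ 0),
      g.order = -((p : ℕ) : ℤ) ∧ Nonempty (S ≅ D q g hg) := by
  constructor
  · rintro ⟨_, hr, q, g, hg, hS, rfl⟩
    have hg' : g.order < 0 := by
      exact_mod_cast (div_lt_iff₀ (by exact_mod_cast q.pos)).1 hr |>.trans_eq (zero_mul _)
    obtain ⟨p, hp⟩ := exists_order_eq_neg hg'
    exact ⟨q, p, g, hg, hp, hS⟩
  · rintro ⟨q, p, g, hg, hgp, hS⟩
    refine ⟨_, ?_, q, g, hg, hS, rfl⟩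
    rw [hgp, Int.cast_neg, Int.cast_natCast]
    exact div_neg_of_neg_of_pos (neg_neg_of_pos (by exact_mod_cast p.pos))
      (by exact_mod_cast q.pos)

theorem negOrder_of_subsingleton (D : DifferenceModule k) [Subsingleton D.carrier] :
    negOrder k D := by
  rintro S ⟨hS, X, i, π, hi, hπ⟩
  have := hi.subsingleton
  have := hπ.subsingleton
  exact (not_nontrivial S.carrier hS.1).elim

theorem negOrder_of_exact {D₁ D : DifferenceModule k} {q p : ℕ+} {g : LaurentSeries k} {hg : g ≠ 0}
    {i : D₁ ⟶ D} {π : D ⟶ DifferenceModule.D q g hg} (hi : Function.Injective i.toLinearMap)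
    (hex : Function.Exact i.toLinearMap π.toLinearMap) (h₁ : negOrder k D₁)
    (hirr : (DifferenceModule.D q g hg).IsIrreducible) (hgp : g.order = -((p : ℕ) : ℤ)) :
    negOrder k D := fun S hS =>
  (hS.of_exact i π hi hex hirr).elim (h₁ S) fun hS₂ =>
    exists_neg_hasOrder_iff.2 ⟨q, p, g, hg, hgp, hS₂⟩

theorem exists_exact_of_negOrder {D : DifferenceModule k} [Nontrivial D.carrier]
    (hD : negOrder k D) : ∃ (D₁ : DifferenceModule k) (q p : ℕ+) (g : LaurentSeries k) (hg : g ≠ 0)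
      (i : D₁ ⟶ D) (π : D ⟶ DifferenceModule.D q g hg),
      Function.Injective i.toLinearMap ∧ Function.Surjective π.toLinearMap ∧
      Function.Exact i.toLinearMap π.toLinearMap ∧
      Module.finrank (LaurentSeries k) D₁.carrier < Module.finrank (LaurentSeries k) D.carrier ∧
      negOrder k D₁ ∧ (DifferenceModule.D q g hg).IsIrreducible ∧ g.order = -((p : ℕ) : ℤ) := by
  obtain ⟨W, hW, hne, hirr⟩ := D.exists_isIrreducible_quot
  obtain ⟨q, p, g, hg, hgp, ⟨j⟩⟩ := exists_neg_hasOrder_iff.1 <|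
    hD _ (hirr.isIrreducibleComponent (D.quotπ W hW) W.mkQ_surjective)
  have hj := bijective_of_iso j
  have hex : Function.Exact (D.subι W hW).toLinearMap (D.quotπ W hW).toLinearMap :=
    LinearMap.exact_subtype_mkQ W
  exact ⟨D.sub W hW, q, p, g, hg, D.subι W hW, D.quotπ W hW ≫ j.hom, Subtype.val_injective,
    hj.2.comp W.mkQ_surjective, hex.comp_injective j.hom.toLinearMap hj.1 (map_zero _),
    Submodule.finrank_lt hne,
    fun S hS => hD S (hS.of_injective (D.subι W hW) Subtype.val_injective), hirr.of_iso j, hgp⟩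

end DifferenceModule

end SlopesAndOrders

section Extension

variable {k : Type u} [Field k]

namespace IsMellinTransform

variable {E₁ E E₂ : FormalConnection k} {D₁ D D₂ : DifferenceModule k}
  {e₁ : E₁.carrier ≃ₗ[k] D₁.carrier} {e : E.carrier ≃ₗ[k] D.carrier}
  {e₂ : E₂.carrier ≃ₗ[k] D₂.carrier}

theorem mapHom_injective (h₁ : IsMellinTransform E₁ D₁ e₁) (h : IsMellinTransform E D e)
    {i : E₁ ⟶ E} (hi : Function.Injective i.toLinearMap) :
    Function.Injective (h₁.mapHom h i).toLinearMap :=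
  e.injective.comp (hi.comp e₁.symm.injective)

theorem comapHom_injective (h₁ : IsMellinTransform E₁ D₁ e₁) (h : IsMellinTransform E D e)
    {i : D₁ ⟶ D} (hi : Function.Injective i.toLinearMap) :
    Function.Injective (h₁.comapHom h i).toLinearMap :=
  e.symm.injective.comp (hi.comp e₁.injective)

theorem mapHom_exact (h₁ : IsMellinTransform E₁ D₁ e₁) (h : IsMellinTransform E D e)
    (h₂ : IsMellinTransform E₂ D₂ e₂) {i : E₁ ⟶ E} {π : E ⟶ E₂}
    (hex : Function.Exact i.toLinearMap π.toLinearMap) :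
    Function.Exact (h₁.mapHom h i).toLinearMap (h.mapHom h₂ π).toLinearMap := by
  refine Function.Exact.of_ladder_addEquiv_of_exact (e₁ := e₁.toAddEquiv) (e₂ := e.toAddEquiv)
    (e₃ := e₂.toAddEquiv) (f₁₂ := i.toLinearMap.toAddMonoidHom)
    (f₂₃ := π.toLinearMap.toAddMonoidHom) (g₁₂ := (h₁.mapHom h i).toLinearMap.toAddMonoidHom)
    (g₂₃ := (h.mapHom h₂ π).toLinearMap.toAddMonoidHom) ?_ ?_ hex
  · exact AddMonoidHom.ext (h₁.mapHom_apply h i)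
  · exact AddMonoidHom.ext (h.mapHom_apply h₂ π)

theorem comapHom_exact (h₁ : IsMellinTransform E₁ D₁ e₁) (h : IsMellinTransform E D e)
    (h₂ : IsMellinTransform E₂ D₂ e₂) {i : D₁ ⟶ D} {π : D ⟶ D₂}
    (hex : Function.Exact i.toLinearMap π.toLinearMap) :
    Function.Exact (h₁.comapHom h i).toLinearMap (h.comapHom h₂ π).toLinearMap := by
  refine Function.Exact.of_ladder_addEquiv_of_exact' (e₁ := e₁.toAddEquiv) (e₂ := e.toAddEquiv)
    (e₃ := e₂.toAddEquiv) (g₁₂ := i.toLinearMap.toAddMonoidHom)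
    (g₂₃ := π.toLinearMap.toAddMonoidHom) (f₁₂ := (h₁.comapHom h i).toLinearMap.toAddMonoidHom)
    (f₂₃ := (h.comapHom h₂ π).toLinearMap.toAddMonoidHom) ?_ ?_ hex
  · exact AddMonoidHom.ext fun v => (h₁.comapHom_apply h i v).symm
  · exact AddMonoidHom.ext fun v => (h.comapHom_apply h₂ π v).symm

theorem exists_of_exact_connection (h₁ : IsMellinTransform E₁ D₁ e₁)
    (h₂ : IsMellinTransform E₂ D₂ e₂) {i : E₁ ⟶ E} {π : E ⟶ E₂}
    (hi : Function.Injective i.toLinearMap) (hπ : Function.Surjective π.toLinearMap)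
    (hex : Function.Exact i.toLinearMap π.toLinearMap) :
    ∃ (D : DifferenceModule k) (e : E.carrier ≃ₗ[k] D.carrier) (i' : D₁ ⟶ D) (π' : D ⟶ D₂),
      IsMellinTransform E D e ∧ Function.Injective i'.toLinearMap ∧
      Function.Exact i'.toLinearMap π'.toLinearMap := by
  obtain ⟨e, he⟩ := Linearizes.exists_of_exact hi hπ hex E.adicContinuous_euler
    (fun v => (i.map_euler v).symm) π.map_euler h₁.linearizes_euler h₂.linearizes_euler
  have h := isMellinTransform_differenceModuleOf E e he
  exact ⟨_, e, h₁.mapHom h i, h.mapHom h₂ π, h, h₁.mapHom_injective h hi, h₁.mapHom_exact h h₂ hex⟩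

theorem exists_of_exact_difference (h₁ : IsMellinTransform E₁ D₁ e₁)
    (h₂ : IsMellinTransform E₂ D₂ e₂) {i : D₁ ⟶ D} {π : D ⟶ D₂}
    (hi : Function.Injective i.toLinearMap) (hπ : Function.Surjective π.toLinearMap)
    (hex : Function.Exact i.toLinearMap π.toLinearMap) :
    ∃ (E : FormalConnection k) (e : E.carrier ≃ₗ[k] D.carrier) (i' : E₁ ⟶ E) (π' : E ⟶ E₂),
      IsMellinTransform E D e ∧ Function.Injective i'.toLinearMap ∧
      Function.Exact i'.toLinearMap π'.toLinearMap := by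
  obtain ⟨e, he⟩ := Linearizes.exists_of_exact hi hπ hex D.adicContinuous_Phi
    (fun v => (i.comm v).symm) π.comm h₁.linearizes_Phi h₂.linearizes_Phi
  have h := isMellinTransform_formalConnectionOf D e he
  exact ⟨_, e.symm, h₁.comapHom h i, h.comapHom h₂ π, h, h₁.comapHom_injective h hi,
    h₁.comapHom_exact h h₂ hex⟩

end IsMellinTransform

end Extension

section Existence

variable {k : Type u} [Field k]

theorem linearizes_refl_of_subsingleton {V : Type*} [AddCommGroup V] [Module k V]
    [Module (LaurentSeries k) V] [IsScalarTower k (LaurentSeries k) V]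
    [FiniteDimensional (LaurentSeries k) V] [Subsingleton V] (N : V →ₗ[k] V) :
    Linearizes N (LinearEquiv.refl k V) :=
  ⟨fun _ => Subsingleton.elim _ _, adicContinuous_id, adicContinuous_id⟩

variable [CharZero k] [IsAlgClosed k]

theorem exists_isMellinTransform_of_posSlope (E : FormalConnection k)
    (hE : FormalConnection.posSlope k E) :
    ∃ (D : DifferenceModule k) (e : E.carrier ≃ₗ[k] D.carrier),
      DifferenceModule.negOrder k D ∧ IsMellinTransform E D e := by
  induction hn : Module.finrank (LaurentSeries k) E.carrier using Nat.strong_induction_on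
    generalizing E with
  | _ n ih =>
  subst hn
  rcases subsingleton_or_nontrivial E.carrier with hsub | _
  · let D := differenceModuleOf E _ (linearizes_refl_of_subsingleton E.euler)
    have : Subsingleton D.carrier := hsub
    exact ⟨D, _, D.negOrder_of_subsingleton, isMellinTransform_differenceModuleOf E _ _⟩
  obtain ⟨E₁, q, p, f, i, π, hi, hπ, hex, hlt, hE₁, hirr, hf⟩ :=
    FormalConnection.exists_exact_of_posSlope hE
  obtain ⟨D₁, e₁, hD₁, h₁⟩ := ih _ hlt E₁ hE₁ rfl
  obtain ⟨g, hg, e₂, hgord, h₂⟩ := exists_isMellinTransform_E q p f hf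
  obtain ⟨D, e, i', π', h, hi', hex'⟩ := h₁.exists_of_exact_connection h₂ hi hπ hex
  exact ⟨D, e, DifferenceModule.negOrder_of_exact hi' hex' hD₁ (h₂.isIrreducible hirr) hgord, h⟩

theorem exists_isMellinTransform_of_negOrder (D : DifferenceModule k)
    (hD : DifferenceModule.negOrder k D) :
    ∃ (E : FormalConnection k) (e : E.carrier ≃ₗ[k] D.carrier),
      FormalConnection.posSlope k E ∧ IsMellinTransform E D e := by
  induction hn : Module.finrank (LaurentSeries k) D.carrier using Nat.strong_induction_on
    generalizing D with
  | _ n ih =>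
  subst hn
  rcases subsingleton_or_nontrivial D.carrier with hsub | _
  · let E := formalConnectionOf D _ (linearizes_refl_of_subsingleton D.Phi)
    have : Subsingleton E.carrier := hsub
    exact ⟨E, _, E.posSlope_of_subsingleton, isMellinTransform_formalConnectionOf D _ _⟩
  obtain ⟨D₁, q, p, g, hg, i, π, hi, hπ, hex, hlt, hD₁, hirr, hgp⟩ :=
    DifferenceModule.exists_exact_of_negOrder hD
  obtain ⟨E₁, e₁, hE₁, h₁⟩ := ih _ hlt D₁ hD₁ rfl
  obtain ⟨f, e₂, hf, h₂⟩ := exists_isMellinTransform_D q p g hg hgp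
  obtain ⟨E, e, i', π', h, hi', hex'⟩ := h₁.exists_of_exact_difference h₂ hi hπ hex
  exact ⟨E, e, FormalConnection.posSlope_of_exact hi' hex' hE₁ (h₂.isIrreducible_E hf hirr) hf, h⟩

end Existence

section Functor

variable {k : Type u} [Field k]

theorem IsMellinTransform.mapHom_id_bijective {E : FormalConnection k} {D D' : DifferenceModule k}
    {e : E.carrier ≃ₗ[k] D.carrier} {e' : E.carrier ≃ₗ[k] D'.carrier}
    (h : IsMellinTransform E D e) (h' : IsMellinTransform E D' e') :
    Function.Bijective (h.mapHom h' (𝟙 E)).toLinearMap :=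
  (e.symm.trans e').bijective

theorem FormalConnection.hom_ext_apply {E E' : FormalConnection k} {f g : E ⟶ E'}
    (h : ∀ v, f.toLinearMap v = g.toLinearMap v) : f = g :=
  FormalConnection.Hom.ext (LinearMap.ext h)

theorem DifferenceModule.hom_ext_apply {D D' : DifferenceModule k} {f g : D ⟶ D'}
    (h : ∀ v, f.toLinearMap v = g.toLinearMap v) : f = g :=
  DifferenceModule.Hom.ext (LinearMap.ext h)

variable [CharZero k]

/-- The isomorphism between two Mellin transforms of the same connection that is the identity on
underlying spaces. -/
def IsMellinTransform.isoOfNegOrder {E : FormalConnection k} {D D' : NNeg k}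
    {e : E.carrier ≃ₗ[k] D.obj.carrier} {e' : E.carrier ≃ₗ[k] D'.obj.carrier}
    (h : IsMellinTransform E D.obj e) (h' : IsMellinTransform E D'.obj e') : D ≅ D' :=
  (DifferenceModule.negOrder k).isoMk
    (DifferenceModule.isoOfBijective _ (h.mapHom_id_bijective h'))

theorem IsMellinTransform.isoOfNegOrder_hom_apply {E : FormalConnection k} {D D' : NNeg k}
    {e : E.carrier ≃ₗ[k] D.obj.carrier} {e' : E.carrier ≃ₗ[k] D'.obj.carrier}
    (h : IsMellinTransform E D.obj e) (h' : IsMellinTransform E D'.obj e') (v : E.carrier) :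
    (h.isoOfNegOrder h').hom.hom.toLinearMap (e v) = e' v :=
  h.mapHom_apply h' (𝟙 E) v

theorem IsLocalMellin.nonempty_iso {M M' : CInftyPos k ⥤ NNeg k} (hM : IsLocalMellin M)
    (hM' : IsLocalMellin M') : Nonempty (M ≅ M') := by
  obtain ⟨e, he, hmap⟩ := hM
  obtain ⟨e', he', hmap'⟩ := hM'
  refine ⟨NatIso.ofComponents (fun E => (he E).isoOfNegOrder (he' E)) fun {E E'} f => ?_⟩
  ext1
  refine DifferenceModule.hom_ext_apply fun d => ?_
  obtain ⟨v, rfl⟩ := (e E).surjective d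
  change ((he E').isoOfNegOrder (he' E')).hom.hom.toLinearMap ((M.map f).hom.toLinearMap (e E v)) =
    (M'.map f).hom.toLinearMap (((he E).isoOfNegOrder (he' E)).hom.hom.toLinearMap (e E v))
  rw [hmap, IsMellinTransform.isoOfNegOrder_hom_apply, IsMellinTransform.isoOfNegOrder_hom_apply,
    hmap']

variable [IsAlgClosed k]

/-- The difference module `(V_θ, Φ)` of a connection `E = (V, ∇)` with positive slopes. -/
def mellinObj (E : CInftyPos k) : NNeg k :=
  ⟨(exists_isMellinTransform_of_posSlope E.obj E.property).choose,
    (exists_isMellinTransform_of_posSlope E.obj E.property).choose_spec.choose_spec.1⟩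

/-- The identification of the spaces underlying `E` and its local Mellin transform. -/
def mellinEquiv (E : CInftyPos k) : E.obj.carrier ≃ₗ[k] (mellinObj E).obj.carrier :=
  (exists_isMellinTransform_of_posSlope E.obj E.property).choose_spec.choose

theorem isMellinTransform_mellinEquiv (E : CInftyPos k) :
    IsMellinTransform E.obj (mellinObj E).obj (mellinEquiv E) :=
  (exists_isMellinTransform_of_posSlope E.obj E.property).choose_spec.choose_spec.2

/-- The local Mellin transform `𝓜^(∞,∞)`. -/
def mellin (k : Type u) [Field k] [CharZero k] [IsAlgClosed k] : CInftyPos k ⥤ NNeg k where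
  obj := mellinObj
  map {E E'} f :=
    ⟨(isMellinTransform_mellinEquiv E).mapHom (isMellinTransform_mellinEquiv E') f.hom⟩
  map_id E := by
    ext1
    exact DifferenceModule.hom_ext_apply fun v => (mellinEquiv E).apply_symm_apply v
  map_comp {E E' E''} f g := by
    ext1
    exact DifferenceModule.hom_ext_apply fun v =>
      congrArg (fun w => mellinEquiv E'' (g.hom.toLinearMap w))
        ((mellinEquiv E').symm_apply_apply _).symm

theorem mellin_map_apply {E E' : CInftyPos k} (f : E ⟶ E') (v : E.obj.carrier) :
    ((mellin k).map f).hom.toLinearMap (mellinEquiv E v) = mellinEquiv E' (f.hom.toLinearMap v) :=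
  (isMellinTransform_mellinEquiv E).mapHom_apply (isMellinTransform_mellinEquiv E') f.hom v

theorem isLocalMellin_mellin : IsLocalMellin (mellin k) :=
  ⟨mellinEquiv, isMellinTransform_mellinEquiv, fun _ _ => mellin_map_apply⟩

instance : (mellin k).Faithful where
  map_injective {E E' f g} h := by
    ext1
    refine FormalConnection.hom_ext_apply fun v => (mellinEquiv E').injective ?_
    rw [← mellin_map_apply, ← mellin_map_apply, h]

instance : (mellin k).Full where
  map_surjective {E E'} g := by
    have h := isMellinTransform_mellinEquiv E
    have h' := isMellinTransform_mellinEquiv E'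
    refine ⟨⟨h.comapHom h' g.hom⟩, ?_⟩
    ext1
    refine DifferenceModule.hom_ext_apply fun d => ?_
    obtain ⟨v, rfl⟩ := (mellinEquiv E).surjective d
    rw [mellin_map_apply]
    exact h.comapHom_apply h' g.hom v

instance : (mellin k).EssSurj where
  mem_essImage D := by
    obtain ⟨E, e, hE, h⟩ := exists_isMellinTransform_of_negOrder D.obj D.property
    exact ⟨⟨E, hE⟩, ⟨(isMellinTransform_mellinEquiv ⟨E, hE⟩).isoOfNegOrder h⟩⟩

end Functor

end LocalMellin

end

theorem mainTheorem4 (k : Type u) [Field k] [IsAlgClosed k] [CharZero k] :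
    ∃ M : LocalMellin.CInftyPos k ⥤ LocalMellin.NNeg k,
      LocalMellin.IsLocalMellin M ∧ M.IsEquivalence ∧
      ∀ M' : LocalMellin.CInftyPos k ⥤ LocalMellin.NNeg k,
        LocalMellin.IsLocalMellin M' → Nonempty (M' ≅ M) :=
  ⟨LocalMellin.mellin k, LocalMellin.isLocalMellin_mellin, {}, fun _ hM =>
    hM.nonempty_iso LocalMellin.isLocalMellin_mellin⟩
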